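/- Let $\Omega\subset\mathbb R^n$ be a bounded open set and let $\mathbf A_w,\mathbf A_s$ be symmetric fourth-order elasticity tensors which, as quadratic forms on symmetric $n\times n$ matrices, satisfy $c_i\,\mathrm{Id}\le \mathbf A_i\le c_i'\,\mathrm{Id}$ for some constants $c_i,c_i'>0$, $i\in\{w,s\}$. Let $\kappa>0$, and let $\eta_\varepsilon>0$ ($\varepsilon>0$) satisfy $\eta_\varepsilon\to0$ and $\eta_\varepsilon/\varepsilon\to\alpha=+\infty$ as $\varepsilon\to0^+$. With $e(u)=\frac12(\nabla u+\nabla u^T)$, define on $L^1(\Omega;\mathbb R^n)\times L^1(\Omega)$ $$\mathcal E_\varepsilon(u,\chi)=\frac12\int_\Omega\bigl[\eta_\varepsilon\chi\mathbf A_w+(1-\chi)\mathbf A_s\bigr]e(u):e(u)\,dx+\frac{\kappa}{\varepsilon}\int_\Omega\chi\,dx$$ if $(u,\chi)\in H^1(\Omega;\mathbb R^n)\times L^\infty(\Omega;\{0,1\})$, and $\mathcal E_\varepsilon(u,\chi)=+\infty$ otherwise. Define also $$\Phi_\infty(u,\chi)=\frac12\int_\Omega\mathbf A_s e(u):e(u)\,dx\quad\text{if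 }\chi=0\text{ a.e. and }u\in H^1(\Omega;\mathbb R^n),$$ and $\Phi_\infty(u,\chi)=+\infty$ otherwise. (i) If $\Omega$ has Lipschitz boundary, then the functionals $\mathcal E_\varepsilon$ $\Gamma$-converge to $\Phi_\infty$ as $\varepsilon\to0^+$ with respect to the strong topology of $L^1(\Omega;\mathbb R^n)\times L^1(\Omega)$. (ii) For an arbitrary bounded open set $\Omega$, the $\Gamma$-limit of $\mathcal E_\varepsilon$ (in the same topology) exists and equals $\Phi_\infty(u,\chi)$ at every $(u,\chi)\in L^1(\Omega;\mathbb R^n)\times L^1(\Omega)$, except possibly at those with $\chi=0$ a.e., $u\notin H^1(\Omega;\mathbb R^n)$, and distributional strain $\frac12(Du+Du^T)$ in $L^2(\Omega)$. -/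

import Mathlib

open MeasureTheory Filter Topology
open scoped ENNReal NNReal ContDiff

noncomputable section

namespace BrittleDamage

/-- Euclidean space `ℝⁿ`. -/
abbrev Space (n : ℕ) : Type := EuclideanSpace ℝ (Fin n)

/-- Real `n × n` matrices. -/
abbrev Mat (n : ℕ) : Type := Matrix (Fin n) (Fin n) ℝ

/-- The Frobenius product `ξ : ζ = tr (ξ ζ)` (used on symmetric matrices). -/
def frob {n : ℕ} (ξ ζ : Mat n) : ℝ := (ξ * ζ).trace

/-- Fourth-order tensors, given by their coefficients `A i j k l`. -/
abbrev Tensor4 (n : ℕ) : Type := Fin n → Fin n → Fin n → Fin n → ℝ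

/-- The action `(A ξ) i j = ∑ k l, A i j k l * ξ k l`. -/
def Tensor4.app {n : ℕ} (A : Tensor4 n) (ξ : Mat n) : Mat n :=
  Matrix.of fun i j => ∑ k, ∑ l, A i j k l * ξ k l

/-- Symmetric fourth-order elasticity tensors (minor and major symmetries) with
`c Id ≤ A ≤ c' Id` as quadratic forms on symmetric matrices, for some `c, c' > 0`. -/
structure IsElasticityTensor {n : ℕ} (A : Tensor4 n) : Prop where
  minor_left : ∀ i j k l, A i j k l = A j i k l
  minor_right : ∀ i j k l, A i j k l = A i j l k
  major : ∀ i j k l, A i j k l = A k l i j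
  growth : ∃ c c' : ℝ, 0 < c ∧ 0 < c' ∧ ∀ ξ : Mat n, ξ.IsSymm →
    c * frob ξ ξ ≤ frob (A.app ξ) ξ ∧ frob (A.app ξ) ξ ≤ c' * frob ξ ξ

/-- Real test functions on the open set `Ω`: smooth, compactly supported in `Ω`. -/
structure IsTestFunction {n : ℕ} (Ω : Set (Space n)) (φ : Space n → ℝ) : Prop where
  smooth : ContDiff ℝ ∞ φ
  compact : HasCompactSupport φ
  support : tsupport φ ⊆ Ω

/-- The partial derivative `∂ⱼ φ`. -/
def partialDeriv {n : ℕ} (φ : Space n → ℝ) (j : Fin n) (x : Space n) : ℝ :=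
  fderiv ℝ φ x (EuclideanSpace.single j 1)

/-- `G` is a square integrable weak gradient of `u` on `Ω`: `G x i j = ∂ⱼ uᵢ(x)`. -/
structure IsWeakGradient {n : ℕ} (Ω : Set (Space n)) (u : Space n → Space n)
    (G : Space n → Mat n) : Prop where
  memLp : ∀ i j, MemLp (fun x => G x i j) 2 (volume.restrict Ω)
  integral_eq : ∀ φ, IsTestFunction Ω φ → ∀ i j,
    ∫ x in Ω, u x i * partialDeriv φ j x = -∫ x in Ω, G x i j * φ x

/-- `u ∈ H¹(Ω; ℝⁿ)`. -/
def MemH1 {n : ℕ} (Ω : Set (Space n)) (u : Space n → Space n) : Prop :=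
  MemLp u 2 (volume.restrict Ω) ∧ ∃ G, IsWeakGradient Ω u G

open Classical in
/-- The weak gradient `∇u` of `u ∈ H¹(Ω; ℝⁿ)`, unique up to null sets
(only used for such `u`). -/
def weakGradient {n : ℕ} (Ω : Set (Space n)) (u : Space n → Space n) : Space n → Mat n :=
  if h : ∃ G, IsWeakGradient Ω u G then h.choose else 0

/-- The linearized strain `e(u) = (∇u + ∇uᵀ) / 2` of `u ∈ H¹(Ω; ℝⁿ)`. -/
def strain {n : ℕ} (Ω : Set (Space n)) (u : Space n → Space n) (x : Space n) : Mat n :=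
  (1 / 2 : ℝ) • (weakGradient Ω u x + (weakGradient Ω u x).transpose)

/-- The distributional linearized strain `(Du + Duᵀ) / 2` of `u` on `Ω` is represented by a
function in `L²(Ω)`. No integrability of the full gradient is required. -/
def HasL2Strain {n : ℕ} (Ω : Set (Space n)) (u : Space n → Space n) : Prop :=
  ∃ e : Space n → Mat n, (∀ i j, MemLp (fun x => e x i j) 2 (volume.restrict Ω)) ∧
    ∀ φ, IsTestFunction Ω φ → ∀ i j,
      (1 / 2 : ℝ) * ∫ x in Ω, (u x i * partialDeriv φ j x + u x j * partialDeriv φ i x)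
        = -∫ x in Ω, e x i j * φ x

/-- `Ω` has Lipschitz boundary: near each boundary point, and after a choice of the vertical
direction `ν`, the set `Ω` is the region strictly above the graph of a Lipschitz function `γ` of
the component of `x` orthogonal to `ν`. -/
def HasLipschitzBoundary {n : ℕ} (Ω : Set (Space n)) : Prop :=
  ∀ x₀ ∈ frontier Ω, ∃ r : ℝ, 0 < r ∧ ∃ ν : Space n, ‖ν‖ = 1 ∧
    ∃ (K : ℝ≥0) (γ : Space n → ℝ), LipschitzWith K γ ∧
      ∀ x ∈ Metric.ball x₀ r, x ∈ Ω ↔ γ (x - inner ℝ x ν • ν) < inner ℝ x ν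

/-- The space `L¹(Ω; ℝⁿ) × L¹(Ω)` with its strong topology. -/
abbrev StateSpace {n : ℕ} (Ω : Set (Space n)) : Type :=
  Lp (Space n) 1 (volume.restrict Ω) × Lp ℝ 1 (volume.restrict Ω)

/-- The brittle damage energy
`½ ∫_Ω [η χ A_w + (1 - χ) A_s] e(u) : e(u) dx + (κ / ε) ∫_Ω χ dx`.
For `u ∈ H¹`, `χ ∈ {0, 1}` and `η, ε, κ > 0` both integrands are nonnegative and integrable. -/
def damageEnergy {n : ℕ} (Ω : Set (Space n)) (Aw As : Tensor4 n) (κ η ε : ℝ)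
    (u : Space n → Space n) (χ : Space n → ℝ) : ℝ≥0∞ :=
  (∫⁻ x in Ω, ENNReal.ofReal (1 / 2 *
      (η * χ x * frob (Aw.app (strain Ω u x)) (strain Ω u x)
        + (1 - χ x) * frob (As.app (strain Ω u x)) (strain Ω u x))))
    + ENNReal.ofReal (κ / ε) * ∫⁻ x in Ω, ENNReal.ofReal (χ x)

open Classical in
/-- The damage energy with parameter `η = η_ε`, extended by `+∞` to `L¹ × L¹` outside
`H¹(Ω; ℝⁿ) × L^∞(Ω; {0, 1})`. -/
def extendedEnergy {n : ℕ} (Ω : Set (Space n)) (Aw As : Tensor4 n) (κ : ℝ) (η : ℝ → ℝ)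
    (ε : ℝ) (p : StateSpace Ω) : ℝ≥0∞ :=
  if MemH1 Ω p.1 ∧ ∀ᵐ x ∂(volume.restrict Ω), p.2 x = 0 ∨ p.2 x = 1 then
    damageEnergy Ω Aw As κ (η ε) ε p.1 p.2
  else ⊤

open Classical in
/-- The linear elastic energy: `½ ∫_Ω A_s e(u) : e(u) dx` if `χ = 0` a.e. and `u ∈ H¹(Ω; ℝⁿ)`,
and `+∞` otherwise. -/
def elasticEnergy {n : ℕ} (Ω : Set (Space n)) (As : Tensor4 n) (p : StateSpace Ω) : ℝ≥0∞ :=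
  if (∀ᵐ x ∂(volume.restrict Ω), p.2 x = 0) ∧ MemH1 Ω p.1 then
    ∫⁻ x in Ω, ENNReal.ofReal
      (1 / 2 * frob (As.app (strain Ω p.1 x)) (strain Ω p.1 x))
  else ⊤

/-- The `Γ`-lower limit at `x` of a family `(F ε)` as `ε → 0⁺`. -/
def gammaLiminf {X : Type*} [TopologicalSpace X] (F : ℝ → X → ℝ≥0∞) (x : X) : ℝ≥0∞ :=
  ⨅ (y : ℝ → X) (_ : Tendsto y (𝓝[>] 0) (𝓝 x)), liminf (fun ε => F ε (y ε)) (𝓝[>] 0)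

/-- The `Γ`-upper limit at `x` of a family `(F ε)` as `ε → 0⁺`. -/
def gammaLimsup {X : Type*} [TopologicalSpace X] (F : ℝ → X → ℝ≥0∞) (x : X) : ℝ≥0∞ :=
  ⨅ (y : ℝ → X) (_ : Tendsto y (𝓝[>] 0) (𝓝 x)), limsup (fun ε => F ε (y ε)) (𝓝[>] 0)

/-- The `Γ`-limit of `(F ε)` as `ε → 0⁺` exists at `x` and equals `v`. -/
def HasGammaLimitAt {X : Type*} [TopologicalSpace X] (F : ℝ → X → ℝ≥0∞) (x : X)
    (v : ℝ≥0∞) : Prop :=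
  gammaLiminf F x = v ∧ gammaLimsup F x = v

/-- `(F ε)` `Γ`-converges to `Φ` as `ε → 0⁺`. -/
def GammaConverges {X : Type*} [TopologicalSpace X] (F : ℝ → X → ℝ≥0∞) (Φ : X → ℝ≥0∞) : Prop :=
  ∀ x, HasGammaLimitAt F x (Φ x)

end BrittleDamage

end

/-! The upper bound is immediate. Where the limit energy is finite, `χ = 0` and the damage energy
coincides with the elastic one, so constant families are recovery sequences
(`gammaLimsup_le_elasticEnergy`).

For the lower bound, take a family converging in `L¹` with energies at most `b`. The damaged set has
volume at most `b ε / κ`, so the limit of `χ` vanishes. The strain on that set is bounded in `L²`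
only by a multiple of `(b / η) ^ (1 / 2)`, but by Cauchy–Schwarz its pairing with a fixed test
function has square of order `ε / η`, and this tends to zero because `η / ε → ∞`
(`DamageBounds.sq_integral_weak_le`). Hence the strain of the sound region, which is bounded in
`L²`, has the same distributional limit as the full strain, namely the strain of the limit `u`
(`tendsto_integral_strong`). By Riesz representation this limit is in `L²`
(`exists_strain_of_damageBounds`). Once `u ∈ H¹`, convexity writes the elastic energy as a supremum
of functionals affine in the strain, each of which passes to the limit
(`elasticEnergy_le_of_damageBounds`). All this holds on any bounded open set; only the step from
`L²` strain to `u ∈ H¹` may fail, whence the exception in (ii).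

For (i) that step is Korn regularity for `L¹` fields (`memH1_of_hasL2Strain`). It rests on a priori
estimates for smooth fields, applied to mollifications. On a ball, integrating the strain along
segments and averaging against a kernel shows that a field is close to an affine map whose linear
part is nearly skew; cutting off the difference and using Korn's first inequality for compact
supports yields the second inequality (`exists_lintegral_partialDeriv_sub_le`). Near a Lipschitz
graph this is applied on balls of radius proportional to the height. The averages of the gradient
over these balls vary along the vertical direction at a rate controlled by the strain, because
second derivatives are combinations of first derivatives of the strain
(`exists_avgGradSlope_sq_le`), and Hardy's inequality carries them up to the boundary
(`hardy_graph`). The constants do not depend on the particular graph, so the graph may be raised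
slightly to leave room for mollification, and compact subsets then exhaust `Ω`. -/

noncomputable section

namespace BrittleDamage

/-! ### Test functions and duality in `L²(Ω)`. -/

namespace IsTestFunction

variable {n : ℕ} {Ω : Set (Space n)} {φ ψ : Space n → ℝ}

theorem continuous (h : IsTestFunction Ω φ) : Continuous φ := h.smooth.continuous

theorem zero : IsTestFunction Ω (0 : Space n → ℝ) where
  smooth := contDiff_const
  compact := HasCompactSupport.zero
  support := by simp [tsupport]

theorem add (h : IsTestFunction Ω φ) (h' : IsTestFunction Ω ψ) : IsTestFunction Ω (φ + ψ) where
  smooth := h.smooth.add h'.smooth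
  compact := h.compact.add h'.compact
  support := (tsupport_add φ ψ).trans (Set.union_subset h.support h'.support)

theorem smul (c : ℝ) (h : IsTestFunction Ω φ) : IsTestFunction Ω (c • φ) where
  smooth := contDiff_const.smul h.smooth
  compact := h.compact.smul_left (f := fun _ => c)
  support := (tsupport_smul_subset_right (fun _ => c) φ).trans h.support

theorem memLp (h : IsTestFunction Ω φ) (p : ℝ≥0∞) : MemLp φ p (volume.restrict Ω) :=
  (h.continuous.memLp_of_hasCompactSupport h.compact).restrict Ω

end IsTestFunction

/-- The space of test functions on `Ω`. -/
def testFunctions {n : ℕ} (Ω : Set (Space n)) : Submodule ℝ (Space n → ℝ) where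
  carrier := {φ | IsTestFunction Ω φ}
  add_mem' := fun h h' => h.add h'
  zero_mem' := IsTestFunction.zero
  smul_mem' := fun c _ h => h.smul c

/-- The map sending a test function to its class in `L²(Ω)`. -/
def testToLp {n : ℕ} (Ω : Set (Space n)) :
    testFunctions Ω →ₗ[ℝ] Lp ℝ 2 (volume.restrict Ω) where
  toFun φ := (φ.2.memLp 2).toLp φ.1
  map_add' _ _ := rfl
  map_smul' _ _ := rfl

theorem inner_toLp {n : ℕ} {Ω : Set (Space n)} {f g : Space n → ℝ}
    (hf : MemLp f 2 (volume.restrict Ω)) (hg : MemLp g 2 (volume.restrict Ω)) :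
    inner ℝ (hf.toLp f) (hg.toLp g) = ∫ x in Ω, f x * g x := by
  rw [L2.inner_def]
  apply integral_congr_ae
  filter_upwards [hf.coeFn_toLp, hg.coeFn_toLp] with x h1 h2
  rw [h1, h2]
  simp [mul_comm]

theorem norm_toLp_sq {n : ℕ} {Ω : Set (Space n)} {f : Space n → ℝ}
    (hf : MemLp f 2 (volume.restrict Ω)) :
    ‖hf.toLp f‖ ^ 2 = ∫ x in Ω, f x ^ 2 := by
  rw [← real_inner_self_eq_norm_sq, inner_toLp]
  simp [sq]

theorem ae_eq_of_integral_testFunction {n : ℕ} {Ω : Set (Space n)} (hΩ : IsOpen Ω)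
    {f g : Space n → ℝ} (hf : IntegrableOn f Ω) (hg : IntegrableOn g Ω)
    (h : ∀ φ, IsTestFunction Ω φ → ∫ x in Ω, f x * φ x = ∫ x in Ω, g x * φ x) :
    f =ᵐ[volume.restrict Ω] g := by
  have key : ∀ᵐ x, x ∈ Ω → (f - g) x = 0 := by
    refine hΩ.ae_eq_zero_of_integral_contDiff_smul_eq_zero
      ((hf.sub hg).locallyIntegrableOn) fun φ h1 h2 h3 => ?_
    have hφ : IsTestFunction Ω φ := ⟨h1, h2, h3⟩
    obtain ⟨C, hC⟩ := h1.continuous.bounded_above_of_compact_support h2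
    have e1 : ∫ x in Ω, φ x • (f - g) x = ∫ x, φ x • (f - g) x :=
      setIntegral_eq_integral_of_forall_compl_eq_zero fun x hx => by
        rw [image_eq_zero_of_notMem_tsupport fun hx' => hx (h3 hx'), zero_smul]
    have i1 : Integrable (fun x => f x * φ x) (volume.restrict Ω) :=
      hf.mul_bdd h1.continuous.aestronglyMeasurable (ae_of_all _ hC)
    have i2 : Integrable (fun x => g x * φ x) (volume.restrict Ω) :=
      hg.mul_bdd h1.continuous.aestronglyMeasurable (ae_of_all _ hC)
    rw [← e1, show (fun x => φ x • (f - g) x) = fun x => f x * φ x - g x * φ x by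
      ext x; simp; ring, integral_sub i1 i2, h φ hφ, sub_self]
  rw [Filter.EventuallyEq, ae_restrict_iff' hΩ.measurableSet]
  filter_upwards [key] with x hx hxΩ
  exact sub_eq_zero.1 (hx hxΩ)

/-- An element orthogonal to all test functions vanishes by the fundamental lemma of the calculus of
variations; boundedness of `Ω` makes it integrable. -/
theorem denseRange_testToLp {n : ℕ} {Ω : Set (Space n)} (hΩ : IsOpen Ω)
    (hb : Bornology.IsBounded Ω) : DenseRange (testToLp Ω) := by
  have : IsFiniteMeasure (volume.restrict Ω) := ⟨by simpa using hb.measure_lt_top⟩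
  have h : (LinearMap.range (testToLp Ω)).topologicalClosure = ⊤ := by
    rw [Submodule.topologicalClosure_eq_top_iff, Submodule.eq_bot_iff]
    intro f hf
    have hf2 := Lp.memLp f
    have : f =ᵐ[volume.restrict Ω] (0 : Space n → ℝ) := by
      refine ae_eq_of_integral_testFunction hΩ (hf2.integrable (by norm_num))
        (integrable_zero _ _ _) fun φ hφ => ?_
      have h0 := (Submodule.mem_orthogonal _ _).1 hf _ ⟨⟨φ, hφ⟩, rfl⟩
      have h1 : inner ℝ ((hφ.memLp 2).toLp φ) (hf2.toLp f) = 0 := by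
        rw [Lp.toLp_coeFn]; exact h0
      rw [inner_toLp] at h1
      simpa [mul_comm] using h1
    exact (Lp.eq_zero_iff_ae_eq_zero).2 this
  have h2 := congrArg (fun S : Submodule ℝ (Lp ℝ 2 (volume.restrict Ω)) => (S : Set (Lp ℝ 2 (volume.restrict Ω)))) h
  simp only [Submodule.topologicalClosure_coe, Submodule.top_coe, LinearMap.coe_range] at h2
  rw [DenseRange, dense_iff_closure_eq, h2]

/-- A linear functional on test functions that is bounded in the `L²` norm is given by
integration against an `L²` function. -/
theorem exists_memLp_of_bounded {n : ℕ} {Ω : Set (Space n)} (hΩ : IsOpen Ω)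
    (hb : Bornology.IsBounded Ω) (T : (Space n → ℝ) → ℝ)
    (hadd : ∀ φ ψ, IsTestFunction Ω φ → IsTestFunction Ω ψ → T (φ + ψ) = T φ + T ψ)
    (hsmul : ∀ (c : ℝ) φ, IsTestFunction Ω φ → T (c • φ) = c * T φ)
    (C : ℝ) (hC : ∀ φ, IsTestFunction Ω φ → T φ ^ 2 ≤ C * ∫ x in Ω, φ x ^ 2) :
    ∃ g, MemLp g 2 (volume.restrict Ω) ∧
      ∀ φ, IsTestFunction Ω φ → T φ = ∫ x in Ω, g x * φ x := by
  let L : testFunctions Ω →ₗ[ℝ] ℝ :=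
    { toFun := fun φ => T φ.1
      map_add' := fun φ ψ => hadd _ _ φ.2 ψ.2
      map_smul' := fun c φ => hsmul c _ φ.2 }
  have hd := denseRange_testToLp hΩ hb
  -- The sign of `C` is not prescribed, so its positive part goes under the root.
  have hbd : ∀ φ : testFunctions Ω, ‖L φ‖ ≤ √(max C 0) * ‖testToLp Ω φ‖ := fun φ => by
    refine abs_le_of_sq_le_sq ?_ (by positivity)
    rw [mul_pow, Real.sq_sqrt (le_max_right _ _)]
    have e : ‖testToLp Ω φ‖ ^ 2 = ∫ x in Ω, φ.1 x ^ 2 := norm_toLp_sq (φ.2.memLp 2)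
    rw [e]
    exact (hC _ φ.2).trans (mul_le_mul_of_nonneg_right (le_max_left _ _)
      (integral_nonneg fun x => sq_nonneg _))
  -- The functional extends by density to all of `L²(Ω)`, and Riesz representation turns the
  -- extension into a function.
  let G := L.extendOfNorm (testToLp Ω)
  let g := (InnerProductSpace.toDual ℝ (Lp ℝ 2 (volume.restrict Ω))).symm G
  refine ⟨g, Lp.memLp g, fun φ hφ => ?_⟩
  have h1 : G (testToLp Ω ⟨φ, hφ⟩) = T φ := LinearMap.extendOfNorm_eq hd ⟨_, hbd⟩ ⟨φ, hφ⟩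
  have h2 : inner ℝ g (testToLp Ω ⟨φ, hφ⟩) = G (testToLp Ω ⟨φ, hφ⟩) :=
    InnerProductSpace.toDual_symm_apply
  have h3 : inner ℝ ((Lp.memLp g).toLp g) ((hφ.memLp 2).toLp φ) = ∫ x in Ω, g x * φ x :=
    inner_toLp _ _
  rw [Lp.toLp_coeFn] at h3
  rw [← h1, ← h2, ← h3]
  rfl

/-- Test functions approximate `L²` functions in quadratic mean. -/
theorem exists_testFunction_approx {n : ℕ} {Ω : Set (Space n)} (hΩ : IsOpen Ω)
    (hb : Bornology.IsBounded Ω) {f : Space n → ℝ} (hf : MemLp f 2 (volume.restrict Ω))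
    {δ : ℝ} (hδ : 0 < δ) :
    ∃ φ, IsTestFunction Ω φ ∧ ∫ x in Ω, (f x - φ x) ^ 2 < δ := by
  obtain ⟨φ, hφ⟩ := (denseRange_testToLp hΩ hb).exists_dist_lt (hf.toLp f) (Real.sqrt_pos.2 hδ)
  refine ⟨φ.1, φ.2, ?_⟩
  have h2 : ‖(hf.sub (φ.2.memLp 2)).toLp (f - φ.1)‖ < √δ := by
    rw [MemLp.toLp_sub hf (φ.2.memLp 2), ← dist_eq_norm]; exact hφ
  have h3 := norm_toLp_sq (hf.sub (φ.2.memLp 2))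
  simp only [Pi.sub_apply] at h3
  rw [← h3]
  calc _ < √δ ^ 2 := by gcongr
    _ = δ := Real.sq_sqrt hδ.le

/-! ### Partial derivatives and integration by parts. -/

section PartialDerivatives

variable {n : ℕ} {f g : Space n → ℝ}

theorem contDiff_partialDeriv (hf : ContDiff ℝ ∞ f) (j : Fin n) :
    ContDiff ℝ ∞ (partialDeriv f j) :=
  (hf.fderiv_right (m := ∞) (by simp)).clm_apply contDiff_const

theorem continuous_partialDeriv (hf : ContDiff ℝ ∞ f) (j : Fin n) :
    Continuous (partialDeriv f j) :=
  (contDiff_partialDeriv hf j).continuous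

theorem tsupport_partialDeriv_subset (f : Space n → ℝ) (j : Fin n) :
    tsupport (partialDeriv f j) ⊆ tsupport f :=
  tsupport_fderiv_apply_subset ℝ _

theorem hasCompactSupport_partialDeriv (hf : HasCompactSupport f) (j : Fin n) :
    HasCompactSupport (partialDeriv f j) :=
  hf.fderiv_apply ℝ _

theorem IsTestFunction.partialDeriv {Ω : Set (Space n)} (hf : IsTestFunction Ω f) (j : Fin n) :
    IsTestFunction Ω (partialDeriv f j) where
  smooth := contDiff_partialDeriv hf.smooth j
  compact := hasCompactSupport_partialDeriv hf.compact j
  support := (tsupport_partialDeriv_subset f j).trans hf.support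

theorem partialDeriv_add (hf : ContDiff ℝ ∞ f) (hg : ContDiff ℝ ∞ g) (j : Fin n) (x : Space n) :
    partialDeriv (fun y => f y + g y) j x = partialDeriv f j x + partialDeriv g j x := by
  simp only [partialDeriv]
  rw [fderiv_fun_add (hf.differentiable (by simp) x) (hg.differentiable (by simp) x)]
  rfl

theorem partialDeriv_sub (hf : ContDiff ℝ ∞ f) (hg : ContDiff ℝ ∞ g) (j : Fin n) (x : Space n) :
    partialDeriv (fun y => f y - g y) j x = partialDeriv f j x - partialDeriv g j x := by
  simp only [partialDeriv]
  rw [fderiv_fun_sub (hf.differentiable (by simp) x) (hg.differentiable (by simp) x)]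
  rfl

theorem partialDeriv_mul (hf : ContDiff ℝ ∞ f) (hg : ContDiff ℝ ∞ g) (j : Fin n) (x : Space n) :
    partialDeriv (fun y => f y * g y) j x
      = f x * partialDeriv g j x + partialDeriv f j x * g x := by
  simp only [partialDeriv]
  rw [fderiv_fun_mul (hf.differentiable (by simp) x) (hg.differentiable (by simp) x)]
  simp [mul_comm]

theorem partialDeriv_const_mul (hf : ContDiff ℝ ∞ f) (c : ℝ) (j : Fin n) (x : Space n) :
    partialDeriv (fun y => c * f y) j x = c * partialDeriv f j x := by
  simp only [partialDeriv]
  rw [fderiv_const_mul (hf.differentiable (by simp) x)]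
  rfl

theorem partialDeriv_comp_affine (hf : ContDiff ℝ ∞ f) (x : Space n) (d : ℝ) (j : Fin n)
    (z : Space n) :
    partialDeriv (fun z => f (x + d • z)) j z = d * partialDeriv f j (x + d • z) := by
  have h1 : HasFDerivAt (fun z : Space n => x + d • z)
      (d • ContinuousLinearMap.id ℝ (Space n)) z :=
    ((hasFDerivAt_id z).const_smul d).const_add x
  have h2 := ((hf.differentiable (by simp) (x + d • z)).hasFDerivAt).comp z h1
  simp only [partialDeriv]
  rw [show (fun z => f (x + d • z)) = f ∘ fun z => x + d • z from rfl, h2.fderiv]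
  simp

theorem contDiff_coord (i : Fin n) : ContDiff ℝ ∞ (fun y : Space n => y i) :=
  (EuclideanSpace.proj (𝕜 := ℝ) i).contDiff

theorem fderiv_apply_eq_sum (f : Space n → ℝ) (x y : Space n) :
    fderiv ℝ f x y = ∑ j, y j * partialDeriv f j x := by
  conv_lhs => rw [← (EuclideanSpace.basisFun (Fin n) ℝ).sum_repr y]
  simp [partialDeriv]

theorem partialDeriv_comm (hf : ContDiff ℝ ∞ f) (i j : Fin n) (x : Space n) :
    partialDeriv (partialDeriv f i) j x = partialDeriv (partialDeriv f j) i x := by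
  have hd : DifferentiableAt ℝ (fderiv ℝ f) x :=
    (hf.fderiv_right (m := ∞) (by simp)).differentiable (by simp) x
  have h (a b : Fin n) : partialDeriv (partialDeriv f a) b x
      = fderiv ℝ (fderiv ℝ f) x (EuclideanSpace.single b 1) (EuclideanSpace.single a 1) := by
    have := hd.hasFDerivAt.clm_apply (hasFDerivAt_const (EuclideanSpace.single a (1 : ℝ)) x)
    have e : partialDeriv f a = fun y => fderiv ℝ f y (EuclideanSpace.single a 1) := rfl
    rw [e, partialDeriv, this.fderiv]
    simp
  rw [h, h]
  exact (hf.contDiffAt.isSymmSndFDerivAt (by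
    simpa using (WithTop.coe_le_coe.2 (le_top : (2 : ℕ∞) ≤ ⊤)))).eq _ _

theorem integrable_mul_of_hasCompactSupport (hf : Continuous f) (hg : Continuous g)
    (hc : HasCompactSupport f) : Integrable (fun x => f x * g x) :=
  (hf.mul hg).integrable_of_hasCompactSupport hc.mul_right

/-- Integration by parts against a compactly supported function. -/
theorem integral_mul_partialDeriv (hf : ContDiff ℝ ∞ f) (hg : ContDiff ℝ ∞ g)
    (hc : HasCompactSupport f) (j : Fin n) :
    ∫ x, f x * partialDeriv g j x = -∫ x, partialDeriv f j x * g x :=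
  integral_mul_fderiv_eq_neg_fderiv_mul_of_integrable
    (integrable_mul_of_hasCompactSupport (continuous_partialDeriv hf j) hg.continuous
      (hasCompactSupport_partialDeriv hc j))
    (integrable_mul_of_hasCompactSupport hf.continuous (continuous_partialDeriv hg j) hc)
    (integrable_mul_of_hasCompactSupport hf.continuous hg.continuous hc)
    (fun x _ => hf.differentiable (by simp) x) (fun x _ => hg.differentiable (by simp) x)

/-- Both sides equal `-∫ ∂ᵢ∂ⱼf g`, by one integration by parts each and the symmetry of second
derivatives. -/
theorem integral_partialDeriv_mul_partialDeriv_comm (hf : ContDiff ℝ ∞ f) (hg : ContDiff ℝ ∞ g)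
    (hc : HasCompactSupport f) (i j : Fin n) :
    ∫ x, partialDeriv f i x * partialDeriv g j x
      = ∫ x, partialDeriv f j x * partialDeriv g i x := by
  rw [integral_mul_partialDeriv (contDiff_partialDeriv hf i) hg
      (hasCompactSupport_partialDeriv hc i) j,
    integral_mul_partialDeriv (contDiff_partialDeriv hf j) hg
      (hasCompactSupport_partialDeriv hc j) i]
  simp only [partialDeriv_comm hf i j]

end PartialDerivatives

/-! ### Korn's first inequality. -/

section Korn

variable {n : ℕ}

/-- The symmetrized gradient of a smooth vector field given by its components. -/
def symGrad (v : Fin n → Space n → ℝ) (i j : Fin n) (x : Space n) : ℝ :=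
  (partialDeriv (v i) j x + partialDeriv (v j) i x) / 2

/-- The squared Frobenius norm of the symmetrized gradient. -/
def strainSq (v : Fin n → Space n → ℝ) (x : Space n) : ℝ :=
  ∑ i, ∑ j, symGrad v i j x ^ 2

variable {v w : Fin n → Space n → ℝ}

theorem contDiff_symGrad (hv : ∀ i, ContDiff ℝ ∞ (v i)) (i j : Fin n) :
    ContDiff ℝ ∞ (symGrad v i j) :=
  ((contDiff_partialDeriv (hv i) j).add (contDiff_partialDeriv (hv j) i)).div_const 2

theorem continuous_strainSq (hv : ∀ i, ContDiff ℝ ∞ (v i)) : Continuous (strainSq v) :=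
  continuous_finsetSum _ fun i _ => continuous_finsetSum _ fun j _ =>
    (contDiff_symGrad hv i j).continuous.pow 2

theorem strainSq_nonneg (v : Fin n → Space n → ℝ) (x : Space n) : 0 ≤ strainSq v x :=
  Finset.sum_nonneg fun _ _ => Finset.sum_nonneg fun _ _ => sq_nonneg _

theorem symGrad_sq_le_strainSq (v : Fin n → Space n → ℝ) (i j : Fin n) (x : Space n) :
    symGrad v i j x ^ 2 ≤ strainSq v x :=
  (Finset.single_le_sum (f := fun j => symGrad v i j x ^ 2) (fun _ _ => sq_nonneg _)
    (Finset.mem_univ j)).trans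
  (Finset.single_le_sum (f := fun i => ∑ j, symGrad v i j x ^ 2)
    (fun _ _ => Finset.sum_nonneg fun _ _ => sq_nonneg _) (Finset.mem_univ i))

/-- Korn's first inequality for compactly supported smooth fields. -/
theorem integral_grad_sq_le_strainSq (hw : ∀ i, ContDiff ℝ ∞ (w i))
    (hc : ∀ i, HasCompactSupport (w i)) (i j : Fin n) :
    ∫ x, partialDeriv (w i) j x ^ 2 ≤ 2 * ∫ x, strainSq w x := by
  have hint (i j k l : Fin n) :
      Integrable fun x => partialDeriv (w i) j x * partialDeriv (w k) l x :=
    integrable_mul_of_hasCompactSupport (continuous_partialDeriv (hw i) j)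
      (continuous_partialDeriv (hw k) l) (hasCompactSupport_partialDeriv (hc i) j)
  -- After exchanging derivatives, the cross terms add up to the integral of the squared divergence.
  have hdiv : 0 ≤ ∑ i, ∑ j, ∫ x, partialDeriv (w i) j x * partialDeriv (w j) i x := by
    have h1 : ∑ i, ∑ j, ∫ x, partialDeriv (w i) j x * partialDeriv (w j) i x
        = ∫ x, (∑ i, partialDeriv (w i) i x) ^ 2 := by
      simp_rw [sq, Finset.sum_mul_sum]
      rw [integral_finsetSum _ fun i _ => integrable_finsetSum _ fun j _ => hint i i j j]
      refine Finset.sum_congr rfl fun i _ => ?_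
      rw [integral_finsetSum _ fun j _ => hint i i j j]
      exact Finset.sum_congr rfl fun j _ =>
        integral_partialDeriv_mul_partialDeriv_comm (hw i) (hw j) (hc i) j i
    rw [h1]
    exact integral_nonneg fun x => sq_nonneg _
  -- Expanding the square gives `2|e(w)|² = |∇w|² + ∑ ∂ⱼwᵢ ∂ᵢwⱼ`, which is where the constant 2
  -- originates.
  have hs : 2 * ∫ x, strainSq w x
      = (∑ i, ∑ j, ∫ x, partialDeriv (w i) j x * partialDeriv (w i) j x)
        + ∑ i, ∑ j, ∫ x, partialDeriv (w i) j x * partialDeriv (w j) i x := by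
    rw [← integral_const_mul]
    have h2 (x : Space n) : 2 * strainSq w x
        = ∑ i, ∑ j, (partialDeriv (w i) j x * partialDeriv (w i) j x
          + partialDeriv (w i) j x * partialDeriv (w j) i x) := by
      have h3 : ∑ i, ∑ j, partialDeriv (w i) j x * partialDeriv (w i) j x
          = ∑ i, ∑ j, partialDeriv (w j) i x * partialDeriv (w j) i x := Finset.sum_comm
      have h4 : 2 * strainSq w x = (∑ i, ∑ j, partialDeriv (w i) j x * partialDeriv (w i) j x
          + ∑ i, ∑ j, partialDeriv (w j) i x * partialDeriv (w j) i x) / 2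
          + ∑ i, ∑ j, partialDeriv (w i) j x * partialDeriv (w j) i x := by
        simp only [strainSq, symGrad, Finset.mul_sum, ← Finset.sum_add_distrib, Finset.sum_div]
        exact Finset.sum_congr rfl fun i _ => Finset.sum_congr rfl fun j _ => by ring
      rw [h4, ← h3]
      simp only [Finset.sum_add_distrib]
      ring
    have h5 (i j : Fin n) : Integrable fun x => partialDeriv (w i) j x * partialDeriv (w i) j x
        + partialDeriv (w i) j x * partialDeriv (w j) i x := (hint i j i j).add (hint i j j i)
    simp_rw [h2]
    rw [integral_finsetSum _ fun i _ => integrable_finsetSum _ fun j _ => h5 i j,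
      ← Finset.sum_add_distrib]
    refine Finset.sum_congr rfl fun i _ => ?_
    rw [integral_finsetSum _ fun j _ => h5 i j,
      ← Finset.sum_add_distrib]
    exact Finset.sum_congr rfl fun j _ => integral_add (hint i j i j) (hint i j j i)
  have hn (i j : Fin n) : 0 ≤ ∫ x, partialDeriv (w i) j x * partialDeriv (w i) j x :=
    integral_nonneg fun x => mul_self_nonneg _
  have hle : ∫ x, partialDeriv (w i) j x * partialDeriv (w i) j x
      ≤ ∑ i, ∑ j, ∫ x, partialDeriv (w i) j x * partialDeriv (w i) j x :=
    (Finset.single_le_sum (fun j _ => hn i j) (Finset.mem_univ j)).trans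
      (Finset.single_le_sum (f := fun i => ∑ j, ∫ x, partialDeriv (w i) j x *
        partialDeriv (w i) j x) (fun i _ => Finset.sum_nonneg fun j _ => hn i j)
        (Finset.mem_univ i))
  simp only [sq]
  linarith

end Korn

/-! ### Cauchy–Schwarz inequalities and averages along segments. -/

section Tools

variable {α : Type*} [MeasurableSpace α] {μ : Measure α}

theorem lintegral_sq_le {f : α → ℝ≥0∞} (hf : AEMeasurable f μ) :
    (∫⁻ x, f x ∂μ) ^ 2 ≤ μ Set.univ * ∫⁻ x, f x ^ 2 ∂μ := by
  have h := ENNReal.lintegral_mul_le_Lp_mul_Lq μ (Real.HolderConjugate.two_two)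
    (aemeasurable_const (b := (1 : ℝ≥0∞))) hf
  simp only [Pi.mul_apply, one_mul, ENNReal.one_rpow, lintegral_const] at h
  have h2 := pow_le_pow_left₀ zero_le h 2
  rw [mul_pow] at h2
  simp only [← ENNReal.rpow_natCast, ← ENNReal.rpow_mul] at h2 ⊢
  norm_num at h2 ⊢
  exact h2

/-- Cauchy–Schwarz against the constant 1 in the weighted measure `μ.withDensity w`. -/
theorem lintegral_mul_sq_le {w f : α → ℝ≥0∞} (hw : Measurable w) (hf : AEMeasurable f μ) :
    (∫⁻ x, w x * f x ∂μ) ^ 2 ≤ (∫⁻ x, w x ∂μ) * ∫⁻ x, w x * f x ^ 2 ∂μ := by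
  have hf' : AEMeasurable f (μ.withDensity w) :=
    hf.mono_ac (withDensity_absolutelyContinuous μ w)
  have h := lintegral_sq_le hf'
  rw [lintegral_withDensity_eq_lintegral_mul₀ hw.aemeasurable hf,
    lintegral_withDensity_eq_lintegral_mul₀ hw.aemeasurable (hf.pow_const 2),
    withDensity_apply _ MeasurableSet.univ, Measure.restrict_univ] at h
  exact h

theorem enorm_sq_eq_ofReal (a : ℝ) : ‖a‖ₑ ^ 2 = ENNReal.ofReal (a ^ 2) := by
  rw [← ofReal_norm, ← ENNReal.ofReal_pow (norm_nonneg _), Real.norm_eq_abs, sq_abs]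

theorem ofReal_sum_sq_le {ι : Type*} (s : Finset ι) (f : ι → ℝ) :
    ENNReal.ofReal ((∑ i ∈ s, f i) ^ 2) ≤ s.card * ∑ i ∈ s, ENNReal.ofReal (f i ^ 2) := by
  rw [← ENNReal.ofReal_sum_of_nonneg fun i _ => sq_nonneg _, ← ENNReal.ofReal_natCast,
    ← ENNReal.ofReal_mul (Nat.cast_nonneg _)]
  exact ENNReal.ofReal_le_ofReal (sq_sum_le_card_mul_sum_sq)

theorem ofReal_add_sq_le (a b : ℝ) : ENNReal.ofReal ((a + b) ^ 2)
    ≤ 2 * (ENNReal.ofReal (a ^ 2) + ENNReal.ofReal (b ^ 2)) := by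
  rw [← ENNReal.ofReal_add (sq_nonneg _) (sq_nonneg _),
    show (2 : ℝ≥0∞) = ENNReal.ofReal 2 by simp, ← ENNReal.ofReal_mul (by norm_num)]
  exact ENNReal.ofReal_le_ofReal (by nlinarith [sq_nonneg (a - b)])

variable {n : ℕ}

theorem lintegral_comp_affine {f : Space n → ℝ≥0∞} (hf : Measurable f) (a : Space n) {t : ℝ}
    (ht : 0 < t) :
    ∫⁻ x, f (a + t • x) = ENNReal.ofReal ((t ^ n)⁻¹) * ∫⁻ x, f x := by
  have h1 : ∫⁻ x, f (a + t • x) = ∫⁻ y, f (a + y) ∂(Measure.map (t • ·) volume) :=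
    (lintegral_map (hf.comp (measurable_const_add a)) (measurable_const_smul t)).symm
  rw [h1, Measure.map_addHaar_smul volume ht.ne', lintegral_smul_measure,
    lintegral_add_left_eq_self f a]
  simp [abs_of_pos (inv_pos.2 (pow_pos ht n))]

/-- Averages along segments between two concentric balls are controlled by the integral over the
larger ball. -/
theorem lintegral_segment_le {f : Space n → ℝ≥0∞} (hf : Measurable f) :
    ∫⁻ x in Metric.ball (0 : Space n) 2, ∫⁻ y in Metric.ball (0 : Space n) 1,
      ∫⁻ t in Set.Ioc (0 : ℝ) 1, f (y + t • (x - y))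
    ≤ (ENNReal.ofReal (2 ^ n) * volume (Metric.ball (0 : Space n) 2)) *
      ∫⁻ x in Metric.ball (0 : Space n) 2, f x := by
  set B1 := Metric.ball (0 : Space n) 1
  set B2 := Metric.ball (0 : Space n) 2
  set I := ∫⁻ x in B2, f x
  have hB1 : MeasurableSet B1 := measurableSet_ball
  have hB2 : MeasurableSet B2 := measurableSet_ball
  have hB : B1 ⊆ B2 := Metric.ball_subset_ball (by norm_num)
  have hconv : Convex ℝ B2 := convex_ball _ _
  -- The map `x ↦ (1 - s) y + s x` stays in the convex ball, and its Jacobian `s ^ n` is at least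
  -- `2⁻ⁿ` as soon as `s ≥ 1 / 2`.
  have hstep (y : Space n) (hy : y ∈ B2) (s : ℝ) (hs : 1 / 2 ≤ s) (hs1 : s ≤ 1)
      (S : Set (Space n)) (hS : MeasurableSet S) (hSB : S ⊆ B2) :
      ∫⁻ x in S, f ((1 - s) • y + s • x) ≤ ENNReal.ofReal (2 ^ n) * I := by
    calc ∫⁻ x in S, f ((1 - s) • y + s • x)
        ≤ ∫⁻ x in S, B2.indicator f ((1 - s) • y + s • x) := by
          refine setLIntegral_mono' hS fun x hx => ?_
          rw [Set.indicator_of_mem]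
          exact hconv hy (hSB hx) (by linarith) (by linarith) (by ring)
      _ ≤ ∫⁻ x, B2.indicator f ((1 - s) • y + s • x) := setLIntegral_le_lintegral _ _
      _ = ENNReal.ofReal ((s ^ n)⁻¹) * I := by
          rw [lintegral_comp_affine (hf.indicator hB2) _ (by linarith),
            lintegral_indicator hB2]
      _ ≤ _ := by
          gcongr
          rw [← inv_pow]
          gcongr
          rw [inv_le_comm₀ (by linarith) (by norm_num)]
          linarith
  have hmeas : Measurable fun p : ℝ × Space n × Space n =>
      f (p.2.1 + p.1 • (p.2.2 - p.2.1)) := by fun_prop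
  have hswap : ∫⁻ x in B2, ∫⁻ y in B1, ∫⁻ t in Set.Ioc (0 : ℝ) 1, f (y + t • (x - y))
      = ∫⁻ t in Set.Ioc (0 : ℝ) 1, ∫⁻ y in B1, ∫⁻ x in B2, f (y + t • (x - y)) := by
    have e1 (x : Space n) : ∫⁻ y in B1, ∫⁻ t in Set.Ioc (0 : ℝ) 1, f (y + t • (x - y))
        = ∫⁻ t in Set.Ioc (0 : ℝ) 1, ∫⁻ y in B1, f (y + t • (x - y)) :=
      lintegral_lintegral_swap (by fun_prop)
    simp_rw [e1]
    rw [lintegral_lintegral_swap]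
    · refine lintegral_congr fun t => ?_
      exact lintegral_lintegral_swap (by fun_prop)
    · refine (Measurable.lintegral_prod_right' (f := fun q : (Space n × ℝ) × Space n =>
        f (q.2 + q.1.2 • (q.1.1 - q.2))) ?_).aemeasurable
      fun_prop
  rw [hswap]
  -- The Jacobian is `t ^ n` when integrating first in `x` and `(1 - t) ^ n` when integrating first
  -- in `y`. The variable is chosen according to the half of the interval containing `t`, so that
  -- neither degenerates.
  have hle (t : ℝ) (ht : t ∈ Set.Ioc (0 : ℝ) 1) :
      ∫⁻ y in B1, ∫⁻ x in B2, f (y + t • (x - y))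
        ≤ (ENNReal.ofReal (2 ^ n) * volume B2) * I := by
    rcases le_total (1 / 2) t with h | h
    · calc ∫⁻ y in B1, ∫⁻ x in B2, f (y + t • (x - y))
          ≤ ∫⁻ y in B1, ENNReal.ofReal (2 ^ n) * I := by
            refine setLIntegral_mono' hB1 fun y hy => ?_
            refine le_trans (le_of_eq (lintegral_congr fun x => ?_))
              (hstep y (hB hy) t h ht.2 B2 hB2 le_rfl)
            congr 1
            module
        _ ≤ _ := by
            rw [setLIntegral_const, mul_right_comm]
            gcongr
    · rw [lintegral_lintegral_swap (by fun_prop)]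
      calc ∫⁻ x in B2, ∫⁻ y in B1, f (y + t • (x - y))
          ≤ ∫⁻ x in B2, ENNReal.ofReal (2 ^ n) * I := by
            refine setLIntegral_mono' hB2 fun x hx => ?_
            refine le_trans (le_of_eq (lintegral_congr fun y => ?_))
              (hstep x hx (1 - t) (by linarith) (by linarith [ht.1]) B1 hB1 hB)
            congr 1
            module
        _ = _ := by
            rw [setLIntegral_const, mul_right_comm]
  calc _ ≤ ∫⁻ t in Set.Ioc (0 : ℝ) 1, (ENNReal.ofReal (2 ^ n) * volume B2) * I :=
        setLIntegral_mono' measurableSet_Ioc hle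
    _ = _ := by rw [setLIntegral_const]; simp

end Tools

/-! ### Affine approximation of a field on a ball. -/

section LocalKorn

variable {n : ℕ}

/-- The standard bump supported in the unit ball. -/
def unitBump (n : ℕ) : ContDiffBump (0 : Space n) := ⟨1 / 2, 1, by norm_num, by norm_num⟩

/-- A smooth cutoff equal to `1` on the unit ball and supported in the ball of radius `2`. -/
def cutoffBump (n : ℕ) : ContDiffBump (0 : Space n) := ⟨1, 2, by norm_num, by norm_num⟩

/-- A smooth kernel of unit mass supported in the unit ball. -/
def kernel (n : ℕ) : Space n → ℝ := (unitBump n).normed volume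

/-- The cutoff function of `cutoffBump`. -/
def cutoff (n : ℕ) : Space n → ℝ := cutoffBump n

theorem contDiff_kernel : ContDiff ℝ ∞ (kernel n) := (unitBump n).contDiff_normed

theorem hasCompactSupport_kernel : HasCompactSupport (kernel n) :=
  (unitBump n).hasCompactSupport_normed

theorem integral_kernel : ∫ x, kernel n x = 1 := (unitBump n).integral_normed

theorem kernel_nonneg (x : Space n) : 0 ≤ kernel n x := (unitBump n).nonneg_normed x

theorem support_kernel : Function.support (kernel n) = Metric.ball 0 1 :=
  (unitBump n).support_normed_eq

/-- Every point outside the open ball, the sphere included, is a minimum of the nonnegative kernel.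
-/
theorem partialDeriv_kernel_eq_zero (k : Fin n) {x : Space n} (hx : x ∉ Metric.ball 0 1) :
    partialDeriv (kernel n) k x = 0 := by
  have hmin : IsLocalMin (kernel n) x := by
    have h0 : kernel n x = 0 := by
      rw [← support_kernel] at hx
      exact Function.notMem_support.1 hx
    exact Filter.Eventually.of_forall fun y => by rw [h0]; exact kernel_nonneg y
  rw [partialDeriv, hmin.fderiv_eq_zero]
  rfl

theorem contDiff_cutoff : ContDiff ℝ ∞ (cutoff n) := (cutoffBump n).contDiff

theorem hasCompactSupport_cutoff : HasCompactSupport (cutoff n) := (cutoffBump n).hasCompactSupport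

theorem cutoff_nonneg (x : Space n) : 0 ≤ cutoff n x := (cutoffBump n).nonneg

theorem cutoff_le_one (x : Space n) : cutoff n x ≤ 1 := (cutoffBump n).le_one

theorem cutoff_eq_one {x : Space n} (hx : x ∈ Metric.ball 0 1) : cutoff n x = 1 :=
  (cutoffBump n).one_of_mem_closedBall (Metric.ball_subset_closedBall hx)

theorem cutoff_eq_zero {x : Space n} (hx : x ∉ Metric.ball 0 2) : cutoff n x = 0 := by
  have h : Function.support (cutoff n) = Metric.ball 0 2 := (cutoffBump n).support_eq
  rw [← h] at hx
  exact Function.notMem_support.1 hx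

theorem partialDeriv_cutoff_eq_zero (k : Fin n) {x : Space n} (hx : x ∉ Metric.ball 0 2) :
    partialDeriv (cutoff n) k x = 0 := by
  have hmin : IsLocalMin (cutoff n) x := Filter.Eventually.of_forall fun y => by
    rw [cutoff_eq_zero hx]; exact cutoff_nonneg y
  rw [partialDeriv, hmin.fderiv_eq_zero]
  rfl

theorem exists_bound_partialDeriv {f : Space n → ℝ} (hf : ContDiff ℝ ∞ f)
    (hc : HasCompactSupport f) : ∃ C : ℝ≥0, ∀ k x, ‖partialDeriv f k x‖ₑ ≤ C := by
  have h (k : Fin n) : ∃ C : ℝ, ∀ x, ‖partialDeriv f k x‖ ≤ C :=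
    (continuous_partialDeriv hf k).bounded_above_of_compact_support
      (hasCompactSupport_partialDeriv hc k)
  choose C hC using h
  refine ⟨∑ k, (C k).toNNReal, fun k x => ?_⟩
  calc ‖partialDeriv f k x‖ₑ = ENNReal.ofReal ‖partialDeriv f k x‖ := (ofReal_norm _).symm
    _ ≤ ENNReal.ofReal (C k) := ENNReal.ofReal_le_ofReal (hC k x)
    _ ≤ _ := ENNReal.coe_le_coe.2
      (Finset.single_le_sum (f := fun k => (C k).toNNReal) (fun _ _ => zero_le)
        (Finset.mem_univ k))

variable {v : Fin n → Space n → ℝ}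

/-- The fundamental theorem of calculus for the component of `v` along a segment. -/
theorem sum_mul_sub_eq_integral (hv : ∀ i, ContDiff ℝ ∞ (v i)) (x y : Space n) :
    ∑ i, (x i - y i) * (v i x - v i y)
      = ∫ t in (0 : ℝ)..1, ∑ i, ∑ j, (x i - y i) * (x j - y j) *
          symGrad v i j (y + t • (x - y)) := by
  have hd (t : ℝ) : HasDerivAt (fun t : ℝ => ∑ i, (x i - y i) * v i (y + t • (x - y)))
      (∑ i, ∑ j, (x i - y i) * (x j - y j) * symGrad v i j (y + t • (x - y))) t := by
    have h1 : HasDerivAt (fun t : ℝ => y + t • (x - y)) (x - y) t := by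
      simpa using ((hasDerivAt_id t).smul_const (x - y)).const_add y
    have h2 (i : Fin n) : HasDerivAt (fun t : ℝ => (x i - y i) * v i (y + t • (x - y)))
        (∑ j, (x i - y i) * (x j - y j) * partialDeriv (v i) j (y + t • (x - y))) t := by
      have := ((((hv i).differentiable (by simp)
        (y + t • (x - y))).hasFDerivAt).comp_hasDerivAt t h1).const_mul (x i - y i)
      convert! this using 1
      rw [fderiv_apply_eq_sum, Finset.mul_sum]
      exact Finset.sum_congr rfl fun j _ => by simp; ring
    have h3 := HasDerivAt.fun_sum (u := Finset.univ) fun i _ => h2 i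
    convert! h3 using 1
    set p := y + t • (x - y)
    -- The coefficients are symmetric in `i` and `j`, so only the symmetric part of the gradient
    -- contributes.
    have h4 : ∑ i, ∑ j, (x i - y i) * (x j - y j) * partialDeriv (v i) j p
        = ∑ i, ∑ j, (x i - y i) * (x j - y j) * partialDeriv (v j) i p := by
      rw [Finset.sum_comm]
      exact Finset.sum_congr rfl fun i _ => Finset.sum_congr rfl fun j _ => by ring
    have h5 : ∑ i, ∑ j, (x i - y i) * (x j - y j) * symGrad v i j p
        = (∑ i, ∑ j, (x i - y i) * (x j - y j) * partialDeriv (v i) j p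
          + ∑ i, ∑ j, (x i - y i) * (x j - y j) * partialDeriv (v j) i p) / 2 := by
      simp only [symGrad, ← Finset.sum_add_distrib, Finset.sum_div]
      exact Finset.sum_congr rfl fun i _ => Finset.sum_congr rfl fun j _ => by ring
    rw [h5, ← h4]
    ring
  have hcont : Continuous fun t : ℝ =>
      ∑ i, ∑ j, (x i - y i) * (x j - y j) * symGrad v i j (y + t • (x - y)) := by
    refine continuous_finsetSum _ fun i _ => continuous_finsetSum _ fun j _ => ?_
    exact continuous_const.mul ((contDiff_symGrad hv i j).continuous.comp (by fun_prop))
  rw [intervalIntegral.integral_eq_sub_of_hasDerivAt (fun t _ => hd t)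
    (hcont.intervalIntegrable 0 1), ← Finset.sum_sub_distrib]
  refine Finset.sum_congr rfl fun i _ => ?_
  simp
  ring

/-- The coefficients of the affine approximation of `v` on the unit ball. -/
def affineCoeff (v : Fin n → Space n → ℝ) (k i : Fin n) : ℝ :=
  ∫ y, partialDeriv (kernel n) k y * v i y

/-- An affine approximation of `v`, close to an infinitesimal rigid motion. -/
def affineApprox (v : Fin n → Space n → ℝ) (k : Fin n) (x : Space n) : ℝ :=
  ∫ y, partialDeriv (kernel n) k y * ∑ i, (x i - y i) * v i y

theorem integrable_partialDeriv_kernel_mul {f : Space n → ℝ} (hf : Continuous f) (k : Fin n) :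
    Integrable fun y => partialDeriv (kernel n) k y * f y :=
  integrable_mul_of_hasCompactSupport (continuous_partialDeriv contDiff_kernel k) hf
    (hasCompactSupport_partialDeriv hasCompactSupport_kernel k)

/-- Note the sign and the transposition: the coefficient is minus a mean of `∂ₖvᵢ`. It nevertheless
approximates `∂ᵢvₖ`, since the means of `∂ᵢvₖ` and `-∂ₖvᵢ` differ by twice a mean of the strain. -/
theorem affineCoeff_eq (hv : ∀ i, ContDiff ℝ ∞ (v i)) (k i : Fin n) :
    affineCoeff v k i = -∫ y, kernel n y * partialDeriv (v i) k y := by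
  rw [integral_mul_partialDeriv contDiff_kernel (hv i) hasCompactSupport_kernel, neg_neg]
  rfl

theorem affineApprox_eq (hv : ∀ i, ContDiff ℝ ∞ (v i)) (k : Fin n) (x : Space n) :
    affineApprox v k x = ∑ i, (affineCoeff v k i * x i
      - ∫ y, partialDeriv (kernel n) k y * (y i * v i y)) := by
  have h1 (i : Fin n) : Integrable fun y => partialDeriv (kernel n) k y * v i y * x i :=
    (integrable_partialDeriv_kernel_mul (hv i).continuous k).mul_const _
  have h2 (i : Fin n) : Integrable fun y => partialDeriv (kernel n) k y * (y i * v i y) :=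
    integrable_partialDeriv_kernel_mul
      ((contDiff_coord i).continuous.mul (hv i).continuous) k
  have h3 (y : Space n) : partialDeriv (kernel n) k y * ∑ i, (x i - y i) * v i y
      = ∑ i, (partialDeriv (kernel n) k y * v i y * x i
        - partialDeriv (kernel n) k y * (y i * v i y)) := by
    rw [Finset.mul_sum]
    exact Finset.sum_congr rfl fun i _ => by ring
  have h4 (i : Fin n) : Integrable fun y => partialDeriv (kernel n) k y * v i y * x i
      - partialDeriv (kernel n) k y * (y i * v i y) := (h1 i).sub (h2 i)
  simp only [affineApprox, h3]
  rw [integral_finsetSum _ fun i _ => h4 i]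
  refine Finset.sum_congr rfl fun i _ => ?_
  rw [integral_sub (h1 i) (h2 i), integral_mul_const]
  rfl

theorem contDiff_affineApprox (hv : ∀ i, ContDiff ℝ ∞ (v i)) (k : Fin n) :
    ContDiff ℝ ∞ (affineApprox v k) := by
  rw [funext (affineApprox_eq hv k)]
  exact ContDiff.sum fun i _ => (contDiff_const.mul (contDiff_coord i)).sub contDiff_const

theorem partialDeriv_affineApprox (hv : ∀ i, ContDiff ℝ ∞ (v i)) (k j : Fin n) (x : Space n) :
    partialDeriv (affineApprox v k) j x = affineCoeff v k j := by
  have h (i : Fin n) : HasFDerivAt (fun x : Space n => affineCoeff v k i * x i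
      - ∫ y, partialDeriv (kernel n) k y * (y i * v i y))
      (affineCoeff v k i • EuclideanSpace.proj (𝕜 := ℝ) i) x :=
    (((EuclideanSpace.proj (𝕜 := ℝ) i).hasFDerivAt).const_mul _).sub_const _
  have h2 := HasFDerivAt.fun_sum (u := Finset.univ) fun i _ => h i
  rw [partialDeriv, funext (affineApprox_eq hv k), h2.fderiv]
  simp

/-- As a function of `y`, the sum `∑ (xᵢ - yᵢ) vᵢ(x)` has `k`-th derivative `-vₖ(x)`, so integrating
it against `∂ₖ` of the unit-mass kernel returns `vₖ(x)`. Only the component of `v(x) - v(y)` along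
`x - y` survives, and that component is an integral of the strain. -/
theorem sub_affineApprox_eq (hv : ∀ i, ContDiff ℝ ∞ (v i)) (k : Fin n) (x : Space n) :
    v k x - affineApprox v k x
      = ∫ y, partialDeriv (kernel n) k y * ∑ i, (x i - y i) * (v i x - v i y) := by
  have hg : ContDiff ℝ ∞ fun y : Space n => ∑ i, (x i - y i) * v i x :=
    ContDiff.sum fun i _ => (contDiff_const.sub (contDiff_coord i)).mul contDiff_const
  have hg' (y : Space n) :
      partialDeriv (fun y : Space n => ∑ i, (x i - y i) * v i x) k y = -v k x := by
    have h (i : Fin n) : HasFDerivAt (fun y : Space n => (x i - y i) * v i x)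
        (v i x • -(EuclideanSpace.proj (𝕜 := ℝ) i : Space n →L[ℝ] ℝ)) y :=
      (((EuclideanSpace.proj (𝕜 := ℝ) i).hasFDerivAt).const_sub _).mul_const _
    rw [partialDeriv, (HasFDerivAt.fun_sum (u := Finset.univ) fun i _ => h i).fderiv]
    simp
  have h1 : v k x = ∫ y, partialDeriv (kernel n) k y * ∑ i, (x i - y i) * v i x := by
    have h2 := integral_mul_partialDeriv contDiff_kernel hg hasCompactSupport_kernel k
    simp only [hg', integral_mul_const, integral_kernel] at h2
    linarith
  have hc (w : Fin n → ℝ) : Continuous fun y : Space n => ∑ i, (x i - y i) * w i :=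
    continuous_finsetSum _ fun i _ =>
      (continuous_const.sub (contDiff_coord i).continuous).mul continuous_const
  have hc' : Continuous fun y : Space n => ∑ i, (x i - y i) * v i y :=
    continuous_finsetSum _ fun i _ =>
      (continuous_const.sub (contDiff_coord i).continuous).mul (hv i).continuous
  conv_lhs => rw [h1]
  rw [affineApprox, ← integral_sub (integrable_partialDeriv_kernel_mul (hc fun i => v i x) k)
    (integrable_partialDeriv_kernel_mul hc' k)]
  congr 1
  ext y
  rw [← mul_sub, ← Finset.sum_sub_distrib]
  congr 1
  exact Finset.sum_congr rfl fun i _ => by ring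

end LocalKorn

section LocalEstimates

variable {n : ℕ}

theorem sum_mul_mul_sq_le (d : Space n) (s : Fin n → Fin n → ℝ) :
    (∑ i, ∑ j, d i * d j * s i j) ^ 2 ≤ ‖d‖ ^ 4 * ∑ i, ∑ j, s i j ^ 2 := by
  have h := Finset.sum_mul_sq_le_sq_mul_sq (Finset.univ ×ˢ Finset.univ)
    (fun p : Fin n × Fin n => d p.1 * d p.2) (fun p => s p.1 p.2)
  rw [Finset.sum_product, Finset.sum_product, Finset.sum_product] at h
  refine h.trans_eq ?_
  congr 1
  rw [show ‖d‖ ^ 4 = ‖d‖ ^ 2 * ‖d‖ ^ 2 by ring, EuclideanSpace.real_norm_sq_eq,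
    Finset.sum_mul_sum]
  simp only [mul_pow]

theorem enorm_partialDeriv_kernel_mul_le {C : ℝ≥0} (hC : ∀ k x, ‖partialDeriv (kernel n) k x‖ₑ ≤ C)
    (k : Fin n) (f : Space n → ℝ≥0∞) :
    ∫⁻ y, ‖partialDeriv (kernel n) k y‖ₑ * f y ≤ C * ∫⁻ y in Metric.ball (0 : Space n) 1, f y := by
  rw [← lintegral_const_mul' _ _ ENNReal.coe_ne_top, ← lintegral_indicator measurableSet_ball]
  refine lintegral_mono fun y => ?_
  by_cases hy : y ∈ Metric.ball (0 : Space n) 1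
  · rw [Set.indicator_of_mem hy]
    gcongr
    exact hC k y
  · simp [partialDeriv_kernel_eq_zero k hy]

/-- The affine approximation is close to `v` in quadratic mean, with an error controlled by the
strain. -/
theorem exists_lintegral_sub_affineApprox_le (n : ℕ) : ∃ C : ℝ≥0, ∀ v : Fin n → Space n → ℝ,
    (∀ i, ContDiff ℝ ∞ (v i)) → ∀ k,
    ∫⁻ x in Metric.ball (0 : Space n) 2, ENNReal.ofReal ((v k x - affineApprox v k x) ^ 2)
      ≤ C * ∫⁻ x in Metric.ball (0 : Space n) 2, ENNReal.ofReal (strainSq v x) := by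
  obtain ⟨C, hC⟩ := exists_bound_partialDeriv (contDiff_kernel (n := n)) hasCompactSupport_kernel
  set B1 := Metric.ball (0 : Space n) 1
  set B2 := Metric.ball (0 : Space n) 2
  let K : ℝ≥0∞ := C * volume B1 * (C * (81 * (ENNReal.ofReal (2 ^ n) * volume B2)))
  have hK : K ≠ ⊤ := by
    have h1 : volume B1 ≠ ⊤ := measure_ball_lt_top.ne
    have h2 : volume B2 ≠ ⊤ := measure_ball_lt_top.ne
    finiteness
  refine ⟨K.toNNReal, fun v hv k => ?_⟩
  rw [ENNReal.coe_toNNReal hK]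
  have hF : Measurable fun x => ENNReal.ofReal (strainSq v x) :=
    (continuous_strainSq hv).measurable.ennreal_ofReal
  -- The increment along the segment is an integral of the strain; squaring it costs `‖x - y‖ ^ 4 ≤
  -- 3 ^ 4 = 81`.
  have hL (x y : Space n) (hx : x ∈ B2) (hy : y ∈ B1) :
      ‖∑ i, (x i - y i) * (v i x - v i y)‖ₑ ^ 2
        ≤ 81 * ∫⁻ t in Set.Ioc (0 : ℝ) 1, ENNReal.ofReal (strainSq v (y + t • (x - y))) := by
    rw [sum_mul_sub_eq_integral hv, intervalIntegral.integral_of_le zero_le_one]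
    have hm : Continuous fun t : ℝ => ∑ i, ∑ j, (x i - y i) * (x j - y j) *
        symGrad v i j (y + t • (x - y)) := by
      refine continuous_finsetSum _ fun i _ => continuous_finsetSum _ fun j _ => ?_
      exact continuous_const.mul ((contDiff_symGrad hv i j).continuous.comp (by fun_prop))
    have hn : ‖x - y‖ ≤ 3 := by
      have h1 := mem_ball_zero_iff.1 hx
      have h2 := mem_ball_zero_iff.1 hy
      linarith [norm_sub_le x y]
    refine (pow_le_pow_left₀ zero_le (enorm_integral_le_lintegral_enorm _) 2).trans ?_
    refine (lintegral_sq_le hm.enorm.measurable.aemeasurable).trans ?_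
    rw [Measure.restrict_apply_univ, Real.volume_Ioc, sub_zero, ENNReal.ofReal_one, one_mul,
      ← lintegral_const_mul' _ _ (by norm_num)]
    refine lintegral_mono fun t => ?_
    rw [enorm_sq_eq_ofReal, show (81 : ℝ≥0∞) = ENNReal.ofReal (3 ^ 4) by norm_num,
      ← ENNReal.ofReal_mul (by norm_num)]
    refine ENNReal.ofReal_le_ofReal ((sum_mul_mul_sq_le (x - y) _).trans ?_)
    have := strainSq_nonneg v (y + t • (x - y))
    exact mul_le_mul (pow_le_pow_left₀ (norm_nonneg _) hn 4) le_rfl this (by norm_num)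
  have hx (x : Space n) (hxB : x ∈ B2) : ENNReal.ofReal ((v k x - affineApprox v k x) ^ 2)
      ≤ C * volume B1 * (C * (81 * ∫⁻ y in B1, ∫⁻ t in Set.Ioc (0 : ℝ) 1,
        ENNReal.ofReal (strainSq v (y + t • (x - y))))) := by
    rw [← enorm_sq_eq_ofReal, sub_affineApprox_eq hv]
    have hm : Continuous fun y : Space n => ∑ i, (x i - y i) * (v i x - v i y) :=
      continuous_finsetSum _ fun i _ => (continuous_const.sub (contDiff_coord i).continuous).mul
        (continuous_const.sub (hv i).continuous)
    refine (pow_le_pow_left₀ zero_le (enorm_integral_le_lintegral_enorm _) 2).trans ?_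
    simp only [enorm_mul]
    refine (lintegral_mul_sq_le
      (continuous_partialDeriv contDiff_kernel k).enorm.measurable
      hm.enorm.measurable.aemeasurable).trans ?_
    have h1 := enorm_partialDeriv_kernel_mul_le hC k (fun _ => 1)
    simp only [mul_one, setLIntegral_const, one_mul] at h1
    refine mul_le_mul' h1 ((enorm_partialDeriv_kernel_mul_le hC k _).trans ?_)
    gcongr
    rw [← lintegral_const_mul' _ _ (by norm_num)]
    exact setLIntegral_mono' measurableSet_ball fun y hy => hL x y hxB hy
  calc _ ≤ ∫⁻ x in B2, C * volume B1 * (C * (81 * ∫⁻ y in B1, ∫⁻ t in Set.Ioc (0 : ℝ) 1,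
        ENNReal.ofReal (strainSq v (y + t • (x - y))))) :=
        setLIntegral_mono' measurableSet_ball hx
    _ = C * volume B1 * (C * (81 * ∫⁻ x in B2, ∫⁻ y in B1, ∫⁻ t in Set.Ioc (0 : ℝ) 1,
        ENNReal.ofReal (strainSq v (y + t • (x - y))))) := by
        rw [lintegral_const_mul', lintegral_const_mul', lintegral_const_mul']
        · norm_num
        · finiteness
        · have h1 : volume B1 ≠ ⊤ := measure_ball_lt_top.ne
          finiteness
    _ ≤ _ := by
        rw [show K * ∫⁻ x in B2, ENNReal.ofReal (strainSq v x) = C * volume B1 * (C * (81 *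
          ((ENNReal.ofReal (2 ^ n) * volume B2) *
            ∫⁻ x in B2, ENNReal.ofReal (strainSq v x)))) by simp only [K]; ring]
        gcongr
        exact lintegral_segment_le hF

end LocalEstimates

/-! ### Korn's second inequality on a ball. -/

section LocalKornInequality

variable {n : ℕ}

/-- Integrating against a bounded kernel supported in the unit ball is bounded in quadratic
mean. -/
theorem exists_integral_mul_sq_le {ζ : Space n → ℝ} (hζ : Continuous ζ)
    (h0 : ∀ x ∉ Metric.ball (0 : Space n) 1, ζ x = 0) :
    ∃ C : ℝ≥0, ∀ f : Space n → ℝ, Continuous f →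
      ENNReal.ofReal ((∫ z, ζ z * f z) ^ 2)
        ≤ C * ∫⁻ z in Metric.ball (0 : Space n) 1, ENNReal.ofReal (f z ^ 2) := by
  have hc : HasCompactSupport ζ :=
    HasCompactSupport.of_support_subset_isCompact (isCompact_closedBall (0 : Space n) 1)
      fun x hx => by
        by_contra h
        exact hx (h0 x fun hb => h (Metric.ball_subset_closedBall hb))
  obtain ⟨M, hM⟩ := hζ.bounded_above_of_compact_support hc
  set B1 := Metric.ball (0 : Space n) 1
  have hle (g : Space n → ℝ≥0∞) :
      ∫⁻ z, ‖ζ z‖ₑ * g z ≤ M.toNNReal * ∫⁻ z in B1, g z := by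
    rw [← lintegral_const_mul' _ _ ENNReal.coe_ne_top, ← lintegral_indicator measurableSet_ball]
    refine lintegral_mono fun y => ?_
    by_cases hy : y ∈ B1
    · rw [Set.indicator_of_mem hy]
      gcongr
      rw [← ofReal_norm]
      exact ENNReal.ofReal_le_ofReal (hM y)
    · simp [h0 y hy]
  have hK : (M.toNNReal : ℝ≥0∞) * volume B1 * M.toNNReal ≠ ⊤ := by
    have h1 : volume B1 ≠ ⊤ := measure_ball_lt_top.ne
    finiteness
  refine ⟨((M.toNNReal : ℝ≥0∞) * volume B1 * M.toNNReal).toNNReal, fun f hf => ?_⟩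
  rw [ENNReal.coe_toNNReal hK, ← enorm_sq_eq_ofReal]
  refine (pow_le_pow_left₀ zero_le (enorm_integral_le_lintegral_enorm _) 2).trans ?_
  simp only [enorm_mul, ← enorm_sq_eq_ofReal]
  refine (lintegral_mul_sq_le hζ.enorm.measurable hf.enorm.measurable.aemeasurable).trans ?_
  have h1 := hle fun _ => 1
  simp only [mul_one, setLIntegral_const, one_mul] at h1
  rw [mul_assoc _ (M.toNNReal : ℝ≥0∞)]
  exact mul_le_mul' h1 (hle _)

theorem kernel_eq_zero {x : Space n} (hx : x ∉ Metric.ball (0 : Space n) 1) : kernel n x = 0 := by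
  rw [← support_kernel] at hx
  exact Function.notMem_support.1 hx

/-- The linear part of the affine approximation is skew up to a mean of the strain, so subtracting
it alters the strain only by a controlled constant. -/
theorem symGrad_affineCoeff_eq {v : Fin n → Space n → ℝ} (hv : ∀ i, ContDiff ℝ ∞ (v i))
    (i j : Fin n) :
    (affineCoeff v i j + affineCoeff v j i) / 2 = -∫ y, kernel n y * symGrad v i j y := by
  have hint (a b : Fin n) : Integrable fun y => kernel n y * partialDeriv (v a) b y :=
    integrable_mul_of_hasCompactSupport contDiff_kernel.continuous
      (continuous_partialDeriv (hv a) b) hasCompactSupport_kernel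
  have h : ∫ y, kernel n y * symGrad v i j y = ((∫ y, kernel n y * partialDeriv (v i) j y)
      + ∫ y, kernel n y * partialDeriv (v j) i y) / 2 := by
    rw [← integral_add (hint i j) (hint j i), ← integral_div]
    congr 1
    ext y
    simp only [symGrad]
    ring
  rw [affineCoeff_eq hv, affineCoeff_eq hv, h]
  ring

/-- Korn's second inequality on a ball: the gradient of `v` is close to a constant matrix. -/
theorem exists_lintegral_partialDeriv_sub_le (n : ℕ) : ∃ C : ℝ≥0, ∀ v : Fin n → Space n → ℝ,
    (∀ i, ContDiff ℝ ∞ (v i)) → ∀ k j,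
    ∫⁻ x in Metric.ball (0 : Space n) 1,
        ENNReal.ofReal ((partialDeriv (v k) j x - affineCoeff v k j) ^ 2)
      ≤ C * ∫⁻ x in Metric.ball (0 : Space n) 2, ENNReal.ofReal (strainSq v x) := by
  obtain ⟨P, hP⟩ := exists_lintegral_sub_affineApprox_le n
  obtain ⟨T, hT⟩ := exists_bound_partialDeriv (contDiff_cutoff (n := n)) hasCompactSupport_cutoff
  obtain ⟨M, hM⟩ := exists_integral_mul_sq_le (n := n) contDiff_kernel.continuous
    fun x => kernel_eq_zero
  set B1 := Metric.ball (0 : Space n) 1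
  set B2 := Metric.ball (0 : Space n) 2
  have hT' (k : Fin n) (x : Space n) : partialDeriv (cutoff n) k x ^ 2 ≤ (T : ℝ) ^ 2 := by
    refine sq_le_sq' ?_ ?_
    all_goals
      have h1 := hT k x
      rw [enorm_le_coe, ← NNReal.coe_le_coe, coe_nnnorm, Real.norm_eq_abs] at h1
      linarith [neg_abs_le (partialDeriv (cutoff n) k x), le_abs_self (partialDeriv (cutoff n) k x)]
  let K : ℝ≥0∞ := 2 * ((n * n : ℕ) * (4 * (1 + M * volume B2 + 2 * (ENNReal.ofReal (T ^ 2) * P))))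
  have hK : K ≠ ⊤ := by
    have h2 : volume B2 ≠ ⊤ := measure_ball_lt_top.ne
    finiteness
  refine ⟨K.toNNReal, fun v hv k j => ?_⟩
  rw [ENNReal.coe_toNNReal hK]
  set S := ∫⁻ x in B2, ENNReal.ofReal (strainSq v x)
  -- The first inequality applies to the cut-off remainder `w`. Derivatives falling on the cutoff
  -- produce multiples of `u`, which the quadratic estimate for the affine approximation already
  -- bounds by the strain.
  let u : Fin n → Space n → ℝ := fun k x => v k x - affineApprox v k x
  let w : Fin n → Space n → ℝ := fun k x => cutoff n x * u k x
  have hu (i : Fin n) : ContDiff ℝ ∞ (u i) := (hv i).sub (contDiff_affineApprox hv i)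
  have hw (i : Fin n) : ContDiff ℝ ∞ (w i) := contDiff_cutoff.mul (hu i)
  have hwc (i : Fin n) : HasCompactSupport (w i) := hasCompactSupport_cutoff.mul_right
  have hdu (i j : Fin n) (x : Space n) :
      partialDeriv (u i) j x = partialDeriv (v i) j x - affineCoeff v i j := by
    rw [partialDeriv_sub (hv i) (contDiff_affineApprox hv i), partialDeriv_affineApprox hv]
  have hdw (i j : Fin n) (x : Space n) : partialDeriv (w i) j x
      = cutoff n x * (partialDeriv (v i) j x - affineCoeff v i j)
        + partialDeriv (cutoff n) j x * u i x := by
    rw [partialDeriv_mul contDiff_cutoff (hu i), hdu]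
  let m : Fin n → Fin n → ℝ := fun i j => ∫ y, kernel n y * symGrad v i j y
  have hsym (i j : Fin n) (x : Space n) : symGrad w i j x
      = cutoff n x * (symGrad v i j x + m i j)
        + (partialDeriv (cutoff n) j x * u i x + partialDeriv (cutoff n) i x * u j x) / 2 := by
    have h1 := symGrad_affineCoeff_eq hv i j
    simp only [symGrad, hdw]
    simp only [symGrad] at h1
    simp only [m, symGrad]
    linear_combination (-cutoff n x) * h1
  have hzero (i j : Fin n) (x : Space n) (hx : x ∉ B2) : symGrad w i j x = 0 := by
    rw [hsym, cutoff_eq_zero hx, partialDeriv_cutoff_eq_zero i hx,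
      partialDeriv_cutoff_eq_zero j hx]
    ring
  have hpt (i j : Fin n) (x : Space n) : ENNReal.ofReal (symGrad w i j x ^ 2)
      ≤ 4 * (ENNReal.ofReal (symGrad v i j x ^ 2) + ENNReal.ofReal (m i j ^ 2)
        + ENNReal.ofReal (T ^ 2) * (ENNReal.ofReal (u i x ^ 2) + ENNReal.ofReal (u j x ^ 2))) := by
    rw [← ENNReal.ofReal_add (by positivity) (by positivity),
      ← ENNReal.ofReal_add (by positivity) (by positivity), ← ENNReal.ofReal_mul (by positivity),
      ← ENNReal.ofReal_add (by positivity) (by positivity),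
      show (4 : ℝ≥0∞) = ENNReal.ofReal 4 by norm_num, ← ENNReal.ofReal_mul (by positivity)]
    refine ENNReal.ofReal_le_ofReal ?_
    rw [hsym]
    have h1 := cutoff_nonneg x
    have h2 := cutoff_le_one x
    have h3 : (partialDeriv (cutoff n) j x * u i x) ^ 2 ≤ T ^ 2 * u i x ^ 2 := by
      rw [mul_pow]; exact mul_le_mul_of_nonneg_right (hT' j x) (sq_nonneg _)
    have h4 : (partialDeriv (cutoff n) i x * u j x) ^ 2 ≤ T ^ 2 * u j x ^ 2 := by
      rw [mul_pow]; exact mul_le_mul_of_nonneg_right (hT' i x) (sq_nonneg _)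
    have h5 : (cutoff n x * (symGrad v i j x + m i j)) ^ 2 ≤ (symGrad v i j x + m i j) ^ 2 := by
      rw [mul_pow]
      exact mul_le_of_le_one_left (sq_nonneg _) (pow_le_one₀ h1 h2)
    set a := cutoff n x * (symGrad v i j x + m i j)
    set b := partialDeriv (cutoff n) j x * u i x
    set c := partialDeriv (cutoff n) i x * u j x
    nlinarith [sq_nonneg (a - (b + c) / 2), sq_nonneg (b - c),
      sq_nonneg (symGrad v i j x - m i j), sq_nonneg b, sq_nonneg c]
  have hmS (i j : Fin n) : ENNReal.ofReal (m i j ^ 2) ≤ M * S := by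
    refine (hM _ (contDiff_symGrad hv i j).continuous).trans ?_
    gcongr
    refine (lintegral_mono fun x => ENNReal.ofReal_le_ofReal
      (symGrad_sq_le_strainSq v i j x)).trans ?_
    exact lintegral_mono_set (Metric.ball_subset_ball (by norm_num))
  have hij (i j : Fin n) : ∫⁻ x, ENNReal.ofReal (symGrad w i j x ^ 2)
      ≤ 4 * (1 + M * volume B2 + 2 * (ENNReal.ofReal (T ^ 2) * P)) * S := by
    have hmeas (i : Fin n) : Measurable fun x => ENNReal.ofReal (u i x ^ 2) :=
      ((hu i).continuous.pow 2).measurable.ennreal_ofReal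
    have hmeas' : Measurable fun x => ENNReal.ofReal (symGrad v i j x ^ 2) :=
      ((contDiff_symGrad hv i j).continuous.pow 2).measurable.ennreal_ofReal
    calc ∫⁻ x, ENNReal.ofReal (symGrad w i j x ^ 2)
        = ∫⁻ x in B2, ENNReal.ofReal (symGrad w i j x ^ 2) := by
          refine (setLIntegral_eq_of_support_subset fun x hx => ?_).symm
          by_contra h
          exact hx (by simp [hzero i j x h])
      _ ≤ ∫⁻ x in B2, 4 * (ENNReal.ofReal (symGrad v i j x ^ 2) + ENNReal.ofReal (m i j ^ 2)
        + ENNReal.ofReal (T ^ 2) * (ENNReal.ofReal (u i x ^ 2) + ENNReal.ofReal (u j x ^ 2))) :=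
          lintegral_mono fun x => hpt i j x
      _ = 4 * ((∫⁻ x in B2, ENNReal.ofReal (symGrad v i j x ^ 2))
          + ENNReal.ofReal (m i j ^ 2) * volume B2
          + ENNReal.ofReal (T ^ 2) * ((∫⁻ x in B2, ENNReal.ofReal (u i x ^ 2))
            + ∫⁻ x in B2, ENNReal.ofReal (u j x ^ 2))) := by
          rw [lintegral_const_mul' _ _ (by norm_num), lintegral_add_left (by fun_prop),
            lintegral_add_left hmeas', setLIntegral_const,
            lintegral_const_mul' _ _ ENNReal.ofReal_ne_top, lintegral_add_left (hmeas i)]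
      _ ≤ 4 * (S + M * S * volume B2 + ENNReal.ofReal (T ^ 2) * (P * S + P * S)) := by
          gcongr
          · exact lintegral_mono fun x => ENNReal.ofReal_le_ofReal (symGrad_sq_le_strainSq v i j x)
          · exact hmS i j
          · exact hP v hv i
          · exact hP v hv j
      _ = _ := by ring
  have hkorn : ∫⁻ x, ENNReal.ofReal (partialDeriv (w k) j x ^ 2)
      ≤ 2 * ∫⁻ x, ENNReal.ofReal (strainSq w x) := by
    have h1 := integral_grad_sq_le_strainSq hw hwc k j
    have i1 : Integrable fun x => partialDeriv (w k) j x ^ 2 := by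
      simp only [sq]
      exact integrable_mul_of_hasCompactSupport (continuous_partialDeriv (hw k) j)
        (continuous_partialDeriv (hw k) j) (hasCompactSupport_partialDeriv (hwc k) j)
    have i2 : Integrable (strainSq w) := by
      refine (continuous_strainSq hw).integrable_of_hasCompactSupport ?_
      refine HasCompactSupport.of_support_subset_isCompact (isCompact_closedBall (0 : Space n) 2)
        fun x hx => ?_
      by_contra h
      refine hx ?_
      simp only [strainSq]
      refine Finset.sum_eq_zero fun a _ => Finset.sum_eq_zero fun b _ => ?_
      rw [hzero a b x fun hb => h (Metric.ball_subset_closedBall hb)]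
      norm_num
    rw [← ofReal_integral_eq_lintegral_ofReal i1 (ae_of_all _ fun x => sq_nonneg _),
      ← ofReal_integral_eq_lintegral_ofReal i2 (ae_of_all _ fun x => strainSq_nonneg w x)]
    refine (ENNReal.ofReal_le_ofReal h1).trans_eq ?_
    rw [ENNReal.ofReal_mul (by norm_num), ENNReal.ofReal_ofNat]
  calc ∫⁻ x in B1, ENNReal.ofReal ((partialDeriv (v k) j x - affineCoeff v k j) ^ 2)
      = ∫⁻ x in B1, ENNReal.ofReal (partialDeriv (w k) j x ^ 2) := by
        refine setLIntegral_congr_fun measurableSet_ball fun x hx => ?_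
        have h1 : w k =ᶠ[𝓝 x] u k := by
          filter_upwards [Metric.isOpen_ball.mem_nhds hx] with y hy
          simp [w, cutoff_eq_one hy]
        rw [← hdu, partialDeriv, partialDeriv, h1.fderiv_eq]
    _ ≤ ∫⁻ x, ENNReal.ofReal (partialDeriv (w k) j x ^ 2) := setLIntegral_le_lintegral _ _
    _ ≤ 2 * ∫⁻ x, ENNReal.ofReal (strainSq w x) := hkorn
    _ = 2 * ∑ i, ∑ j, ∫⁻ x, ENNReal.ofReal (symGrad w i j x ^ 2) := by
        congr 1
        have h1 (a b : Fin n) : Measurable fun x => ENNReal.ofReal (symGrad w a b x ^ 2) :=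
          ((contDiff_symGrad hw a b).continuous.pow 2).measurable.ennreal_ofReal
        have h2 (x : Space n) : ENNReal.ofReal (strainSq w x)
            = ∑ i, ∑ j, ENNReal.ofReal (symGrad w i j x ^ 2) := by
          rw [strainSq, ENNReal.ofReal_sum_of_nonneg fun _ _ =>
            Finset.sum_nonneg fun _ _ => sq_nonneg _]
          exact Finset.sum_congr rfl fun a _ =>
            ENNReal.ofReal_sum_of_nonneg fun _ _ => sq_nonneg _
        simp only [h2]
        rw [lintegral_finsetSum _ fun a _ => Finset.measurable_fun_sum _ fun b _ => h1 a b]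
        exact Finset.sum_congr rfl fun a _ => lintegral_finsetSum _ fun b _ => h1 a b
    _ ≤ 2 * ∑ _i : Fin n, ∑ _j : Fin n,
          4 * (1 + M * volume B2 + 2 * (ENNReal.ofReal (T ^ 2) * P)) * S := by
        gcongr
        exact hij _ _
    _ = K * S := by
        simp only [Finset.sum_const, Finset.card_univ, Fintype.card_fin, nsmul_eq_mul, K]
        push_cast
        ring

end LocalKornInequality

/-! ### Local estimates at arbitrary scale. -/

section Scaling

variable {n : ℕ}

/-- The average of `∂ₖ vⱼ` at scale `d` around `x`. -/
def avgGrad (v : Fin n → Space n → ℝ) (j k : Fin n) (d : ℝ) (x : Space n) : ℝ :=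
  ∫ z, kernel n z * partialDeriv (v j) k (x + d • z)

theorem contDiff_comp_affine {f : Space n → ℝ} (hf : ContDiff ℝ ∞ f) (x : Space n) (d : ℝ) :
    ContDiff ℝ ∞ fun z : Space n => f (x + d • z) :=
  hf.comp (contDiff_const.add (contDiff_id.const_smul d))

/-- Korn's second inequality on a ball of arbitrary center and radius. -/
theorem exists_lintegral_partialDeriv_add_avgGrad_le (n : ℕ) :
    ∃ C : ℝ≥0, ∀ v : Fin n → Space n → ℝ, (∀ i, ContDiff ℝ ∞ (v i)) →
    ∀ k j (x : Space n) (d : ℝ), 0 < d →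
    ∫⁻ z in Metric.ball (0 : Space n) 1,
        ENNReal.ofReal ((partialDeriv (v k) j (x + d • z) + avgGrad v j k d x) ^ 2)
      ≤ C * ∫⁻ z in Metric.ball (0 : Space n) 2, ENNReal.ofReal (strainSq v (x + d • z)) := by
  obtain ⟨C, hC⟩ := exists_lintegral_partialDeriv_sub_le n
  refine ⟨C, fun v hv k j x d hd => ?_⟩
  -- Dividing by `d` makes gradient and strain invariant under the rescaling, so the constant does
  -- not depend on `d`.
  let w : Fin n → Space n → ℝ := fun i z => d⁻¹ * v i (x + d • z)
  have hw' (i : Fin n) := contDiff_comp_affine (hv i) x d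
  have hw (i : Fin n) : ContDiff ℝ ∞ (w i) := contDiff_const.mul (hw' i)
  have hpd (i j : Fin n) (z : Space n) :
      partialDeriv (w i) j z = partialDeriv (v i) j (x + d • z) := by
    rw [partialDeriv_const_mul (hw' i), partialDeriv_comp_affine (hv i), ← mul_assoc,
      inv_mul_cancel₀ hd.ne', one_mul]
  have h := hC w hw k j
  have e1 (z : Space n) : strainSq w z = strainSq v (x + d • z) := by
    simp only [strainSq, symGrad, hpd]
  -- The linear part is minus the transposed mean gradient, hence the plus sign in the conclusion.
  have e2 : affineCoeff w k j = -avgGrad v j k d x := by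
    rw [affineCoeff_eq hw]
    simp only [hpd]
    rfl
  simp only [e1, e2, hpd, sub_neg_eq_add] at h
  exact h

/-- The `L²` norm on a ball is controlled by the `L¹` norm and the strain. -/
theorem exists_lintegral_sq_le (n : ℕ) :
    ∃ C : ℝ≥0, ∀ v : Fin n → Space n → ℝ, (∀ i, ContDiff ℝ ∞ (v i)) →
    ∀ k (x : Space n) (d : ℝ), 0 < d →
    ∫⁻ z in Metric.ball (0 : Space n) 1, ENNReal.ofReal (v k (x + d • z) ^ 2)
      ≤ C * ((∑ i, ∫⁻ z in Metric.ball (0 : Space n) 1, ‖v i (x + d • z)‖ₑ) ^ 2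
        + ENNReal.ofReal (d ^ 2) * ∫⁻ z in Metric.ball (0 : Space n) 2,
          ENNReal.ofReal (strainSq v (x + d • z))) := by
  obtain ⟨P, hP⟩ := exists_lintegral_sub_affineApprox_le n
  obtain ⟨M, hM⟩ := exists_bound_partialDeriv (contDiff_kernel (n := n)) hasCompactSupport_kernel
  set B1 := Metric.ball (0 : Space n) 1
  set B2 := Metric.ball (0 : Space n) 2
  let K : ℝ≥0∞ := 2 * (P + (M * 2) ^ 2 * volume B1)
  have hK : K ≠ ⊤ := by
    have h2 : volume B1 ≠ ⊤ := measure_ball_lt_top.ne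
    finiteness
  refine ⟨K.toNNReal, fun v hv k x d hd => ?_⟩
  rw [ENNReal.coe_toNNReal hK]
  -- Without division by `d` the rescaled strain carries a factor `d`, which gives the `d ^ 2` of
  -- the conclusion.
  let w : Fin n → Space n → ℝ := fun i z => v i (x + d • z)
  have hw (i : Fin n) : ContDiff ℝ ∞ (w i) := contDiff_comp_affine (hv i) x d
  have hs (z : Space n) : ENNReal.ofReal (strainSq w z)
      = ENNReal.ofReal (d ^ 2) * ENNReal.ofReal (strainSq v (x + d • z)) := by
    rw [← ENNReal.ofReal_mul (sq_nonneg _)]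
    congr 1
    simp only [strainSq, symGrad, w, partialDeriv_comp_affine (hv _), Finset.mul_sum]
    exact Finset.sum_congr rfl fun a _ => Finset.sum_congr rfl fun b _ => by ring
  have h1 := hP w hw k
  simp only [hs] at h1
  rw [lintegral_const_mul' _ _ ENNReal.ofReal_ne_top] at h1
  set S := ENNReal.ofReal (d ^ 2) * ∫⁻ z in B2, ENNReal.ofReal (strainSq v (x + d • z))
  set N := ∑ i, ∫⁻ z in B1, ‖w i z‖ₑ
  -- The affine approximation sees the field only through integrals against derivatives of the
  -- kernel, so an `L¹` norm controls it; the 2 bounds `|zᵢ - yᵢ|` on the unit ball.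
  have h2 (z : Space n) (hz : z ∈ B1) : ENNReal.ofReal (affineApprox w k z ^ 2)
      ≤ (M * 2) ^ 2 * N ^ 2 := by
    rw [← enorm_sq_eq_ofReal, ← mul_pow]
    refine pow_le_pow_left₀ zero_le ?_ 2
    refine (enorm_integral_le_lintegral_enorm _).trans ?_
    simp only [enorm_mul]
    refine (enorm_partialDeriv_kernel_mul_le hM k _).trans ?_
    rw [mul_assoc]
    gcongr
    have hm (i : Fin n) : Measurable fun y => (2 : ℝ≥0∞) * ‖w i y‖ₑ :=
      (hw i).continuous.enorm.measurable.const_mul _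
    calc ∫⁻ y in B1, ‖∑ i, (z i - y i) * w i y‖ₑ ≤ ∫⁻ y in B1, ∑ i, 2 * ‖w i y‖ₑ := by
          refine setLIntegral_mono' measurableSet_ball fun y hy => ?_
          refine (enorm_sum_le _ _).trans (Finset.sum_le_sum fun i _ => ?_)
          rw [enorm_mul]
          gcongr
          rw [← ofReal_norm]
          refine ENNReal.ofReal_le_of_le_toReal ?_
          rw [ENNReal.toReal_ofNat]
          have e1 := mem_ball_zero_iff.1 hz
          have e2 := mem_ball_zero_iff.1 hy
          have e3 := PiLp.norm_apply_le z i
          have e4 := PiLp.norm_apply_le y i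
          linarith [norm_sub_le (z i) (y i)]
      _ = 2 * N := by
          rw [lintegral_finsetSum _ fun i _ => hm i, Finset.mul_sum]
          exact Finset.sum_congr rfl fun i _ => lintegral_const_mul' _ _ (by norm_num)
  calc ∫⁻ z in B1, ENNReal.ofReal (w k z ^ 2)
      ≤ ∫⁻ z in B1, 2 * (ENNReal.ofReal ((w k z - affineApprox w k z) ^ 2)
          + ENNReal.ofReal (affineApprox w k z ^ 2)) :=
        lintegral_mono fun z => by
          simpa using ofReal_add_sq_le (w k z - affineApprox w k z) (affineApprox w k z)
    _ = 2 * ((∫⁻ z in B1, ENNReal.ofReal ((w k z - affineApprox w k z) ^ 2))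
          + ∫⁻ z in B1, ENNReal.ofReal (affineApprox w k z ^ 2)) := by
        rw [lintegral_const_mul' _ _ (by norm_num), lintegral_add_left]
        exact (((hw k).continuous.sub
          (contDiff_affineApprox hw k).continuous).pow 2).measurable.ennreal_ofReal
    _ ≤ 2 * (P * S + (M * 2) ^ 2 * N ^ 2 * volume B1) := by
        gcongr
        · exact (lintegral_mono_set (Metric.ball_subset_ball (by norm_num))).trans h1
        · rw [← setLIntegral_const]
          exact setLIntegral_mono' measurableSet_ball h2
    _ ≤ 2 * ((P + (M * 2) ^ 2 * volume B1) * S + (P + (M * 2) ^ 2 * volume B1) * N ^ 2) := by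
        rw [mul_right_comm]
        gcongr
        · exact le_self_add
        · exact le_add_self
    _ = K * (N ^ 2 + S) := by simp only [K]; ring

end Scaling

/-! ### Averages over balls of variable radius. -/

section VariableScale

variable {n : ℕ} {δ : Space n → ℝ} {D : Set (Space n)}

/-- Average over balls of radius `r * δ x` around `x ∈ D`, as a weighted integral. -/
theorem lintegral_variable_scale (hδ : Continuous δ) (hD : MeasurableSet D)
    (hpos : ∀ x ∈ D, 0 < δ x) {f : Space n → ℝ≥0∞} (hf : Measurable f) (r : ℝ) :
    ∫⁻ x in D, ∫⁻ z in Metric.ball (0 : Space n) r, f (x + δ x • z)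
      = ∫⁻ y, f y * ∫⁻ x in D ∩ {x | dist y x < r * δ x}, ENNReal.ofReal ((δ x ^ n)⁻¹) := by
  have h1 (x : Space n) (hx : x ∈ D) : ∫⁻ z in Metric.ball (0 : Space n) r, f (x + δ x • z)
      = ∫⁻ y, ENNReal.ofReal ((δ x ^ n)⁻¹) *
        (Metric.ball x (r * δ x)).indicator f y := by
    rw [lintegral_const_mul _ (hf.indicator measurableSet_ball),
      ← lintegral_comp_affine (hf.indicator measurableSet_ball) x (hpos x hx),
      ← lintegral_indicator measurableSet_ball]
    refine lintegral_congr fun z => ?_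
    have : x + δ x • z ∈ Metric.ball x (r * δ x) ↔ z ∈ Metric.ball (0 : Space n) r := by
      rw [mem_ball_iff_norm, mem_ball_zero_iff, add_sub_cancel_left, norm_smul, Real.norm_eq_abs,
        abs_of_pos (hpos x hx), mul_comm r, mul_lt_mul_iff_right₀ (hpos x hx)]
    by_cases hz : z ∈ Metric.ball (0 : Space n) r
    · rw [Set.indicator_of_mem hz, Set.indicator_of_mem (this.2 hz)]
    · rw [Set.indicator_of_notMem hz, Set.indicator_of_notMem (fun h => hz (this.1 h))]
  have hset : MeasurableSet {p : Space n × Space n | dist p.2 p.1 < r * δ p.1} :=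
    measurableSet_lt (by fun_prop) (by fun_prop)
  have hm : Measurable fun p : Space n × Space n => ENNReal.ofReal ((δ p.1 ^ n)⁻¹) *
      (Metric.ball p.1 (r * δ p.1)).indicator f p.2 := by
    refine Measurable.mul (by fun_prop) ?_
    exact (hf.comp measurable_snd).indicator hset
  rw [setLIntegral_congr_fun hD h1, lintegral_lintegral_swap hm.aemeasurable]
  refine lintegral_congr fun y => ?_
  have hset' : MeasurableSet {x | dist y x < r * δ x} :=
    measurableSet_lt (by fun_prop) (by fun_prop)
  rw [Set.inter_comm, ← Measure.restrict_restrict hset', ← lintegral_indicator hset',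
    ← lintegral_const_mul]
  · refine lintegral_congr fun x => ?_
    by_cases hx : dist y x < r * δ x
    · rw [Set.indicator_of_mem (show y ∈ Metric.ball x (r * δ x) from hx),
        Set.indicator_of_mem (show x ∈ {x | dist y x < r * δ x} from hx), mul_comm]
    · rw [Set.indicator_of_notMem (show y ∉ Metric.ball x (r * δ x) from hx),
        Set.indicator_of_notMem (show x ∉ {x | dist y x < r * δ x} from hx), mul_zero, mul_zero]
  · exact Measurable.indicator (by fun_prop) hset'

theorem volume_ball_eq (x : Space n) {r : ℝ} (hr : 0 < r) :
    volume (Metric.ball x r)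
      = ENNReal.ofReal (r ^ n) * volume (Metric.ball (0 : Space n) 1) := by
  rw [Measure.addHaar_ball_of_pos _ _ hr]
  simp

/-- If `|x - y| < 2 δ(x)`, the Lipschitz bound gives `δ(x) ≥ 2/3 δ(y)` and `|x - y| < 4 δ(y)`. The
total weight received by `y` is thus at most `(4 / (2/3)) ^ n = 6 ^ n` times the volume of the unit
ball. -/
theorem lintegral_variable_scale_le (hδ : LipschitzWith (1 / 4) δ) (hD : MeasurableSet D)
    (hpos : ∀ x ∈ D, 0 < δ x) {f : Space n → ℝ≥0∞} (hf : Measurable f) {V : Set (Space n)}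
    (hV : ∀ x ∈ D, ∀ z ∈ Metric.ball (0 : Space n) 2, x + δ x • z ∈ V) (hVm : MeasurableSet V) :
    ∫⁻ x in D, ∫⁻ z in Metric.ball (0 : Space n) 2, f (x + δ x • z)
      ≤ (ENNReal.ofReal (6 ^ n) * volume (Metric.ball (0 : Space n) 1)) * ∫⁻ y in V, f y := by
  have h1 : ∫⁻ x in D, ∫⁻ z in Metric.ball (0 : Space n) 2, f (x + δ x • z)
      = ∫⁻ x in D, ∫⁻ z in Metric.ball (0 : Space n) 2, V.indicator f (x + δ x • z) :=
    setLIntegral_congr_fun hD fun x hx =>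
      setLIntegral_congr_fun measurableSet_ball fun z hz => by
        rw [Set.indicator_of_mem (hV x hx z hz)]
  rw [h1, lintegral_variable_scale hδ.continuous hD hpos (hf.indicator hVm),
    ← lintegral_indicator hVm, ← lintegral_const_mul _ (hf.indicator hVm)]
  refine lintegral_mono fun y => ?_
  rw [mul_comm]
  gcongr
  have hlip (x : Space n) : |δ x - δ y| ≤ 1 / 4 * dist y x := by
    have := hδ.dist_le_mul x y
    rw [Real.dist_eq, dist_comm] at this
    simpa using this
  set A := D ∩ {x | dist y x < 2 * δ x}
  have hA (x : Space n) (hx : x ∈ A) : 0 < δ y ∧ 2 / 3 * δ y ≤ δ x ∧ dist x y < 4 * δ y := by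
    have h2 := hlip x
    have h3 : dist y x < 2 * δ x := hx.2
    have h4 := abs_le.1 h2
    have h5 := dist_nonneg (x := y) (y := x)
    have h6 := hpos x hx.1
    rw [dist_comm x y]
    refine ⟨?_, ?_, ?_⟩ <;> linarith
  by_cases hy : 0 < δ y
  · calc ∫⁻ x in A, ENNReal.ofReal ((δ x ^ n)⁻¹)
        ≤ ∫⁻ _ in A, ENNReal.ofReal (((2 / 3 * δ y) ^ n)⁻¹) := by
          refine setLIntegral_mono' (hD.inter (measurableSet_lt (by fun_prop)
            (hδ.continuous.measurable.const_mul _))) fun x hx => ?_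
          refine ENNReal.ofReal_le_ofReal ?_
          have := (hA x hx).2.1
          gcongr
      _ ≤ ENNReal.ofReal (((2 / 3 * δ y) ^ n)⁻¹) * volume (Metric.ball y (4 * δ y)) := by
          rw [setLIntegral_const]
          gcongr
          exact fun x hx => (hA x hx).2.2
      _ = _ := by
          rw [volume_ball_eq _ (by positivity), ← mul_assoc, ← ENNReal.ofReal_mul (by positivity),
            ← inv_pow, ← mul_pow]
          congr 3
          field_simp
          norm_num
  · have : A = ∅ := Set.eq_empty_of_forall_notMem fun x hx => hy (hA x hx).1
    simp [this]

/-- Every `x` within `δ(y) / 2` of `y` has `y` in its own ball and satisfies `δ(x) ≤ 9/8 δ(y)`. So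
`y` receives weight at least `((1/2) / (9/8)) ^ n = (4/9) ^ n` times the volume of the unit ball. -/
theorem lintegral_le_variable_scale (hδ : LipschitzWith (1 / 4) δ) (hD : MeasurableSet D)
    (hpos : ∀ x ∈ D, 0 < δ x) {f : Space n → ℝ≥0∞} (hf : Measurable f) {V : Set (Space n)}
    (hV : ∀ y ∈ V, 0 < δ y ∧ Metric.ball y (δ y / 2) ⊆ D) (hVm : MeasurableSet V) :
    ∫⁻ y in V, f y ≤ (ENNReal.ofReal ((4 / 9) ^ n) * volume (Metric.ball (0 : Space n) 1))⁻¹ *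
      ∫⁻ x in D, ∫⁻ z in Metric.ball (0 : Space n) 1, f (x + δ x • z) := by
  rw [lintegral_variable_scale hδ.continuous hD hpos hf]
  set c := ENNReal.ofReal ((4 / 9) ^ n) * volume (Metric.ball (0 : Space n) 1)
  have hc0 : c ≠ 0 := by
    have h1 : volume (Metric.ball (0 : Space n) 1) ≠ 0 :=
      (Metric.measure_ball_pos _ _ one_pos).ne'
    have h2 : ENNReal.ofReal ((4 / 9) ^ n) ≠ 0 := (ENNReal.ofReal_pos.2 (by positivity)).ne'
    exact mul_ne_zero h2 h1
  have hct : c ≠ ⊤ := by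
    have h1 : volume (Metric.ball (0 : Space n) 1) ≠ ⊤ := measure_ball_lt_top.ne
    finiteness
  rw [← lintegral_const_mul' _ _ (ENNReal.inv_ne_top.2 hc0), ← lintegral_indicator hVm]
  refine lintegral_mono fun y => ?_
  by_cases hy : y ∈ V
  swap
  · rw [Set.indicator_of_notMem hy]; exact zero_le
  rw [Set.indicator_of_mem hy]
  obtain ⟨hy0, hyD⟩ := hV y hy
  have hlip (x : Space n) : |δ x - δ y| ≤ 1 / 4 * dist x y := by
    have := hδ.dist_le_mul x y
    rw [Real.dist_eq] at this
    simpa using this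
  have key : c ≤ ∫⁻ x in D ∩ {x | dist y x < 1 * δ x}, ENNReal.ofReal ((δ x ^ n)⁻¹) := by
    have hx (x : Space n) (hx : x ∈ Metric.ball y (δ y / 2)) :
        dist y x < δ x ∧ δ x ≤ 9 / 8 * δ y := by
      have h1 : dist x y < δ y / 2 := hx
      have h2 := abs_le.1 (hlip x)
      rw [dist_comm y x]
      constructor <;> linarith
    calc c = ENNReal.ofReal (((9 / 8 * δ y) ^ n)⁻¹) * volume (Metric.ball y (δ y / 2)) := by
          change ENNReal.ofReal ((4 / 9) ^ n) * _ = _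
          rw [volume_ball_eq y (half_pos hy0), ← mul_assoc, ← ENNReal.ofReal_mul (by positivity),
            ← inv_pow, ← mul_pow]
          congr 3
          field_simp
          norm_num
      _ = ∫⁻ x in Metric.ball y (δ y / 2), ENNReal.ofReal (((9 / 8 * δ y) ^ n)⁻¹) := by
          rw [setLIntegral_const]
      _ ≤ ∫⁻ x in Metric.ball y (δ y / 2), ENNReal.ofReal ((δ x ^ n)⁻¹) := by
          refine setLIntegral_mono' measurableSet_ball fun x hxb => ENNReal.ofReal_le_ofReal ?_
          have h1 := (hx x hxb).2
          have h2 := hpos x (hyD hxb)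
          gcongr
      _ ≤ ∫⁻ x in D ∩ {x | dist y x < 1 * δ x}, ENNReal.ofReal ((δ x ^ n)⁻¹) :=
          lintegral_mono_set fun x hxb => ⟨hyD hxb, by
            change dist y x < 1 * δ x
            rw [one_mul]
            exact (hx x hxb).1⟩
  calc f y = c⁻¹ * (f y * c) := by
        rw [mul_comm (f y), ← mul_assoc, ENNReal.inv_mul_cancel hc0 hct, one_mul]
    _ ≤ _ := by gcongr

end VariableScale

/-! ### Hardy's inequality, on intervals and above a graph. -/

section Hardy

/-- A one-dimensional Hardy inequality. -/
theorem hardy_interval {φ φ' : ℝ → ℝ} (hφ : ∀ t, HasDerivAt φ (φ' t) t) (hφ' : Continuous φ')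
    {a : ℝ} (ha : 0 ≤ a) :
    ∫ t in (0 : ℝ)..a, φ t ^ 2
      ≤ 2 * (a * φ 0 ^ 2) + 4 * ∫ t in (0 : ℝ)..a, ((a - t) * φ' t) ^ 2 := by
  have hc : Continuous φ := continuous_iff_continuousAt.2 fun t => (hφ t).continuousAt
  -- Since `(a - t) φ ^ 2` vanishes at `t = a`, integrating its derivative leaves only the endpoint
  -- 0; Young's inequality then absorbs half of `∫ φ ^ 2`.
  have hd (t : ℝ) : HasDerivAt (fun t => (a - t) * φ t ^ 2)
      (-φ t ^ 2 + 2 * ((a - t) * φ' t * φ t)) t := by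
    have h := ((hasDerivAt_id t).const_sub a).mul ((hφ t).pow 2)
    convert! h using 1
    simp
    ring
  have h1 := intervalIntegral.integral_eq_sub_of_hasDerivAt (a := 0) (b := a) (fun t _ => hd t)
    ((by fun_prop : Continuous fun t => -φ t ^ 2 + 2 * ((a - t) * φ' t * φ t)).intervalIntegrable
      _ _)
  have h2 : ∫ t in (0 : ℝ)..a, (-φ t ^ 2 + 2 * ((a - t) * φ' t * φ t))
      ≤ ∫ t in (0 : ℝ)..a, (-(1 / 2) * φ t ^ 2 + 2 * ((a - t) * φ' t) ^ 2) := by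
    refine intervalIntegral.integral_mono_on ha
      ((by fun_prop : Continuous _).intervalIntegrable _ _)
      ((by fun_prop : Continuous _).intervalIntegrable _ _) fun t _ => ?_
    nlinarith [sq_nonneg (φ t - 2 * ((a - t) * φ' t))]
  rw [h1, intervalIntegral.integral_add ((by fun_prop : Continuous _).intervalIntegrable _ _)
    ((by fun_prop : Continuous _).intervalIntegrable _ _), intervalIntegral.integral_const_mul,
    intervalIntegral.integral_const_mul] at h2
  simp only [sub_self, zero_mul, sub_zero, zero_sub] at h2
  linarith

theorem lintegral_hardy_interval {φ φ' : ℝ → ℝ} (hφ : ∀ t, HasDerivAt φ (φ' t) t)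
    (hφ' : Continuous φ') {a : ℝ} (ha : 0 ≤ a) :
    ∫⁻ t in Set.Ioo (0 : ℝ) a, ENNReal.ofReal (φ t ^ 2)
      ≤ ENNReal.ofReal (2 * a) * ENNReal.ofReal (φ 0 ^ 2)
        + 4 * ∫⁻ t in Set.Ioo (0 : ℝ) a, ENNReal.ofReal (((a - t) * φ' t) ^ 2) := by
  have hc : Continuous φ := continuous_iff_continuousAt.2 fun t => (hφ t).continuousAt
  have key (f : ℝ → ℝ) (hf : Continuous f) : ∫⁻ t in Set.Ioo (0 : ℝ) a, ENNReal.ofReal (f t ^ 2)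
      = ENNReal.ofReal (∫ t in (0 : ℝ)..a, f t ^ 2) := by
    rw [intervalIntegral.integral_of_le ha, integral_Ioc_eq_integral_Ioo,
      ofReal_integral_eq_lintegral_ofReal]
    · exact ((hf.pow 2).integrableOn_Icc).mono_set Set.Ioo_subset_Icc_self
    · exact ae_of_all _ fun t => sq_nonneg _
  rw [key φ hc, key _ (by fun_prop), ← ENNReal.ofReal_mul (by positivity),
    ← ENNReal.ofReal_ofNat 4, ← ENNReal.ofReal_mul (by norm_num), ← ENNReal.ofReal_add
    (by positivity) (mul_nonneg (by norm_num)
      (intervalIntegral.integral_nonneg ha fun _ _ => sq_nonneg _))]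
  refine ENNReal.ofReal_le_ofReal ((hardy_interval hφ hφ' ha).trans_eq ?_)
  ring

variable {n : ℕ} {ν : Space n} {g : Space n → ℝ} {W : Set (Space n)}

/-- Disintegration along the lines of direction `ν` starting in the slab `h < g < 2h`. -/
theorem lintegral_slab (hg : Continuous g) (hgν : ∀ x (t : ℝ), g (x + t • ν) = g x + t)
    (hW : MeasurableSet W) (hWν : ∀ x (t : ℝ), x + t • ν ∈ W ↔ x ∈ W) (h : ℝ)
    {f : Space n → ℝ≥0∞} (hf : Measurable f) :
    ∫⁻ y in W ∩ {y | h < g y ∧ g y < 2 * h}, ∫⁻ t in Set.Ioo 0 (g y), f (y - t • ν)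
      = ∫⁻ x in W ∩ {x | 0 < g x},
        f x * volume (Set.Ioi 0 ∩ Set.Ioo (h - g x) (2 * h - g x)) := by
  have hgm := hg.measurable
  -- The domain in the variables `x = y - t • ν` and `t`: the condition `t < g y` becomes `0 < g x`.
  let P : Set (Space n × ℝ) := {p | p.1 ∈ W ∧ 0 < g p.1 ∧ 0 < p.2 ∧ h < g p.1 + p.2 ∧
    g p.1 + p.2 < 2 * h}
  have hP : MeasurableSet P := by
    have m1 : MeasurableSet {p : Space n × ℝ | p.1 ∈ W} := measurable_fst hW
    have m2 : MeasurableSet {p : Space n × ℝ | 0 < g p.1} :=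
      measurableSet_lt (by fun_prop) (by fun_prop)
    have m3 : MeasurableSet {p : Space n × ℝ | 0 < p.2} :=
      measurableSet_lt (by fun_prop) (by fun_prop)
    have m4 : MeasurableSet {p : Space n × ℝ | h < g p.1 + p.2} :=
      measurableSet_lt (by fun_prop) (by fun_prop)
    have m5 : MeasurableSet {p : Space n × ℝ | g p.1 + p.2 < 2 * h} :=
      measurableSet_lt (by fun_prop) (by fun_prop)
    exact m1.inter (m2.inter (m3.inter (m4.inter m5)))
  have hS : MeasurableSet (W ∩ {y | h < g y ∧ g y < 2 * h}) :=
    hW.inter (hgm measurableSet_Ioo)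
  have hS' : MeasurableSet (W ∩ {x | 0 < g x}) :=
    hW.inter (hgm measurableSet_Ioi)
  let H : Space n × ℝ → ℝ≥0∞ := P.indicator fun p => f p.1
  have hH : Measurable H := (hf.comp measurable_fst).indicator hP
  have hHm (p) (hp : p ∈ P) : H p = f p.1 := Set.indicator_of_mem hp _
  have hHn (p) (hp : p ∉ P) : H p = 0 := Set.indicator_of_notMem hp _
  have h1 : ∫⁻ y in W ∩ {y | h < g y ∧ g y < 2 * h}, ∫⁻ t in Set.Ioo 0 (g y), f (y - t • ν)
      = ∫⁻ y, ∫⁻ t, H (y - t • ν, t) := by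
    rw [← lintegral_indicator hS]
    refine lintegral_congr fun y => ?_
    have e (t : ℝ) : (y - t • ν, t) ∈ P ↔
        y ∈ W ∩ {y | h < g y ∧ g y < 2 * h} ∧ t ∈ Set.Ioo 0 (g y) := by
      have e1 := hgν (y - t • ν) t
      have e2 := hWν (y - t • ν) t
      rw [sub_add_cancel] at e1 e2
      change (y - t • ν ∈ W ∧ 0 < g (y - t • ν) ∧ 0 < t ∧ h < g (y - t • ν) + t ∧
        g (y - t • ν) + t < 2 * h) ↔ (y ∈ W ∧ h < g y ∧ g y < 2 * h) ∧ 0 < t ∧ t < g y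
      rw [← e2, ← e1]
      constructor
      · rintro ⟨a, b, c, d, e⟩
        exact ⟨⟨a, d, e⟩, c, by linarith⟩
      · rintro ⟨⟨a, d, e⟩, c, b⟩
        exact ⟨a, by linarith, c, d, e⟩
    by_cases hy : y ∈ W ∩ {y | h < g y ∧ g y < 2 * h}
    · rw [Set.indicator_of_mem hy, ← lintegral_indicator measurableSet_Ioo]
      refine lintegral_congr fun t => ?_
      by_cases ht : t ∈ Set.Ioo 0 (g y)
      · rw [Set.indicator_of_mem ht, hHm _ ((e t).2 ⟨hy, ht⟩)]
      · rw [Set.indicator_of_notMem ht, hHn _ fun hp => ht ((e t).1 hp).2]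
    · rw [Set.indicator_of_notMem hy]
      symm
      rw [lintegral_eq_zero_iff (by fun_prop)]
      exact ae_of_all _ fun t => hHn _ fun hp => hy ((e t).1 hp).1
  -- For fixed `t` the substitution is a translation.
  have h2 : ∫⁻ y, ∫⁻ t, H (y - t • ν, t) = ∫⁻ x, ∫⁻ t, H (x, t) := by
    rw [lintegral_lintegral_swap (by fun_prop)]
    simp only [sub_eq_add_neg]
    have e (t : ℝ) : ∫⁻ y, H (y + -(t • ν), t) = ∫⁻ x, H (x, t) :=
      lintegral_add_right_eq_self (fun x => H (x, t)) _
    simp only [e]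
    rw [lintegral_lintegral_swap (f := fun t x => H (x, t))]
    exact (hH.comp measurable_swap).aemeasurable
  rw [h1, h2, ← lintegral_indicator hS']
  refine lintegral_congr fun x => ?_
  by_cases hx : x ∈ W ∩ {x | 0 < g x}
  · rw [Set.indicator_of_mem hx, ← setLIntegral_const, ← lintegral_indicator
      (measurableSet_Ioi.inter measurableSet_Ioo)]
    refine lintegral_congr fun t => ?_
    have e : (x, t) ∈ P ↔ t ∈ Set.Ioi 0 ∩ Set.Ioo (h - g x) (2 * h - g x) := by
      change (x ∈ W ∧ 0 < g x ∧ 0 < t ∧ h < g x + t ∧ g x + t < 2 * h) ↔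
        0 < t ∧ h - g x < t ∧ t < 2 * h - g x
      constructor
      · rintro ⟨a, b, c, d, e⟩
        exact ⟨c, by linarith, by linarith⟩
      · rintro ⟨c, d, e⟩
        exact ⟨hx.1, hx.2, c, by linarith, by linarith⟩
    by_cases ht : t ∈ Set.Ioi 0 ∩ Set.Ioo (h - g x) (2 * h - g x)
    · rw [Set.indicator_of_mem ht, hHm _ (e.2 ht)]
    · rw [Set.indicator_of_notMem ht, hHn _ fun hp => ht (e.1 hp)]
  · rw [Set.indicator_of_notMem hx, lintegral_eq_zero_iff (by fun_prop)]
    exact ae_of_all _ fun t => hHn _ fun hp => hx ⟨hp.1, hp.2.1⟩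

/-- Hardy's inequality above a Lipschitz graph. -/
theorem hardy_graph (hg : Continuous g) (hgν : ∀ x (t : ℝ), g (x + t • ν) = g x + t)
    (hW : MeasurableSet W) (hWν : ∀ x (t : ℝ), x + t • ν ∈ W ↔ x ∈ W) {h : ℝ} (hh : 0 < h)
    {f f' : Space n → ℝ} (hf : Continuous f) (hf' : Continuous f')
    (hd : ∀ y t, HasDerivAt (fun t : ℝ => f (y - t • ν)) (f' (y - t • ν)) t) :
    ∫⁻ x in W ∩ {x | 0 < g x ∧ g x < h}, ENNReal.ofReal (f x ^ 2)
      ≤ 4 * (∫⁻ x in W ∩ {x | h < g x ∧ g x < 2 * h}, ENNReal.ofReal (f x ^ 2))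
        + 4 * ∫⁻ x in W ∩ {x | 0 < g x ∧ g x < 2 * h}, ENNReal.ofReal ((g x * f' x) ^ 2) := by
  have hgm := hg.measurable
  have hset (a b : ℝ) : MeasurableSet (W ∩ {y | a < g y ∧ g y < b}) :=
    hW.inter (hgm measurableSet_Ioo)
  have hset' : MeasurableSet (W ∩ {x | 0 < g x}) :=
    hW.inter (hgm measurableSet_Ioi)
  have hH : ENNReal.ofReal h ≠ 0 := (ENNReal.ofReal_pos.2 hh).ne'
  have hm : Measurable fun x => ENNReal.ofReal (f x ^ 2) := by fun_prop
  have hm' : Measurable fun x => ENNReal.ofReal ((g x * f' x) ^ 2) := by fun_prop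
  -- From a point of height below `h` the whole slab lies ahead in direction `ν`, and crossing it
  -- takes length `h`.
  have lower : ENNReal.ofReal h * ∫⁻ x in W ∩ {x | 0 < g x ∧ g x < h}, ENNReal.ofReal (f x ^ 2)
      ≤ ∫⁻ y in W ∩ {y | h < g y ∧ g y < 2 * h},
        ∫⁻ t in Set.Ioo 0 (g y), ENNReal.ofReal (f (y - t • ν) ^ 2) := by
    rw [lintegral_slab hg hgν hW hWν h hm, ← lintegral_const_mul _ hm]
    refine le_trans ?_ (lintegral_mono_set (s := W ∩ {x | 0 < g x ∧ g x < h})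
      fun x hx => ⟨hx.1, hx.2.1⟩)
    refine setLIntegral_mono' (hset _ _) fun x hx => ?_
    rw [mul_comm]
    gcongr
    have e : Set.Ioi 0 ∩ Set.Ioo (h - g x) (2 * h - g x) = Set.Ioo (h - g x) (2 * h - g x) :=
      Set.inter_eq_right.2 fun t ht => lt_trans (sub_pos.2 hx.2.2) ht.1
    rw [e, Real.volume_Ioo]
    exact ENNReal.ofReal_le_ofReal (by linarith)
  -- From any point the length spent in the slab is at most `h`, and it is zero for heights of at
  -- least `2 * h`.
  have upper : ∫⁻ y in W ∩ {y | h < g y ∧ g y < 2 * h}, ∫⁻ t in Set.Ioo 0 (g y),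
        ENNReal.ofReal ((g (y - t • ν) * f' (y - t • ν)) ^ 2)
      ≤ ENNReal.ofReal h * ∫⁻ x in W ∩ {x | 0 < g x ∧ g x < 2 * h},
        ENNReal.ofReal ((g x * f' x) ^ 2) := by
    rw [lintegral_slab hg hgν hW hWν h hm', ← lintegral_const_mul _ hm',
      ← lintegral_indicator hset', ← lintegral_indicator (hset _ _)]
    refine lintegral_mono fun x => ?_
    by_cases hx : x ∈ W ∩ {x | 0 < g x}
    swap
    · rw [Set.indicator_of_notMem hx]; exact zero_le
    rw [Set.indicator_of_mem hx]
    by_cases hx2 : g x < 2 * h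
    · rw [Set.indicator_of_mem (show x ∈ W ∩ {x | 0 < g x ∧ g x < 2 * h} from
        ⟨hx.1, hx.2, hx2⟩), mul_comm]
      gcongr
      refine (measure_mono Set.inter_subset_right).trans ?_
      rw [Real.volume_Ioo]
      exact ENNReal.ofReal_le_ofReal (by linarith)
    · have e : Set.Ioi 0 ∩ Set.Ioo (h - g x) (2 * h - g x) = ∅ :=
        Set.eq_empty_of_forall_notMem fun t ht => by
          have h1 : 0 < t := ht.1
          have h2 := ht.2.2
          linarith
      rw [e, measure_empty, mul_zero]
      exact zero_le
  -- Hardy on the vertical segment below `y`: the weight `g y - t` is the height of `y - t • ν`, and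
  -- `g y < 2 * h` turns the factor `2 * g y` into `4 * h`.
  have hline (y : Space n) (hy : y ∈ W ∩ {y | h < g y ∧ g y < 2 * h}) :
      ∫⁻ t in Set.Ioo 0 (g y), ENNReal.ofReal (f (y - t • ν) ^ 2)
        ≤ ENNReal.ofReal h * 4 * ENNReal.ofReal (f y ^ 2) + 4 * ∫⁻ t in Set.Ioo 0 (g y),
          ENNReal.ofReal ((g (y - t • ν) * f' (y - t • ν)) ^ 2) := by
    have h0 : 0 ≤ g y := (hh.trans hy.2.1).le
    have h1 := lintegral_hardy_interval (hd y) (by fun_prop) h0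
    rw [zero_smul, sub_zero] at h1
    have h2 (t : ℝ) : g y - t = g (y - t • ν) := by
      have := hgν (y - t • ν) t
      rw [sub_add_cancel] at this
      linarith
    simp only [h2] at h1
    refine h1.trans ?_
    gcongr
    rw [← ENNReal.ofReal_ofNat 4, ← ENNReal.ofReal_mul hh.le]
    exact ENNReal.ofReal_le_ofReal (by linarith [hy.2.2])
  have total : ENNReal.ofReal h *
        ∫⁻ x in W ∩ {x | 0 < g x ∧ g x < h}, ENNReal.ofReal (f x ^ 2)
      ≤ ENNReal.ofReal h * (4 * (∫⁻ x in W ∩ {x | h < g x ∧ g x < 2 * h}, ENNReal.ofReal (f x ^ 2))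
        + 4 * ∫⁻ x in W ∩ {x | 0 < g x ∧ g x < 2 * h}, ENNReal.ofReal ((g x * f' x) ^ 2)) := by
    refine lower.trans ((setLIntegral_mono' (hset _ _) hline).trans ?_)
    rw [lintegral_add_left (by fun_prop), lintegral_const_mul _ hm, lintegral_const_mul'
      _ _ (by norm_num), mul_add, ← mul_assoc (ENNReal.ofReal h) 4]
    gcongr _ + ?_
    rw [mul_left_comm]
    gcongr
  exact (ENNReal.mul_le_mul_iff_right hH ENNReal.ofReal_ne_top).1 total

end Hardy

/-! ### Vertical variation of averaged gradients. -/

section AverageSlope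

variable {n : ℕ} {v : Fin n → Space n → ℝ}

/-- The derivative of `avgGrad` when the center moves with velocity `ν` and the scale grows at
rate `c`. -/
def avgGradSlope (v : Fin n → Space n → ℝ) (ν : Space n) (c : ℝ) (j k : Fin n) (d : ℝ)
    (x : Space n) : ℝ :=
  ∫ z, kernel n z * fderiv ℝ (partialDeriv (v j) k) (x + d • z) (ν + c • z)

/-- Over a compact domain, continuity of the integrand passes to the parametric integral. -/
theorem integral_kernel_mul_eq (f : Space n → ℝ) :
    ∫ z, kernel n z * f z = ∫ z in Metric.closedBall (0 : Space n) 1, kernel n z * f z :=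
  (setIntegral_eq_integral_of_forall_compl_eq_zero fun x hx => by
    rw [kernel_eq_zero fun h => hx (Metric.ball_subset_closedBall h), zero_mul]).symm

theorem continuous_avgGrad (hv : ∀ i, ContDiff ℝ ∞ (v i)) {δ : Space n → ℝ} (hδ : Continuous δ)
    (j k : Fin n) : Continuous fun x => avgGrad v j k (δ x) x := by
  simp only [avgGrad, integral_kernel_mul_eq]
  have h := continuous_partialDeriv (hv j) k
  have h2 := (contDiff_kernel (n := n)).continuous
  exact continuous_parametric_integral_of_continuous (by simp only [Function.uncurry_def]; fun_prop)
    (isCompact_closedBall _ _)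

theorem continuous_avgGradSlope (hv : ∀ i, ContDiff ℝ ∞ (v i)) {δ : Space n → ℝ}
    (hδ : Continuous δ) (ν : Space n) (c : ℝ) (j k : Fin n) :
    Continuous fun x => avgGradSlope v ν c j k (δ x) x := by
  simp only [avgGradSlope, integral_kernel_mul_eq]
  have h : Continuous (fderiv ℝ (partialDeriv (v j) k)) :=
    (contDiff_partialDeriv (hv j) k).continuous_fderiv (by simp)
  have h2 := (contDiff_kernel (n := n)).continuous
  exact continuous_parametric_integral_of_continuous (by simp only [Function.uncurry_def]; fun_prop)
    (isCompact_closedBall _ _)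

/-- Going down from `y`, the centre moves with velocity `-ν` and the scale `c * (a - t)` shrinks at
rate `c`: the reverse of the motion defining `avgGradSlope`, hence the sign. Domination comes from
compactness of a time interval times the closed unit ball. -/
theorem hasDerivAt_avgGrad (hv : ∀ i, ContDiff ℝ ∞ (v i)) (y ν : Space n) (a c : ℝ)
    (j k : Fin n) (t : ℝ) :
    HasDerivAt (fun t : ℝ => avgGrad v j k (c * (a - t)) (y - t • ν))
      (-avgGradSlope v ν c j k (c * (a - t)) (y - t • ν)) t := by
  set f := partialDeriv (v j) k
  have hf : ContDiff ℝ ∞ f := contDiff_partialDeriv (hv j) k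
  have hf' : Continuous (fderiv ℝ f) := hf.continuous_fderiv (by simp)
  have hfc := hf.continuous
  have hk := (contDiff_kernel (n := n)).continuous
  have hc : Continuous fun p : ℝ × Space n =>
      fderiv ℝ f (y - p.1 • ν + (c * (a - p.1)) • p.2) (ν + c • p.2) := by fun_prop
  obtain ⟨M, hM⟩ := (((isCompact_closedBall t 1).prod
    (isCompact_closedBall (0 : Space n) 1)).bddAbove_image hc.norm.continuousOn)
  have key := hasDerivAt_integral_of_dominated_loc_of_deriv_le (μ := (volume : Measure (Space n)))
    (F := fun t z => kernel n z * f (y - t • ν + (c * (a - t)) • z))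
    (F' := fun t z => kernel n z * -fderiv ℝ f (y - t • ν + (c * (a - t)) • z) (ν + c • z))
    (x₀ := t) (s := Metric.closedBall t 1) (bound := fun z => kernel n z * M)
    (Metric.closedBall_mem_nhds t one_pos)
    (Filter.Eventually.of_forall fun s => (by fun_prop : Continuous _).aestronglyMeasurable)
    (integrable_mul_of_hasCompactSupport hk (by fun_prop) hasCompactSupport_kernel)
    (by fun_prop : Continuous _).aestronglyMeasurable
    (ae_of_all _ fun z s hs => by
      by_cases hz : z ∈ Metric.closedBall (0 : Space n) 1
      · rw [norm_mul, norm_neg, Real.norm_of_nonneg (kernel_nonneg z)]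
        exact mul_le_mul_of_nonneg_left (hM ⟨(s, z), ⟨hs, hz⟩, rfl⟩) (kernel_nonneg z)
      · simp [kernel_eq_zero fun h => hz (Metric.ball_subset_closedBall h)])
    ((hk.integrable_of_hasCompactSupport hasCompactSupport_kernel).mul_const M)
    (ae_of_all _ fun z s _ => by
      have h1 : HasDerivAt (fun t : ℝ => y - t • ν + (c * (a - t)) • z)
          (-(ν + c • z)) s := by
        have h2 := ((hasDerivAt_id s).smul_const ν).const_sub y
        have h3 := (((hasDerivAt_id s).const_sub a).const_mul c).smul_const z
        convert! h2.add h3 using 1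
        module
      have h4 := (((hf.differentiable (by simp) _).hasFDerivAt).comp_hasDerivAt s h1).const_mul
        (kernel n z)
      simpa using h4)
  have h := key.2
  simp only [mul_neg, integral_neg] at h
  exact h

/-- The Christoffel-type identity behind Korn's inequality: the skew part of the gradient may be
large, but its variation is determined by derivatives of the strain. -/
theorem partialDeriv_partialDeriv_eq (hv : ∀ i, ContDiff ℝ ∞ (v i)) (j k l : Fin n)
    (x : Space n) :
    partialDeriv (partialDeriv (v j) k) l x = partialDeriv (symGrad v j k) l x
      + partialDeriv (symGrad v j l) k x - partialDeriv (symGrad v k l) j x := by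
  have h (a b c : Fin n) : partialDeriv (symGrad v a b) c x
      = 1 / 2 * (partialDeriv (partialDeriv (v a) b) c x
        + partialDeriv (partialDeriv (v b) a) c x) := by
    rw [← partialDeriv_add (contDiff_partialDeriv (hv a) b) (contDiff_partialDeriv (hv b) a),
      ← partialDeriv_const_mul ((contDiff_partialDeriv (hv a) b).add
        (contDiff_partialDeriv (hv b) a))]
    congr 1
    ext y
    simp only [symGrad]
    ring
  rw [h, h, h, partialDeriv_comm (hv j) l k, partialDeriv_comm (hv l) j k,
    partialDeriv_comm (hv k) l j]
  ring

/-- The slope of the averaged gradient is controlled by the strain alone. -/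
theorem exists_avgGradSlope_sq_le (ν : Space n) (c : ℝ) :
    ∃ C : ℝ≥0, ∀ v : Fin n → Space n → ℝ, (∀ i, ContDiff ℝ ∞ (v i)) →
    ∀ j k (x : Space n) (d : ℝ),
    ENNReal.ofReal ((d * avgGradSlope v ν c j k d x) ^ 2)
      ≤ C * ∫⁻ z in Metric.ball (0 : Space n) 1, ENNReal.ofReal (strainSq v (x + d • z)) := by
  -- The components of the velocity `ν + c • z` are absorbed into the kernel, which stays smooth and
  -- supported in the unit ball.
  let ζ : Fin n → Space n → ℝ := fun l z => kernel n z * (ν l + c * z l)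
  have hlin (l : Fin n) : ContDiff ℝ ∞ fun z : Space n => ν l + c * z l :=
    contDiff_const.add (contDiff_const.mul (contDiff_coord l))
  have hζ (l : Fin n) : ContDiff ℝ ∞ (ζ l) := contDiff_kernel.mul (hlin l)
  have hζc (l : Fin n) : HasCompactSupport (ζ l) := hasCompactSupport_kernel.mul_right
  have hζ0 (l a : Fin n) (x : Space n) (hx : x ∉ Metric.ball (0 : Space n) 1) :
      partialDeriv (ζ l) a x = 0 := by
    rw [partialDeriv_mul contDiff_kernel (hlin l), kernel_eq_zero hx,
      partialDeriv_kernel_eq_zero a hx]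
    ring
  choose M hM using fun l a =>
    exists_integral_mul_sq_le (continuous_partialDeriv (hζ l) a) (hζ0 l a)
  let Q : ℝ≥0 := ∑ l, ∑ a, M l a
  have hMQ (l a : Fin n) : M l a ≤ Q :=
    (Finset.single_le_sum (f := fun a => M l a) (fun _ _ => zero_le) (Finset.mem_univ a)).trans
      (Finset.single_le_sum (f := fun l => ∑ a, M l a) (fun _ _ => zero_le) (Finset.mem_univ l))
  refine ⟨n * (n * (3 * (3 * Q))), fun v hv j k x d => ?_⟩
  set S := ∫⁻ z in Metric.ball (0 : Space n) 1, ENNReal.ofReal (strainSq v (x + d • z))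
  let T : Fin n → Fin n → Fin n → Fin n → ℝ := fun l a p q =>
    ∫ z, partialDeriv (ζ l) a z * symGrad v p q (x + d • z)
  have hT (l a p q : Fin n) : ENNReal.ofReal (T l a p q ^ 2) ≤ Q * S := by
    refine (hM l a _ (contDiff_comp_affine (contDiff_symGrad hv p q) x d).continuous).trans ?_
    refine mul_le_mul' (ENNReal.coe_le_coe.2 (hMQ l a)) (lintegral_mono fun z => ?_)
    exact ENNReal.ofReal_le_ofReal (symGrad_sq_le_strainSq v p q _)
  -- The factor `d` is the one produced by differentiating `z ↦ x + d • z`, so integration by parts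
  -- leaves no negative power of `d`.
  have hibp (l a p q : Fin n) :
      ∫ z, ζ l z * (d * partialDeriv (symGrad v p q) a (x + d • z)) = -T l a p q := by
    have h := integral_mul_partialDeriv (hζ l)
      (contDiff_comp_affine (contDiff_symGrad hv p q) x d) (hζc l) a
    simp only [partialDeriv_comp_affine (contDiff_symGrad hv p q)] at h
    exact h
  have hint (l a p q : Fin n) :
      Integrable fun z => ζ l z * (d * partialDeriv (symGrad v p q) a (x + d • z)) :=
    integrable_mul_of_hasCompactSupport (hζ l).continuous
      (continuous_const.mul (contDiff_comp_affine
        (contDiff_partialDeriv (contDiff_symGrad hv p q) a) x d).continuous) (hζc l)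
  have hslope : d * avgGradSlope v ν c j k d x
      = ∑ l, (-T l l j k + -T l k j l - -T l j k l) := by
    rw [avgGradSlope, ← integral_const_mul]
    have e (z : Space n) :
        d * (kernel n z * fderiv ℝ (partialDeriv (v j) k) (x + d • z) (ν + c • z))
        = ∑ l, (ζ l z * (d * partialDeriv (symGrad v j k) l (x + d • z))
          + ζ l z * (d * partialDeriv (symGrad v j l) k (x + d • z))
          - ζ l z * (d * partialDeriv (symGrad v k l) j (x + d • z))) := by
      rw [fderiv_apply_eq_sum, Finset.mul_sum, Finset.mul_sum]
      refine Finset.sum_congr rfl fun l _ => ?_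
      rw [partialDeriv_partialDeriv_eq hv]
      simp only [ζ, PiLp.add_apply, PiLp.smul_apply, smul_eq_mul]
      ring
    simp only [e]
    have h1 (l : Fin n) : Integrable fun z =>
        ζ l z * (d * partialDeriv (symGrad v j k) l (x + d • z))
          + ζ l z * (d * partialDeriv (symGrad v j l) k (x + d • z)) :=
      (hint l l j k).add (hint l k j l)
    have h2 (l : Fin n) : Integrable fun z =>
        ζ l z * (d * partialDeriv (symGrad v j k) l (x + d • z))
          + ζ l z * (d * partialDeriv (symGrad v j l) k (x + d • z))
          - ζ l z * (d * partialDeriv (symGrad v k l) j (x + d • z)) :=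
      (h1 l).sub (hint l j k l)
    rw [integral_finsetSum _ fun l _ => h2 l]
    refine Finset.sum_congr rfl fun l _ => ?_
    rw [integral_sub (h1 l) (hint l j k l), integral_add (hint l l j k) (hint l k j l),
      hibp, hibp, hibp]
  have hthree (a b e : ℝ) (ha : ENNReal.ofReal (a ^ 2) ≤ Q * S)
      (hb : ENNReal.ofReal (b ^ 2) ≤ Q * S) (he : ENNReal.ofReal (e ^ 2) ≤ Q * S) :
      ENNReal.ofReal ((-a + -b - -e) ^ 2) ≤ 3 * (3 * Q) * S := by
    have h := ofReal_sum_sq_le Finset.univ ![-a, -b, e]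
    simp only [Fin.sum_univ_three, Matrix.cons_val_zero, Matrix.cons_val_one, Matrix.cons_val,
      Finset.card_univ, Fintype.card_fin, neg_sq] at h
    rw [show -a + -b - -e = -a + -b + e by ring]
    refine h.trans ?_
    push_cast
    calc (3 : ℝ≥0∞) * (ENNReal.ofReal (a ^ 2) + ENNReal.ofReal (b ^ 2) + ENNReal.ofReal (e ^ 2))
        ≤ 3 * (Q * S + Q * S + Q * S) := by gcongr
      _ = 3 * (3 * Q) * S := by ring
  rw [hslope]
  refine (ofReal_sum_sq_le Finset.univ _).trans ?_
  rw [Finset.card_univ, Fintype.card_fin]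
  push_cast
  calc (n : ℝ≥0∞) * ∑ l, ENNReal.ofReal ((-T l l j k + -T l k j l - -T l j k l) ^ 2)
      ≤ n * ∑ _l : Fin n, 3 * (3 * Q) * S := by
        gcongr
        exact hthree _ _ _ (hT _ _ _ _) (hT _ _ _ _) (hT _ _ _ _)
    _ = _ := by
        rw [Finset.sum_const, Finset.card_univ, Fintype.card_fin, nsmul_eq_mul]
        ring

end AverageSlope

/-! ### Geometry above a Lipschitz graph. -/

section GraphGeometry

variable {n : ℕ}

/-- The cylinder of axis `ν` spanned by the ball of radius `r` around `x₀`. -/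
def cylinder (ν x₀ : Space n) (r : ℝ) : Set (Space n) :=
  {x | ∃ t : ℝ, x + t • ν ∈ Metric.ball x₀ r}

/-- The part of a cylinder where `g` takes values between `a` and `b`. -/
def layer (ν x₀ : Space n) (g : Space n → ℝ) (r a b : ℝ) : Set (Space n) :=
  cylinder ν x₀ r ∩ {x | a < g x ∧ g x < b}

/-- `g` is the height above a Lipschitz graph in the direction `ν`, small at `x₀`. -/
structure IsGraphHeight (ν x₀ : Space n) (L h : ℝ) (g : Space n → ℝ) : Prop where
  norm_eq : ‖ν‖ = 1
  one_le : 1 ≤ L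
  pos : 0 < h
  lipschitz : ∀ x y, |g x - g y| ≤ L * dist x y
  shift : ∀ x (t : ℝ), g (x + t • ν) = g x + t
  base : |g x₀| ≤ h / 2

theorem isOpen_cylinder (ν x₀ : Space n) (r : ℝ) : IsOpen (cylinder ν x₀ r) := by
  have : cylinder ν x₀ r = ⋃ t : ℝ, (fun x => x + t • ν) ⁻¹' Metric.ball x₀ r := by
    ext x; simp [cylinder]
  rw [this]
  exact isOpen_iUnion fun t => Metric.isOpen_ball.preimage (by fun_prop)

theorem add_smul_mem_cylinder_iff (ν x₀ : Space n) (r : ℝ) (x : Space n) (t : ℝ) :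
    x + t • ν ∈ cylinder ν x₀ r ↔ x ∈ cylinder ν x₀ r := by
  constructor
  · rintro ⟨s, hs⟩
    exact ⟨t + s, by rwa [add_smul, ← add_assoc]⟩
  · rintro ⟨s, hs⟩
    refine ⟨s - t, ?_⟩
    rwa [add_assoc, ← add_smul, add_sub_cancel]

theorem mem_cylinder_of_dist_le {ν x₀ x y : Space n} {r ρ : ℝ} (hx : x ∈ cylinder ν x₀ r)
    (hy : dist y x ≤ ρ) : y ∈ cylinder ν x₀ (r + ρ) := by
  obtain ⟨t, ht⟩ := hx
  refine ⟨t, ?_⟩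
  rw [Metric.mem_ball] at ht ⊢
  have h1 := dist_triangle (y + t • ν) (x + t • ν) x₀
  rw [dist_add_right] at h1
  linarith

namespace IsGraphHeight

variable {ν x₀ : Space n} {L h : ℝ} {g : Space n → ℝ}

/-- The factor `(4 * L)⁻¹` is chosen to meet the Lipschitz condition of the variable-radius
estimates and to keep balls of twice this radius above the graph. -/
theorem lipschitzWith (H : IsGraphHeight ν x₀ L h g) :
    LipschitzWith (1 / 4) fun x => (4 * L)⁻¹ * g x := by
  have hL := H.one_le
  refine LipschitzWith.of_dist_le_mul fun x y => ?_
  rw [Real.dist_eq, ← mul_sub, abs_mul, abs_of_pos (by positivity)]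
  calc (4 * L)⁻¹ * |g x - g y| ≤ (4 * L)⁻¹ * (L * dist x y) := by
        gcongr
        exact H.lipschitz x y
    _ = 1 / 4 * dist x y := by field_simp
    _ = _ := by simp

theorem continuous (H : IsGraphHeight ν x₀ L h g) : Continuous g := by
  have hL := H.one_le
  have h1 := H.lipschitzWith.continuous.const_mul (4 * L)
  refine h1.congr fun x => ?_
  field_simp

theorem measurableSet_layer (H : IsGraphHeight ν x₀ L h g) (r a b : ℝ) :
    MeasurableSet (layer ν x₀ g r a b) :=
  (isOpen_cylinder ν x₀ r).measurableSet.inter (H.continuous.measurable measurableSet_Ioo)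

theorem scale_pos (H : IsGraphHeight ν x₀ L h g) {x : Space n} (hx : 0 < g x) :
    0 < (4 * L)⁻¹ * g x := by
  have hL := H.one_le
  positivity

theorem scale_le (H : IsGraphHeight ν x₀ L h g) {x : Space n} (hx : 0 < g x) :
    (4 * L)⁻¹ * g x ≤ g x / 4 := by
  have hL := H.one_le
  rw [mul_inv]
  have h1 : L⁻¹ ≤ 1 := inv_le_one_of_one_le₀ hL
  nlinarith

theorem L_mul_scale (H : IsGraphHeight ν x₀ L h g) (x : Space n) :
    L * ((4 * L)⁻¹ * g x) = g x / 4 := by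
  have hL := H.one_le
  field_simp

/-- A vertical translate by `t` lies within `2 * h` of `x₀`. Comparing heights gives `|t| ≤ 8 h + h
/ 2 + 2 L h`, and the total `10.5 h + 2 L h` is below `15 L h` because `L ≥ 1`. -/
theorem dist_lt (H : IsGraphHeight ν x₀ L h g) {x : Space n}
    (hx : x ∈ layer ν x₀ g (2 * h) 0 (8 * h)) : dist x x₀ < 15 * L * h := by
  have hL := H.one_le
  have hh := H.pos
  obtain ⟨⟨t, ht⟩, h0, h8⟩ := hx
  rw [Metric.mem_ball] at ht
  have h1 := H.lipschitz (x + t • ν) x₀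
  rw [H.shift] at h1
  have h2 := abs_le.1 H.base
  have h3 := abs_le.1 h1
  have h4 : L * dist (x + t • ν) x₀ ≤ L * (2 * h) := by gcongr
  have h5 : |t| ≤ 8 * h + h / 2 + L * (2 * h) := by
    rw [abs_le]
    constructor <;> linarith
  have h6 : dist x (x + t • ν) = |t| := by
    rw [dist_self_add_right, norm_smul, H.norm_eq, Real.norm_eq_abs, mul_one]
  have h7 := dist_triangle x (x + t • ν) x₀
  nlinarith

/-- Within twice the scale, `g` changes by less than `g x / 2`, so the point stays above the graph;
the displacement is below `4 * h`, and `15 L h + 4 h ≤ 20 L h`. -/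
theorem add_smul_mem (H : IsGraphHeight ν x₀ L h g) {x z : Space n}
    (hx : x ∈ layer ν x₀ g (2 * h) 0 (8 * h)) (hz : z ∈ Metric.ball (0 : Space n) 2) :
    x + ((4 * L)⁻¹ * g x) • z ∈ Metric.ball x₀ (20 * L * h) ∩ {y | 0 < g y} := by
  have hL := H.one_le
  have hh := H.pos
  have h1 := H.dist_lt hx
  have hgx : 0 < g x := hx.2.1
  have h8 : g x < 8 * h := hx.2.2
  have h2 := H.scale_pos hgx
  have h3 := H.scale_le hgx
  have h9 := H.L_mul_scale x
  set d := (4 * L)⁻¹ * g x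
  have h4 : dist (x + d • z) x < d * 2 := by
    rw [dist_self_add_left, norm_smul, Real.norm_of_nonneg h2.le]
    exact mul_lt_mul_of_pos_left (mem_ball_zero_iff.1 hz) h2
  constructor
  · rw [Metric.mem_ball]
    have h5 := dist_triangle (x + d • z) x x₀
    nlinarith
  · change 0 < g (x + d • z)
    have h5 := (abs_le.1 (H.lipschitz (x + d • z) x)).1
    have h6 : L * dist (x + d • z) x < L * (d * 2) := by gcongr
    linarith

/-- On a ball of half the scale, `g` varies by less than `g y / 8`, well within the factors 2 of
room; the radius is below `h`, which the wider cylinder absorbs. -/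
theorem ball_subset_layer (H : IsGraphHeight ν x₀ L h g) {a b : ℝ} (ha : 0 ≤ a) (hb : b ≤ 2 * h)
    {y : Space n} (hy : y ∈ layer ν x₀ g h a b) :
    0 < (4 * L)⁻¹ * g y ∧
      Metric.ball y ((4 * L)⁻¹ * g y / 2) ⊆ layer ν x₀ g (2 * h) (a / 2) (2 * b) := by
  have hL := H.one_le
  have hh := H.pos
  have hgy : 0 < g y := ha.trans_lt hy.2.1
  have h2 := H.scale_pos hgy
  have h3 := H.scale_le hgy
  have h9 := H.L_mul_scale y
  refine ⟨h2, fun x hx => ?_⟩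
  rw [Metric.mem_ball] at hx
  have hb' := hy.2.2
  have ha' := hy.2.1
  constructor
  · have h4 := mem_cylinder_of_dist_le hy.1 (show dist x y ≤ h by linarith)
    rwa [← two_mul] at h4
  · have h4 := abs_le.1 (H.lipschitz x y)
    have h5 : L * dist x y < L * ((4 * L)⁻¹ * g y / 2) := by gcongr
    constructor <;> linarith

theorem layer_mono {r r' a a' b b' : ℝ} (hr : r ≤ r') (ha : a' ≤ a) (hb : b ≤ b') :
    layer ν x₀ g r a b ⊆ layer ν x₀ g r' a' b' := by
  rintro x ⟨⟨t, ht⟩, h1, h2⟩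
  exact ⟨⟨t, Metric.ball_subset_ball hr ht⟩, ha.trans_lt h1, h2.trans_le hb⟩

theorem volume_layer_le (H : IsGraphHeight ν x₀ L h g) :
    volume (layer ν x₀ g (2 * h) 0 (8 * h)) ≤ volume (Metric.ball x₀ (20 * L * h)) := by
  refine measure_mono fun x hx => ?_
  have hL := H.one_le
  have hh := H.pos
  rw [Metric.mem_ball]
  have := H.dist_lt hx
  nlinarith

theorem ball_inter_subset (H : IsGraphHeight ν x₀ L h g) :
    Metric.ball x₀ (h / (2 * L)) ∩ {x | 0 < g x} ⊆ layer ν x₀ g h 0 h := by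
  have hL := H.one_le
  have hh := H.pos
  rintro x ⟨hx, hgx⟩
  rw [Metric.mem_ball] at hx
  have h1 : h / (2 * L) ≤ h := div_le_self hh.le (by linarith)
  refine ⟨⟨0, ?_⟩, hgx, ?_⟩
  · rw [zero_smul, add_zero, Metric.mem_ball]
    exact hx.trans_le h1
  · have h2 := (abs_le.1 (H.lipschitz x x₀)).2
    have h3 := (abs_le.1 H.base).2
    have h4 : L * dist x x₀ < L * (h / (2 * L)) := by gcongr
    have h5 : L * (h / (2 * L)) = h / 2 := by field_simp
    linarith

theorem lintegral_strain_le (H : IsGraphHeight ν x₀ L h g) {f : Space n → ℝ≥0∞}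
    (hf : Measurable f) {D : Set (Space n)} (hD : MeasurableSet D)
    (hD' : D ⊆ layer ν x₀ g (2 * h) 0 (8 * h)) :
    ∫⁻ x in D, ∫⁻ z in Metric.ball (0 : Space n) 2, f (x + ((4 * L)⁻¹ * g x) • z)
      ≤ (ENNReal.ofReal (6 ^ n) * volume (Metric.ball (0 : Space n) 1)) *
        ∫⁻ y in Metric.ball x₀ (20 * L * h) ∩ {y | 0 < g y}, f y :=
  lintegral_variable_scale_le H.lipschitzWith hD (fun _ hx => H.scale_pos (hD' hx).2.1) hf
    (fun _ hx _ hz => H.add_smul_mem (hD' hx) hz)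
    (measurableSet_ball.inter (H.continuous.measurable measurableSet_Ioi))

end IsGraphHeight

end GraphGeometry

/-! ### Estimates up to a Lipschitz boundary. -/

section BoundaryEstimate

variable {n : ℕ}

/-- Moving the derivative onto the kernel costs `d⁻¹` and the change of variables costs `d⁻ⁿ`. At
heights bounded below, the mean gradient is therefore controlled by the `L¹` norm alone. -/
theorem exists_avgGrad_sq_le (n : ℕ) : ∃ C : ℝ≥0, ∀ v : Fin n → Space n → ℝ,
    (∀ i, ContDiff ℝ ∞ (v i)) → ∀ j k (x : Space n) (d d₀ : ℝ), 0 < d₀ → d₀ ≤ d →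
    ENNReal.ofReal (avgGrad v j k d x ^ 2)
      ≤ (C * ENNReal.ofReal ((d₀ ^ (n + 1))⁻¹) * ∫⁻ y, ‖v j y‖ₑ) ^ 2 := by
  obtain ⟨C, hC⟩ := exists_bound_partialDeriv (contDiff_kernel (n := n)) hasCompactSupport_kernel
  refine ⟨C, fun v hv j k x d d₀ h0 hd => ?_⟩
  have hd0 : 0 < d := h0.trans_le hd
  have h1 : avgGrad v j k d x
      = -d⁻¹ * ∫ z, partialDeriv (kernel n) k z * v j (x + d • z) := by
    have h2 := integral_mul_partialDeriv contDiff_kernel (contDiff_comp_affine (hv j) x d)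
      hasCompactSupport_kernel k
    simp only [partialDeriv_comp_affine (hv j)] at h2
    have h3 : ∫ z, kernel n z * (d * partialDeriv (v j) k (x + d • z))
        = d * avgGrad v j k d x := by
      rw [avgGrad, ← integral_const_mul]
      congr 1
      ext z
      ring
    rw [h3] at h2
    field_simp
    linarith
  rw [← enorm_sq_eq_ofReal, h1, enorm_mul, enorm_neg]
  refine pow_le_pow_left₀ zero_le ?_ 2
  have h4 : ‖∫ z, partialDeriv (kernel n) k z * v j (x + d • z)‖ₑ
      ≤ C * (ENNReal.ofReal ((d ^ n)⁻¹) * ∫⁻ y, ‖v j y‖ₑ) := by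
    refine (enorm_integral_le_lintegral_enorm _).trans ?_
    simp only [enorm_mul]
    refine (enorm_partialDeriv_kernel_mul_le hC k _).trans ?_
    rw [← lintegral_comp_affine (hv j).continuous.enorm.measurable x hd0]
    gcongr
    exact Measure.restrict_le_self
  have h5 : ‖d⁻¹‖ₑ * ENNReal.ofReal ((d ^ n)⁻¹) ≤ ENNReal.ofReal ((d₀ ^ (n + 1))⁻¹) := by
    rw [← ofReal_norm, Real.norm_of_nonneg (by positivity), ← ENNReal.ofReal_mul (by positivity),
      ← mul_inv, ← pow_succ']
    exact ENNReal.ofReal_le_ofReal (by gcongr)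
  calc ‖d⁻¹‖ₑ * ‖∫ z, partialDeriv (kernel n) k z * v j (x + d • z)‖ₑ
      ≤ ‖d⁻¹‖ₑ * (C * (ENNReal.ofReal ((d ^ n)⁻¹) * ∫⁻ y, ‖v j y‖ₑ)) := by gcongr
    _ = C * (‖d⁻¹‖ₑ * ENNReal.ofReal ((d ^ n)⁻¹)) * ∫⁻ y, ‖v j y‖ₑ := by ring
    _ ≤ _ := by gcongr

end BoundaryEstimate

section BoundaryKorn

variable {n : ℕ}

namespace IsGraphHeight

variable {ν x₀ : Space n} {L h : ℝ} {g : Space n → ℝ}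

theorem apply_sub (H : IsGraphHeight ν x₀ L h g) (y : Space n) (t : ℝ) :
    g (y - t • ν) = g y - t := by
  have h1 := H.shift (y - t • ν) t
  rw [sub_add_cancel] at h1
  linarith

end IsGraphHeight

/-- The averaged gradient is square integrable up to the boundary. -/
theorem exists_lintegral_avgGrad_sq_le (ν x₀ : Space n) {L h : ℝ} (hL : 1 ≤ L) (hh : 0 < h)
    (M : ℝ≥0) :
    ∃ C : ℝ≥0, ∀ g, IsGraphHeight ν x₀ L h g → ∀ v : Fin n → Space n → ℝ,
    (∀ i, ContDiff ℝ ∞ (v i)) →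
    ∫⁻ x in Metric.ball x₀ (20 * L * h) ∩ {x | 0 < g x}, ENNReal.ofReal (strainSq v x) ≤ M →
    (∀ i, ∫⁻ x, ‖v i x‖ₑ ≤ M) → ∀ j k,
    ∫⁻ x in layer ν x₀ g (2 * h) 0 (4 * h),
      ENNReal.ofReal (avgGrad v j k ((4 * L)⁻¹ * g x) x ^ 2) ≤ C := by
  obtain ⟨A, hA⟩ := exists_avgGrad_sq_le n
  obtain ⟨S, hS⟩ := exists_avgGradSlope_sq_le ν (4 * L)⁻¹
  let B : ℝ≥0∞ := (A * ENNReal.ofReal ((((4 * L)⁻¹ * (4 * h)) ^ (n + 1))⁻¹) * M) ^ 2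
  let K : ℝ≥0∞ := ENNReal.ofReal (6 ^ n) * volume (Metric.ball (0 : Space n) 1)
  let N : ℝ≥0∞ := volume (Metric.ball x₀ (20 * L * h))
  let T : ℝ≥0∞ := 4 * (B * N) + 4 * (ENNReal.ofReal ((4 * L) ^ 2) * (S * (K * M)))
  have hT : T ≠ ⊤ := by
    have h1 : volume (Metric.ball (0 : Space n) 1) ≠ ⊤ := measure_ball_lt_top.ne
    have h2 : volume (Metric.ball x₀ (20 * L * h)) ≠ ⊤ := measure_ball_lt_top.ne
    finiteness
  refine ⟨T.toNNReal, fun g H v hv hM hM' j k => ?_⟩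
  rw [ENNReal.coe_toNNReal hT]
  have hgc := H.continuous
  have hF : Measurable fun x => ENNReal.ofReal (strainSq v x) :=
    (continuous_strainSq hv).measurable.ennreal_ofReal
  -- Hardy for the averaged gradient, whose scale is proportional to the height. In the slab `(4 h,
  -- 8 h)` the scale is bounded below, so the `L¹` bound applies there; the slope term is bounded by
  -- the strain.
  have h1 := hardy_graph hgc H.shift (isOpen_cylinder ν x₀ (2 * h)).measurableSet
    (add_smul_mem_cylinder_iff ν x₀ (2 * h)) (h := 4 * h) (by positivity)
    (f := fun x => avgGrad v j k ((4 * L)⁻¹ * g x) x)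
    (f' := fun x => -avgGradSlope v ν (4 * L)⁻¹ j k ((4 * L)⁻¹ * g x) x)
    (continuous_avgGrad hv (by fun_prop) j k)
    (continuous_avgGradSlope hv (by fun_prop) ν _ j k).neg
    (fun y t => by
      simp only [H.apply_sub]
      exact hasDerivAt_avgGrad hv y ν (g y) (4 * L)⁻¹ j k t)
  refine h1.trans ?_
  rw [show 2 * (4 * h) = 8 * h by ring]
  refine add_le_add (mul_le_mul' le_rfl ?_) (mul_le_mul' le_rfl ?_)
  · calc ∫⁻ x in layer ν x₀ g (2 * h) (4 * h) (8 * h),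
          ENNReal.ofReal (avgGrad v j k ((4 * L)⁻¹ * g x) x ^ 2)
        ≤ ∫⁻ _ in layer ν x₀ g (2 * h) (4 * h) (8 * h), B := by
          refine setLIntegral_mono' (H.measurableSet_layer _ _ _) fun x hx => ?_
          refine (hA v hv j k x _ ((4 * L)⁻¹ * (4 * h)) (by positivity) ?_).trans ?_
          · have := hx.2.1.le
            gcongr
          · simp only [B]
            gcongr
            exact hM' j
      _ ≤ B * N := by
          rw [setLIntegral_const]
          gcongr
          exact (measure_mono (IsGraphHeight.layer_mono le_rfl (by linarith) le_rfl)).trans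
            H.volume_layer_le
  · calc ∫⁻ x in layer ν x₀ g (2 * h) 0 (8 * h), ENNReal.ofReal
          ((g x * -avgGradSlope v ν (4 * L)⁻¹ j k ((4 * L)⁻¹ * g x) x) ^ 2)
        ≤ ∫⁻ x in layer ν x₀ g (2 * h) 0 (8 * h), ENNReal.ofReal ((4 * L) ^ 2) * (S *
          ∫⁻ z in Metric.ball (0 : Space n) 2,
            ENNReal.ofReal (strainSq v (x + ((4 * L)⁻¹ * g x) • z))) := by
          refine lintegral_mono fun x => ?_
          -- The Hardy weight `g x` is `4 * L` times the scale, which is the weight in the slope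
          -- estimate.
          have e : (g x * -avgGradSlope v ν (4 * L)⁻¹ j k ((4 * L)⁻¹ * g x) x) ^ 2
              = (4 * L) ^ 2 * ((4 * L)⁻¹ * g x *
                avgGradSlope v ν (4 * L)⁻¹ j k ((4 * L)⁻¹ * g x) x) ^ 2 := by
            field_simp
          rw [e, ENNReal.ofReal_mul (by positivity)]
          gcongr
          refine (hS v hv j k x _).trans ?_
          gcongr
          norm_num
      _ ≤ _ := by
          rw [lintegral_const_mul' _ _ ENNReal.ofReal_ne_top,
            lintegral_const_mul' _ _ ENNReal.coe_ne_top]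
          gcongr
          refine (H.lintegral_strain_le hF (H.measurableSet_layer _ _ _) le_rfl).trans ?_
          gcongr

/-- The gradient is square integrable up to the boundary. -/
theorem exists_lintegral_partialDeriv_sq_le (ν x₀ : Space n) {L h : ℝ} (hL : 1 ≤ L) (hh : 0 < h)
    (M : ℝ≥0) :
    ∃ C : ℝ≥0, ∀ g, IsGraphHeight ν x₀ L h g → ∀ v : Fin n → Space n → ℝ,
    (∀ i, ContDiff ℝ ∞ (v i)) →
    ∫⁻ x in Metric.ball x₀ (20 * L * h) ∩ {x | 0 < g x}, ENNReal.ofReal (strainSq v x) ≤ M →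
    (∀ i, ∫⁻ x, ‖v i x‖ₑ ≤ M) → ∀ j k,
    ∫⁻ x in layer ν x₀ g h 0 (2 * h), ENNReal.ofReal (partialDeriv (v k) j x ^ 2) ≤ C := by
  obtain ⟨A, hA⟩ := exists_lintegral_avgGrad_sq_le ν x₀ hL hh M
  obtain ⟨P, hP⟩ := exists_lintegral_partialDeriv_add_avgGrad_le n
  let V : ℝ≥0∞ := volume (Metric.ball (0 : Space n) 1)
  let K : ℝ≥0∞ := ENNReal.ofReal (6 ^ n) * V
  let T : ℝ≥0∞ := (ENNReal.ofReal ((4 / 9) ^ n) * V)⁻¹ * (2 * (P * (K * M) + A * V))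
  have hV : V ≠ ⊤ := measure_ball_lt_top.ne
  have hT : T ≠ ⊤ := by
    have h1 : ENNReal.ofReal ((4 / 9) ^ n) * V ≠ 0 :=
      mul_ne_zero (ENNReal.ofReal_pos.2 (by positivity)).ne'
        (Metric.measure_ball_pos _ _ one_pos).ne'
    have h2 := ENNReal.inv_ne_top.2 h1
    finiteness
  refine ⟨T.toNNReal, fun g H v hv hM hM' j k => ?_⟩
  rw [ENNReal.coe_toNNReal hT]
  have hgc := H.continuous
  have hF : Measurable fun x => ENNReal.ofReal (strainSq v x) :=
    (continuous_strainSq hv).measurable.ennreal_ofReal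
  have hd := continuous_partialDeriv (hv k) j
  have hD := H.measurableSet_layer (2 * h) 0 (4 * h)
  have hsub (y : Space n) (hy : y ∈ layer ν x₀ g h 0 (2 * h)) := H.ball_subset_layer le_rfl le_rfl hy
  rw [zero_div, show 2 * (2 * h) = 4 * h by ring] at hsub
  -- Once averaged over balls of radius comparable to the height, the gradient splits into minus the
  -- transposed mean gradient and a deviation controlled by Korn's inequality on the ball.
  refine (lintegral_le_variable_scale H.lipschitzWith hD (fun x hx => H.scale_pos hx.2.1)
    (f := fun x => ENNReal.ofReal (partialDeriv (v k) j x ^ 2)) (by fun_prop) hsub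
    (H.measurableSet_layer _ _ _)).trans ?_
  refine mul_le_mul' le_rfl ?_
  have hGm : Measurable fun x => ENNReal.ofReal (avgGrad v j k ((4 * L)⁻¹ * g x) x ^ 2) :=
    ((continuous_avgGrad hv (by fun_prop) j k).pow 2).measurable.ennreal_ofReal
  calc ∫⁻ x in layer ν x₀ g (2 * h) 0 (4 * h), ∫⁻ z in Metric.ball (0 : Space n) 1,
        ENNReal.ofReal (partialDeriv (v k) j (x + ((4 * L)⁻¹ * g x) • z) ^ 2)
      ≤ ∫⁻ x in layer ν x₀ g (2 * h) 0 (4 * h),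
          2 * (ENNReal.ofReal (avgGrad v j k ((4 * L)⁻¹ * g x) x ^ 2) * V
            + P * ∫⁻ z in Metric.ball (0 : Space n) 2,
              ENNReal.ofReal (strainSq v (x + ((4 * L)⁻¹ * g x) • z))) := by
        refine setLIntegral_mono' hD fun x hx => ?_
        set d := (4 * L)⁻¹ * g x
        have h1 := hP v hv k j x d (H.scale_pos hx.2.1)
        calc ∫⁻ z in Metric.ball (0 : Space n) 1,
              ENNReal.ofReal (partialDeriv (v k) j (x + d • z) ^ 2)
            ≤ ∫⁻ z in Metric.ball (0 : Space n) 1, 2 * (ENNReal.ofReal (avgGrad v j k d x ^ 2)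
                + ENNReal.ofReal ((partialDeriv (v k) j (x + d • z) + avgGrad v j k d x) ^ 2)) := by
              refine lintegral_mono fun z => ?_
              have := ofReal_add_sq_le (-avgGrad v j k d x)
                (partialDeriv (v k) j (x + d • z) + avgGrad v j k d x)
              rw [neg_sq] at this
              simpa using this
          _ = 2 * (ENNReal.ofReal (avgGrad v j k d x ^ 2) * V
                + ∫⁻ z in Metric.ball (0 : Space n) 1,
                ENNReal.ofReal ((partialDeriv (v k) j (x + d • z) + avgGrad v j k d x) ^ 2)) := by
              rw [lintegral_const_mul' _ _ (by norm_num), lintegral_add_left measurable_const,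
                setLIntegral_const]
          _ ≤ _ := by gcongr
    _ = 2 * ((∫⁻ x in layer ν x₀ g (2 * h) 0 (4 * h),
            ENNReal.ofReal (avgGrad v j k ((4 * L)⁻¹ * g x) x ^ 2)) * V
          + P * ∫⁻ x in layer ν x₀ g (2 * h) 0 (4 * h), ∫⁻ z in Metric.ball (0 : Space n) 2,
              ENNReal.ofReal (strainSq v (x + ((4 * L)⁻¹ * g x) • z))) := by
        rw [lintegral_const_mul' _ _ (by norm_num), lintegral_add_left (hGm.mul_const _),
          lintegral_mul_const _ hGm, lintegral_const_mul' _ _ ENNReal.coe_ne_top]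
    _ ≤ 2 * (A * V + P * (K * M)) := by
        gcongr
        · exact hA g H v hv hM hM' j k
        · refine (H.lintegral_strain_le hF hD
            (IsGraphHeight.layer_mono le_rfl le_rfl (by linarith))).trans ?_
          gcongr
    _ = _ := by rw [add_comm]

/-- The field is square integrable up to the boundary. -/
theorem exists_lintegral_boundary_sq_le (ν x₀ : Space n) {L h : ℝ} (hL : 1 ≤ L) (hh : 0 < h)
    (M : ℝ≥0) :
    ∃ C : ℝ≥0, ∀ g, IsGraphHeight ν x₀ L h g → ∀ v : Fin n → Space n → ℝ,
    (∀ i, ContDiff ℝ ∞ (v i)) →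
    ∫⁻ x in Metric.ball x₀ (20 * L * h) ∩ {x | 0 < g x}, ENNReal.ofReal (strainSq v x) ≤ M →
    (∀ i, ∫⁻ x, ‖v i x‖ₑ ≤ M) → ∀ k,
    ∫⁻ x in layer ν x₀ g h 0 h, ENNReal.ofReal (v k x ^ 2) ≤ C := by
  obtain ⟨A, hA⟩ := exists_lintegral_partialDeriv_sq_le ν x₀ hL hh M
  obtain ⟨P, hP⟩ := exists_lintegral_sq_le n
  let V : ℝ≥0∞ := volume (Metric.ball (0 : Space n) 1)
  let K : ℝ≥0∞ := ENNReal.ofReal (6 ^ n) * V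
  let N : ℝ≥0∞ := volume (Metric.ball x₀ (20 * L * h))
  let J : ℝ≥0∞ := (n * (ENNReal.ofReal ((((4 * L)⁻¹ * (h / 2)) ^ n)⁻¹) * M)) ^ 2
  let Q : ℝ≥0∞ := (ENNReal.ofReal ((4 / 9) ^ n) * V)⁻¹ *
    (P * (J * N + ENNReal.ofReal (h ^ 2) * (K * M)))
  let T : ℝ≥0∞ := 4 * Q + 4 * (ENNReal.ofReal (4 * h ^ 2) * (n * (n * A)))
  have hV : V ≠ ⊤ := measure_ball_lt_top.ne
  have hT : T ≠ ⊤ := by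
    have h1 : ENNReal.ofReal ((4 / 9) ^ n) * V ≠ 0 :=
      mul_ne_zero (ENNReal.ofReal_pos.2 (by positivity)).ne'
        (Metric.measure_ball_pos _ _ one_pos).ne'
    have h2 := ENNReal.inv_ne_top.2 h1
    have h3 : volume (Metric.ball x₀ (20 * L * h)) ≠ ⊤ := measure_ball_lt_top.ne
    finiteness
  refine ⟨T.toNNReal, fun g H v hv hM hM' k => ?_⟩
  rw [ENNReal.coe_toNNReal hT]
  have hgc := H.continuous
  have hF : Measurable fun x => ENNReal.ofReal (strainSq v x) :=
    (continuous_strainSq hv).measurable.ennreal_ofReal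
  have hvc := (hv k).continuous
  have hv' : Continuous (fderiv ℝ (v k)) := (hv k).continuous_fderiv (by simp)
  -- Hardy for the field itself: the weight is at most `2 * h`, and the vertical derivative is
  -- controlled by the gradient bound.
  have h1 := hardy_graph hgc H.shift (isOpen_cylinder ν x₀ h).measurableSet
    (add_smul_mem_cylinder_iff ν x₀ h) hh (f := v k) (f' := fun x => -fderiv ℝ (v k) x ν)
    hvc (by fun_prop)
    (fun y t => by
      have h2 : HasDerivAt (fun t : ℝ => y - t • ν) (-ν) t := by
        simpa using ((hasDerivAt_id t).smul_const ν).const_sub y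
      have h3 := ((hv k).differentiable (by simp) (y - t • ν)).hasFDerivAt.comp_hasDerivAt t h2
      rw [map_neg] at h3
      exact h3)
  refine h1.trans (add_le_add (mul_le_mul' le_rfl ?_) (mul_le_mul' le_rfl ?_))
  -- In the slab `h < g < 2 * h` the balls have radius bounded below, so the local bound by `L¹`
  -- norm and strain applies.
  · have hD := H.measurableSet_layer (2 * h) (h / 2) (4 * h)
    have hD8 : layer ν x₀ g (2 * h) (h / 2) (4 * h) ⊆ layer ν x₀ g (2 * h) 0 (8 * h) :=
      IsGraphHeight.layer_mono le_rfl (by positivity) (by linarith)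
    have hsub (y : Space n) (hy : y ∈ layer ν x₀ g h h (2 * h)) :=
      H.ball_subset_layer hh.le le_rfl hy
    rw [show 2 * (2 * h) = 4 * h by ring] at hsub
    refine (lintegral_le_variable_scale H.lipschitzWith hD
      (fun x hx => H.scale_pos (hD8 hx).2.1)
      (f := fun x => ENNReal.ofReal (v k x ^ 2)) (by fun_prop) hsub
      (H.measurableSet_layer _ _ _)).trans ?_
    refine mul_le_mul' le_rfl ?_
    calc ∫⁻ x in layer ν x₀ g (2 * h) (h / 2) (4 * h), ∫⁻ z in Metric.ball (0 : Space n) 1,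
          ENNReal.ofReal (v k (x + ((4 * L)⁻¹ * g x) • z) ^ 2)
        ≤ ∫⁻ x in layer ν x₀ g (2 * h) (h / 2) (4 * h),
            P * (J + ENNReal.ofReal (h ^ 2) * ∫⁻ z in Metric.ball (0 : Space n) 2,
              ENNReal.ofReal (strainSq v (x + ((4 * L)⁻¹ * g x) • z))) := by
          refine setLIntegral_mono' hD fun x hx => ?_
          have hgx : h / 2 < g x := hx.2.1
          have hgx4 : g x < 4 * h := hx.2.2
          have hg0 : 0 < g x := (hD8 hx).2.1
          have hdh : (4 * L)⁻¹ * g x ≤ h := by linarith [H.scale_le hg0]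
          have hd0 : (4 * L)⁻¹ * (h / 2) ≤ (4 * L)⁻¹ * g x := by gcongr
          have hd := H.scale_pos hg0
          set d := (4 * L)⁻¹ * g x
          refine (hP v hv k x d hd).trans ?_
          gcongr
          refine pow_le_pow_left₀ zero_le ?_ 2
          calc ∑ i, ∫⁻ z in Metric.ball (0 : Space n) 1, ‖v i (x + d • z)‖ₑ
              ≤ ∑ _i : Fin n, ENNReal.ofReal ((((4 * L)⁻¹ * (h / 2)) ^ n)⁻¹) * M := by
                refine Finset.sum_le_sum fun i _ => ?_
                refine (setLIntegral_le_lintegral _ _).trans ?_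
                rw [lintegral_comp_affine (hv i).continuous.enorm.measurable x hd]
                gcongr
                exact hM' i
            _ = _ := by simp
      _ = P * (J * volume (layer ν x₀ g (2 * h) (h / 2) (4 * h))
            + ENNReal.ofReal (h ^ 2) * ∫⁻ x in layer ν x₀ g (2 * h) (h / 2) (4 * h),
              ∫⁻ z in Metric.ball (0 : Space n) 2,
              ENNReal.ofReal (strainSq v (x + ((4 * L)⁻¹ * g x) • z))) := by
          rw [lintegral_const_mul' _ _ ENNReal.coe_ne_top, lintegral_add_left measurable_const,
            setLIntegral_const, lintegral_const_mul' _ _ ENNReal.ofReal_ne_top]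
      _ ≤ _ := by
          gcongr
          · exact (measure_mono hD8).trans H.volume_layer_le
          · refine (H.lintegral_strain_le hF hD hD8).trans ?_
            gcongr
  · calc ∫⁻ x in layer ν x₀ g h 0 (2 * h),
          ENNReal.ofReal ((g x * -fderiv ℝ (v k) x ν) ^ 2)
        ≤ ∫⁻ x in layer ν x₀ g h 0 (2 * h), ENNReal.ofReal (4 * h ^ 2) *
            (n * ∑ j, ENNReal.ofReal (partialDeriv (v k) j x ^ 2)) := by
          refine setLIntegral_mono' (H.measurableSet_layer _ _ _) fun x hx => ?_
          have hg0 : 0 < g x := hx.2.1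
          have hg2 : g x < 2 * h := hx.2.2
          rw [mul_neg, neg_sq, mul_pow, ENNReal.ofReal_mul (sq_nonneg _)]
          refine mul_le_mul' (ENNReal.ofReal_le_ofReal (by nlinarith)) ?_
          rw [fderiv_apply_eq_sum]
          refine (ofReal_sum_sq_le _ _).trans ?_
          rw [Finset.card_univ, Fintype.card_fin]
          refine mul_le_mul' le_rfl (Finset.sum_le_sum fun j _ => ENNReal.ofReal_le_ofReal ?_)
          rw [mul_pow]
          refine mul_le_of_le_one_left (sq_nonneg _) ?_
          have h2 := PiLp.norm_apply_le ν j
          rw [H.norm_eq] at h2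
          rw [← sq_abs]
          exact pow_le_one₀ (abs_nonneg _) h2
      _ = ENNReal.ofReal (4 * h ^ 2) * (n * ∑ j, ∫⁻ x in layer ν x₀ g h 0 (2 * h),
            ENNReal.ofReal (partialDeriv (v k) j x ^ 2)) := by
          have hm (j : Fin n) : Measurable fun x => ENNReal.ofReal (partialDeriv (v k) j x ^ 2) :=
            ((continuous_partialDeriv (hv k) j).pow 2).measurable.ennreal_ofReal
          rw [lintegral_const_mul' _ _ ENNReal.ofReal_ne_top,
            lintegral_const_mul' _ _ (ENNReal.natCast_ne_top n), lintegral_finsetSum _ fun j _ => hm j]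
      _ ≤ ENNReal.ofReal (4 * h ^ 2) * (n * ∑ _j : Fin n, (A : ℝ≥0∞)) := by
          gcongr with j
          exact hA g H v hv hM hM' j k
      _ = _ := by simp

end BoundaryKorn

/-! ### Interior estimates. -/

section InteriorEstimate

variable {n : ℕ}

theorem setLIntegral_ball_comp_affine {f : Space n → ℝ≥0∞} (hf : Measurable f) (x : Space n)
    {d r : ℝ} (hd : 0 < d) :
    ∫⁻ z in Metric.ball (0 : Space n) r, f (x + d • z)
      = ENNReal.ofReal ((d ^ n)⁻¹) * ∫⁻ y in Metric.ball x (r * d), f y := by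
  rw [← lintegral_indicator measurableSet_ball, ← lintegral_indicator measurableSet_ball,
    ← lintegral_comp_affine (hf.indicator measurableSet_ball) x hd]
  refine lintegral_congr fun z => ?_
  have : x + d • z ∈ Metric.ball x (r * d) ↔ z ∈ Metric.ball (0 : Space n) r := by
    rw [mem_ball_iff_norm, mem_ball_zero_iff, add_sub_cancel_left, norm_smul, Real.norm_eq_abs,
      abs_of_pos hd, mul_comm r, mul_lt_mul_iff_right₀ hd]
  by_cases hz : z ∈ Metric.ball (0 : Space n) r
  · rw [Set.indicator_of_mem hz, Set.indicator_of_mem (this.2 hz)]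
  · rw [Set.indicator_of_notMem hz, Set.indicator_of_notMem (fun h => hz (this.1 h))]

/-- Interior Korn estimate. -/
theorem exists_lintegral_interior_le (x : Space n) {d : ℝ} (hd : 0 < d) (M : ℝ≥0) :
    ∃ C : ℝ≥0, ∀ v : Fin n → Space n → ℝ, (∀ i, ContDiff ℝ ∞ (v i)) →
    ∫⁻ y in Metric.ball x (2 * d), ENNReal.ofReal (strainSq v y) ≤ M →
    (∀ i, ∫⁻ y, ‖v i y‖ₑ ≤ M) → ∀ k,
    (∀ j, ∫⁻ y in Metric.ball x d, ENNReal.ofReal (partialDeriv (v k) j y ^ 2) ≤ C) ∧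
    ∫⁻ y in Metric.ball x d, ENNReal.ofReal (v k y ^ 2) ≤ C := by
  obtain ⟨A, hA⟩ := exists_avgGrad_sq_le n
  obtain ⟨P, hP⟩ := exists_lintegral_partialDeriv_add_avgGrad_le n
  obtain ⟨Q, hQ⟩ := exists_lintegral_sq_le n
  let V : ℝ≥0∞ := volume (Metric.ball (0 : Space n) 1)
  let s : ℝ≥0∞ := ENNReal.ofReal ((d ^ n)⁻¹)
  let T₁ : ℝ≥0∞ := 2 * ((A * ENNReal.ofReal ((d ^ (n + 1))⁻¹) * M) ^ 2 * V + P * (s * M))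
  let T₂ : ℝ≥0∞ := Q * ((n * (s * M)) ^ 2 + ENNReal.ofReal (d ^ 2) * (s * M))
  have hV : V ≠ ⊤ := measure_ball_lt_top.ne
  have hs : s ≠ ⊤ := ENNReal.ofReal_ne_top
  have hs0 : s ≠ 0 := (ENNReal.ofReal_pos.2 (by positivity)).ne'
  have hT : s⁻¹ * (T₁ + T₂) ≠ ⊤ := by
    have := ENNReal.inv_ne_top.2 hs0
    finiteness
  refine ⟨(s⁻¹ * (T₁ + T₂)).toNNReal, fun v hv hM hM' k => ?_⟩
  rw [ENNReal.coe_toNNReal hT]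
  have hscale (f : Space n → ℝ≥0∞) (hf : Measurable f) (T : ℝ≥0∞)
      (h : ∫⁻ z in Metric.ball (0 : Space n) 1, f (x + d • z) ≤ T) :
      ∫⁻ y in Metric.ball x d, f y ≤ s⁻¹ * T := by
    rw [setLIntegral_ball_comp_affine hf x hd, one_mul] at h
    calc ∫⁻ y in Metric.ball x d, f y = s⁻¹ * (s * ∫⁻ y in Metric.ball x d, f y) := by
          rw [← mul_assoc, ENNReal.inv_mul_cancel hs0 hs, one_mul]
      _ ≤ s⁻¹ * T := by gcongr
  have hF : Measurable fun x => ENNReal.ofReal (strainSq v x) :=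
    (continuous_strainSq hv).measurable.ennreal_ofReal
  have hS : ∫⁻ z in Metric.ball (0 : Space n) 2, ENNReal.ofReal (strainSq v (x + d • z))
      ≤ s * M := by
    rw [setLIntegral_ball_comp_affine hF x hd]
    gcongr
  constructor
  · intro j
    have hd' := continuous_partialDeriv (hv k) j
    refine (hscale _ (by fun_prop) T₁ ?_).trans (mul_le_mul' le_rfl le_self_add)
    calc ∫⁻ z in Metric.ball (0 : Space n) 1,
          ENNReal.ofReal (partialDeriv (v k) j (x + d • z) ^ 2)
        ≤ ∫⁻ z in Metric.ball (0 : Space n) 1, 2 * (ENNReal.ofReal (avgGrad v j k d x ^ 2)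
            + ENNReal.ofReal ((partialDeriv (v k) j (x + d • z) + avgGrad v j k d x) ^ 2)) := by
          refine lintegral_mono fun z => ?_
          have := ofReal_add_sq_le (-avgGrad v j k d x)
            (partialDeriv (v k) j (x + d • z) + avgGrad v j k d x)
          rw [neg_sq] at this
          simpa using this
      _ = 2 * (ENNReal.ofReal (avgGrad v j k d x ^ 2) * V
            + ∫⁻ z in Metric.ball (0 : Space n) 1,
            ENNReal.ofReal ((partialDeriv (v k) j (x + d • z) + avgGrad v j k d x) ^ 2)) := by
          rw [lintegral_const_mul' _ _ (by norm_num), lintegral_add_left measurable_const,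
            setLIntegral_const]
      _ ≤ T₁ := by
          simp only [T₁]
          gcongr
          · refine (hA v hv j k x d d hd le_rfl).trans ?_
            gcongr
            exact hM' j
          · refine (hP v hv k j x d hd).trans ?_
            gcongr
  · have hvc := (hv k).continuous
    refine (hscale _ (by fun_prop) T₂ ?_).trans (mul_le_mul' le_rfl le_add_self)
    refine (hQ v hv k x d hd).trans ?_
    simp only [T₂]
    gcongr
    calc ∑ i, ∫⁻ z in Metric.ball (0 : Space n) 1, ‖v i (x + d • z)‖ₑ
        ≤ ∑ _i : Fin n, s * M := by
          refine Finset.sum_le_sum fun i _ => ?_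
          rw [setLIntegral_ball_comp_affine (hv i).continuous.enorm.measurable x hd]
          gcongr
          exact (setLIntegral_le_lintegral _ _).trans (hM' i)
      _ = _ := by simp

end InteriorEstimate

/-! ### Mollification. -/

section Mollification

variable {n : ℕ}

/-- A bump function of radius `1 / (m + 1)`. -/
def mollBump (n m : ℕ) : ContDiffBump (0 : Space n) where
  rIn := 1 / (2 * (m + 1))
  rOut := 1 / (m + 1)
  rIn_pos := by positivity
  rIn_lt_rOut := by
    gcongr
    have : (0 : ℝ) ≤ m := by positivity
    linarith

/-- The standard mollifier of radius `1 / (m + 1)`. -/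
def mollifier (n m : ℕ) : Space n → ℝ := (mollBump n m).normed volume

/-- The regularization of `f` by convolution. -/
def mollify (m : ℕ) (f : Space n → ℝ) (x : Space n) : ℝ := ∫ t, f t * mollifier n m (x - t)

variable (m : ℕ)

theorem contDiff_mollifier : ContDiff ℝ ∞ (mollifier n m) := (mollBump n m).contDiff_normed

theorem hasCompactSupport_mollifier : HasCompactSupport (mollifier n m) :=
  (mollBump n m).hasCompactSupport_normed

theorem tsupport_mollifier : tsupport (mollifier n m) = Metric.closedBall 0 (1 / (m + 1)) :=
  (mollBump n m).tsupport_normed_eq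

theorem mollifier_nonneg (x : Space n) : 0 ≤ mollifier n m x := (mollBump n m).nonneg_normed x

theorem mollifier_neg (x : Space n) : mollifier n m (-x) = mollifier n m x :=
  (mollBump n m).normed_neg x

theorem lintegral_mollifier : ∫⁻ x, ‖mollifier n m x‖ₑ = 1 := by
  have h1 (x : Space n) : ‖mollifier n m x‖ₑ = ENNReal.ofReal (mollifier n m x) := by
    rw [← ofReal_norm, Real.norm_of_nonneg (mollifier_nonneg m x)]
  have h2 : ∫ x, mollifier n m x = 1 := (mollBump n m).integral_normed
  simp only [h1]
  have h3 : Integrable (mollifier n m) := (mollBump n m).integrable_normed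
  rw [← ofReal_integral_eq_lintegral_ofReal h3
    (ae_of_all _ fun x => mollifier_nonneg m x), h2, ENNReal.ofReal_one]

theorem lintegral_mollifier_sub_right (t : Space n) : ∫⁻ x, ‖mollifier n m (x - t)‖ₑ = 1 := by
  rw [lintegral_sub_right_eq_self (fun x => ‖mollifier n m x‖ₑ) t, lintegral_mollifier]

theorem lintegral_mollifier_sub_left (x : Space n) : ∫⁻ t, ‖mollifier n m (x - t)‖ₑ = 1 := by
  have h (t : Space n) : mollifier n m (x - t) = mollifier n m (t - x) := by
    rw [← mollifier_neg, neg_sub]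
  simp only [h, lintegral_mollifier_sub_right]

variable {m} {f : Space n → ℝ}

theorem contDiff_mollify (hf : Integrable f) : ContDiff ℝ ∞ (mollify m f) :=
  (hasCompactSupport_mollifier m).contDiff_convolution_right (ContinuousLinearMap.mul ℝ ℝ)
    hf.locallyIntegrable (contDiff_mollifier m)

theorem partialDeriv_mollify (hf : Integrable f) (j : Fin n) (x : Space n) :
    partialDeriv (mollify m f) j x = ∫ t, f t * partialDeriv (mollifier n m) j (x - t) := by
  have h := (hasCompactSupport_mollifier m).hasFDerivAt_convolution_right
    (ContinuousLinearMap.mul ℝ ℝ) hf.locallyIntegrable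
    ((contDiff_mollifier (n := n) m).of_le (by simp)) x
  have h2 := convolution_precompR_apply (ContinuousLinearMap.mul ℝ ℝ) hf.locallyIntegrable
    ((hasCompactSupport_mollifier m).fderiv ℝ)
    ((contDiff_mollifier (n := n) m).continuous_fderiv (by simp)) x (EuclideanSpace.single j 1)
  have h3 : HasFDerivAt (mollify m f) _ x := h
  rw [partialDeriv, h3.fderiv, h2]
  rfl

theorem lintegral_lintegral_mollifier {g : Space n → ℝ≥0∞} (hg : AEMeasurable g) :
    ∫⁻ x, ∫⁻ t, ‖mollifier n m (x - t)‖ₑ * g t = ∫⁻ t, g t := by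
  have hc := (contDiff_mollifier (n := n) m).continuous
  rw [lintegral_lintegral_swap]
  · refine lintegral_congr fun t => ?_
    have h : Measurable fun x => ‖mollifier n m (x - t)‖ₑ :=
      (hc.comp (continuous_id.sub continuous_const)).enorm.measurable
    rw [lintegral_mul_const _ h, lintegral_mollifier_sub_right, one_mul]
  · exact (hc.comp (continuous_fst.sub continuous_snd)).enorm.measurable.aemeasurable.mul
      hg.comp_snd

theorem enorm_mollify_le (f : Space n → ℝ) (x : Space n) :
    ‖mollify m f x‖ₑ ≤ ∫⁻ t, ‖mollifier n m (x - t)‖ₑ * ‖f t‖ₑ := by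
  refine (enorm_integral_le_lintegral_enorm _).trans_eq ?_
  simp only [enorm_mul, mul_comm]

theorem lintegral_enorm_mollify_le (hf : Integrable f) :
    ∫⁻ x, ‖mollify m f x‖ₑ ≤ ∫⁻ t, ‖f t‖ₑ :=
  (lintegral_mono fun x => enorm_mollify_le f x).trans_eq
    (lintegral_lintegral_mollifier hf.aemeasurable.enorm)

/-- Jensen's inequality for the probability density `t ↦ mollifier n m (x - t)`, then Tonelli. -/
theorem lintegral_mollify_sq_le (hf : Integrable f) :
    ∫⁻ x, ENNReal.ofReal (mollify m f x ^ 2) ≤ ∫⁻ t, ENNReal.ofReal (f t ^ 2) := by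
  have hc := (contDiff_mollifier (n := n) m).continuous
  simp only [← enorm_sq_eq_ofReal]
  rw [← lintegral_lintegral_mollifier (m := m) (hf.aemeasurable.enorm.pow_const 2)]
  refine lintegral_mono fun x => ?_
  have h : Measurable fun t => ‖mollifier n m (x - t)‖ₑ :=
    (hc.comp (continuous_const.sub continuous_id)).enorm.measurable
  refine (pow_le_pow_left₀ zero_le (enorm_mollify_le f x) 2).trans ?_
  refine (lintegral_mul_sq_le h hf.aemeasurable.enorm).trans_eq ?_
  rw [lintegral_mollifier_sub_left, one_mul]

/-- Fubini moves the even mollifier onto `φ`, whose mollifications converge uniformly; integrability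
of `f` then suffices. -/
theorem tendsto_integral_mollify_mul (hf : Integrable f) {φ : Space n → ℝ} (hφ : Continuous φ)
    (hc : HasCompactSupport φ) :
    Tendsto (fun m => ∫ x, mollify m f x * φ x) atTop (𝓝 (∫ x, f x * φ x)) := by
  obtain ⟨B, hB⟩ := hφ.bounded_above_of_compact_support hc
  let ψ (m : ℕ) (t : Space n) : ℝ := ∫ x, mollifier n m (x - t) * φ x
  have hswap (m : ℕ) : ∫ x, mollify m f x * φ x = ∫ t, f t * ψ m t := by
    have hi : Integrable (fun p : Space n × Space n => f p.2 * mollifier n m (p.1 - p.2) * φ p.1)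
        (volume.prod volume) := by
      refine Integrable.mul_bdd (c := B) ?_ (by fun_prop) (ae_of_all _ fun p => hB p.1)
      exact hf.convolution_integrand (ContinuousLinearMap.mul ℝ ℝ)
        (mollBump n m).integrable_normed
    have h1 (x : Space n) : mollify m f x * φ x
        = ∫ t, f t * mollifier n m (x - t) * φ x := (integral_mul_const _ _).symm
    simp only [h1]
    rw [integral_integral_swap hi]
    congr 1
    ext t
    rw [← integral_const_mul]
    simp only [mul_assoc]
  have hψ (m : ℕ) (t : Space n) : ψ m t = ∫ s, mollifier n m s * φ (t - s) := by
    refine (integral_sub_left_eq_self (fun x => mollifier n m (x - t) * φ x)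
      volume t).symm.trans ?_
    simp only [sub_sub_cancel_left, mollifier_neg]
  have hψc (m : ℕ) : Continuous (ψ m) := by
    have h := (contDiff_mollifier (n := n) m).continuous
    have e : ψ m = fun t => ∫ x in tsupport φ, mollifier n m (x - t) * φ x := by
      ext t
      exact (setIntegral_eq_integral_of_forall_compl_eq_zero fun x hx => by
        rw [image_eq_zero_of_notMem_tsupport hx, mul_zero]).symm
    rw [e]
    exact continuous_parametric_integral_of_continuous
      (by simp only [Function.uncurry_def]; fun_prop) hc
  rw [Metric.tendsto_atTop]
  intro ε hε
  set I := ∫ t, ‖f t‖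
  have hI : 0 ≤ I := integral_nonneg fun t => norm_nonneg _
  have huc := hφ.uniformContinuous_of_tendsto_cocompact hc.is_zero_at_infty
  -- The summand 1 covers the case `I = 0` and makes the final inequality `I * (ε / (I + 1)) < ε`
  -- strict.
  obtain ⟨r, hr, hrφ⟩ := Metric.uniformContinuous_iff.1 huc (ε / (I + 1)) (by positivity)
  obtain ⟨N, hN⟩ := exists_nat_one_div_lt hr
  refine ⟨N, fun m hm => ?_⟩
  have hbound (t : Space n) : ‖ψ m t - φ t‖ ≤ ε / (I + 1) := by
    rw [hψ, ← dist_eq_norm]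
    refine ContDiffBump.dist_normed_convolution_le (φ := mollBump n m) (μ := volume)
      hφ.aestronglyMeasurable fun x hx => (hrφ ?_).le
    refine (Metric.mem_ball.1 hx).trans (lt_of_le_of_lt ?_ hN)
    change 1 / ((m : ℝ) + 1) ≤ _
    gcongr
  have hψB (m : ℕ) (t : Space n) (h : ‖ψ m t - φ t‖ ≤ ε / (I + 1)) :
      ‖ψ m t‖ ≤ ε / (I + 1) + B := by
    have := norm_add_le (ψ m t - φ t) (φ t)
    rw [sub_add_cancel] at this
    linarith [hB t]
  have i1 : Integrable fun t => f t * ψ m t :=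
    hf.mul_bdd (hψc m).aestronglyMeasurable (ae_of_all _ fun t => hψB m t (hbound t))
  have i2 : Integrable fun t => f t * φ t :=
    hf.mul_bdd hφ.aestronglyMeasurable (ae_of_all _ hB)
  rw [hswap, dist_eq_norm, ← integral_sub i1 i2]
  calc ‖∫ t, (f t * ψ m t - f t * φ t)‖ ≤ ∫ t, ‖f t‖ * (ε / (I + 1)) := by
        refine norm_integral_le_of_norm_le (hf.norm.mul_const _) (ae_of_all _ fun t => ?_)
        rw [← mul_sub, norm_mul]
        exact mul_le_mul_of_nonneg_left (hbound t) (norm_nonneg _)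
    _ = I * (ε / (I + 1)) := integral_mul_const _ _
    _ < ε := by
        rw [mul_div_assoc', div_lt_iff₀ (by positivity)]
        nlinarith

end Mollification

/-! ### Regularization of fields with square integrable strain. -/

section Regularization

variable {n : ℕ} {Ω : Set (Space n)}

theorem integral_indicator_mul (hΩ : IsOpen Ω) (f g : Space n → ℝ) :
    ∫ x, Ω.indicator f x * g x = ∫ x in Ω, f x * g x := by
  rw [← integral_indicator hΩ.measurableSet]
  simp only [Set.indicator_mul_left]

/-- Translates of the mollifier are test functions on sets containing their supports. -/
theorem isTestFunction_mollifier {m : ℕ} {x : Space n}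
    (hx : Metric.closedBall x (1 / (m + 1)) ⊆ Ω) :
    IsTestFunction Ω fun t => mollifier n m (x - t) := by
  have h (t : Space n) (ht : t ∉ Metric.closedBall x (1 / ((m : ℝ) + 1))) :
      mollifier n m (x - t) = 0 := by
    refine image_eq_zero_of_notMem_tsupport fun h => ht ?_
    rw [tsupport_mollifier, mem_closedBall_zero_iff] at h
    rwa [mem_closedBall_iff_norm']
  have hs : tsupport (fun t => mollifier n m (x - t)) ⊆ Metric.closedBall x (1 / (m + 1)) :=
    closure_minimal (fun t ht => by_contra fun h' => ht (h t h')) Metric.isClosed_closedBall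
  exact ⟨(contDiff_mollifier m).comp (contDiff_const.sub contDiff_id),
    HasCompactSupport.intro (isCompact_closedBall _ _) h, hs.trans hx⟩

theorem partialDeriv_mollifier_sub (m : ℕ) (x t : Space n) (j : Fin n) :
    partialDeriv (fun t => mollifier n m (x - t)) j t = -partialDeriv (mollifier n m) j (x - t) := by
  have h := partialDeriv_comp_affine (contDiff_mollifier (n := n) m) x (-1) j t
  simpa [← sub_eq_add_neg] using h

/-- The components of the regularization of the extension of `u` by zero. -/
def regularize (Ω : Set (Space n)) (u : Space n → Space n) (m : ℕ) (i : Fin n) : Space n → ℝ :=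
  mollify m (Ω.indicator fun t => u t i)

variable {u : Space n → Space n}

theorem integrable_indicator_apply (hΩ : IsOpen Ω) (hu : IntegrableOn u Ω) (i : Fin n) :
    Integrable (Ω.indicator fun t => u t i) :=
  (integrable_indicator_iff hΩ.measurableSet).2 (Integrable.eval_piLp hu i)

theorem contDiff_regularize (hΩ : IsOpen Ω) (hu : IntegrableOn u Ω) (m : ℕ) (i : Fin n) :
    ContDiff ℝ ∞ (regularize Ω u m i) :=
  contDiff_mollify (integrable_indicator_apply hΩ hu i)

theorem symGrad_regularize (hΩ : IsOpen Ω) (hu : IntegrableOn u Ω) {e : Space n → Mat n}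
    (he : ∀ φ, IsTestFunction Ω φ → ∀ i j,
      (1 / 2 : ℝ) * ∫ x in Ω, (u x i * partialDeriv φ j x + u x j * partialDeriv φ i x)
        = -∫ x in Ω, e x i j * φ x) {m : ℕ} {x : Space n}
    (hx : Metric.closedBall x (1 / (m + 1)) ⊆ Ω) (i j : Fin n) :
    symGrad (regularize Ω u m) i j x = mollify m (Ω.indicator fun t => e t i j) x := by
  have h1 := he _ (isTestFunction_mollifier hx) i j
  have hφ := isTestFunction_mollifier hx
  have hint (i j : Fin n) : Integrable (fun t => u t i *
      partialDeriv (fun t => mollifier n m (x - t)) j t) (volume.restrict Ω) := by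
    obtain ⟨B, hB⟩ := (continuous_partialDeriv hφ.smooth j).bounded_above_of_compact_support
      (hasCompactSupport_partialDeriv hφ.compact j)
    exact (Integrable.eval_piLp hu i).mul_bdd
      (continuous_partialDeriv hφ.smooth j).aestronglyMeasurable (ae_of_all _ hB)
  have h2 (i j : Fin n) : partialDeriv (regularize Ω u m i) j x
      = -∫ t in Ω, u t i * partialDeriv (fun t => mollifier n m (x - t)) j t := by
    rw [regularize, partialDeriv_mollify (integrable_indicator_apply hΩ hu i),
      integral_indicator_mul hΩ, ← integral_neg]
    simp only [partialDeriv_mollifier_sub, mul_neg, neg_neg]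
  rw [integral_add (hint i j) (hint j i)] at h1
  rw [symGrad, h2, h2, mollify, integral_indicator_mul hΩ]
  linarith

/-- Mollification contracts `L²`, so the bound depends neither on `m` nor on the set. -/
theorem setLIntegral_strainSq_regularize_le (hΩ : IsOpen Ω) (hu : IntegrableOn u Ω)
    {e : Space n → Mat n} (hi : ∀ i j, IntegrableOn (fun x => e x i j) Ω)
    (he : ∀ φ, IsTestFunction Ω φ → ∀ i j,
      (1 / 2 : ℝ) * ∫ x in Ω, (u x i * partialDeriv φ j x + u x j * partialDeriv φ i x)
        = -∫ x in Ω, e x i j * φ x) {m : ℕ} {A : Set (Space n)} (hA : MeasurableSet A)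
    (h : ∀ x ∈ A, Metric.closedBall x (1 / ((m : ℝ) + 1)) ⊆ Ω) :
    ∫⁻ x in A, ENNReal.ofReal (strainSq (regularize Ω u m) x)
      ≤ ∑ i, ∑ j, ∫⁻ x in Ω, ENNReal.ofReal (e x i j ^ 2) := by
  have hi' (i j : Fin n) : Integrable (Ω.indicator fun t => e t i j) :=
    (integrable_indicator_iff hΩ.measurableSet).2 (hi i j)
  have hm (i j : Fin n) : Measurable fun x =>
      ENNReal.ofReal (mollify m (Ω.indicator fun t => e t i j) x ^ 2) :=
    ((contDiff_mollify (hi' i j)).continuous.pow 2).measurable.ennreal_ofReal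
  calc ∫⁻ x in A, ENNReal.ofReal (strainSq (regularize Ω u m) x)
      = ∫⁻ x in A, ∑ i, ∑ j,
          ENNReal.ofReal (mollify m (Ω.indicator fun t => e t i j) x ^ 2) := by
        refine setLIntegral_congr_fun hA fun x hx => ?_
        simp only [strainSq, symGrad_regularize hΩ hu he (h x hx)]
        rw [ENNReal.ofReal_sum_of_nonneg fun i _ => Finset.sum_nonneg fun j _ => sq_nonneg _]
        exact Finset.sum_congr rfl fun i _ =>
          ENNReal.ofReal_sum_of_nonneg fun j _ => sq_nonneg _
    _ ≤ ∫⁻ x, ∑ i, ∑ j, ENNReal.ofReal (mollify m (Ω.indicator fun t => e t i j) x ^ 2) :=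
        setLIntegral_le_lintegral _ _
    _ = ∑ i, ∑ j, ∫⁻ x, ENNReal.ofReal (mollify m (Ω.indicator fun t => e t i j) x ^ 2) := by
        rw [lintegral_finsetSum _ fun i _ => Finset.measurable_fun_sum _ fun j _ => hm i j]
        exact Finset.sum_congr rfl fun i _ => lintegral_finsetSum _ fun j _ => hm i j
    _ ≤ _ := by
        refine Finset.sum_le_sum fun i _ => Finset.sum_le_sum fun j _ => ?_
        refine (lintegral_mollify_sq_le (hi' i j)).trans_eq ?_
        rw [← lintegral_indicator hΩ.measurableSet]
        refine lintegral_congr fun x => ?_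
        by_cases hx : x ∈ Ω <;> simp [hx]

theorem lintegral_enorm_regularize_le (hΩ : IsOpen Ω) (hu : IntegrableOn u Ω) (m : ℕ)
    (i : Fin n) : ∫⁻ x, ‖regularize Ω u m i x‖ₑ ≤ ∫⁻ x in Ω, ‖u x‖ₑ := by
  refine (lintegral_enorm_mollify_le (integrable_indicator_apply hΩ hu i)).trans ?_
  rw [← lintegral_indicator hΩ.measurableSet]
  refine lintegral_mono fun x => ?_
  by_cases hx : x ∈ Ω
  · simpa [hx] using PiLp.enorm_apply_le (u x) i
  · simp [hx]

end Regularization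

/-! ### Boundary charts. -/

section GraphChart

variable {n : ℕ} {Ω : Set (Space n)}

/-- Near a point of a Lipschitz boundary, `Ω` is the positivity set of a graph height. -/
theorem exists_isGraphHeight (hΩ : IsOpen Ω) (hL : HasLipschitzBoundary Ω) {x₀ : Space n}
    (hx₀ : x₀ ∈ frontier Ω) :
    ∃ r > 0, ∃ (ν : Space n) (L : ℝ) (g : Space n → ℝ), 1 ≤ L ∧
      (∀ x ∈ Metric.ball x₀ r, x ∈ Ω ↔ 0 < g x) ∧
      ∀ h > 0, ∀ s, |s| ≤ h / 2 → IsGraphHeight ν x₀ L h fun x => g x - s := by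
  obtain ⟨r, hr, ν, hν, K, γ, hγ, hmem⟩ := hL x₀ hx₀
  have hνν : inner ℝ ν ν = (1 : ℝ) := by rw [real_inner_self_eq_norm_sq, hν, one_pow]
  let g : Space n → ℝ := fun x => inner ℝ x ν - γ (x - inner ℝ x ν • ν)
  have hgc : Continuous g := by
    have := hγ.continuous
    fun_prop
  have hmem' : ∀ x ∈ Metric.ball x₀ r, x ∈ Ω ↔ 0 < g x := fun x hx =>
    (hmem x hx).trans sub_pos.symm
  -- A boundary point is outside the open set `Ω`, so `g x₀ ≤ 0`; if `g x₀ < 0`, a whole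
  -- neighbourhood would miss `Ω`.
  have hg0 : g x₀ = 0 := by
    refine le_antisymm ?_ ?_
    · refine not_lt.1 fun h => ?_
      rw [hΩ.frontier_eq] at hx₀
      exact hx₀.2 ((hmem' x₀ (Metric.mem_ball_self hr)).2 h)
    · refine not_lt.1 fun h => ?_
      have hopen : IsOpen (Metric.ball x₀ r ∩ {x | g x < 0}) :=
        Metric.isOpen_ball.inter (isOpen_lt hgc continuous_const)
      obtain ⟨y, hy, hyΩ⟩ := mem_closure_iff.1 (frontier_subset_closure hx₀) _ hopen
        ⟨Metric.mem_ball_self hr, h⟩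
      exact lt_asymm hy.2 ((hmem' y hy.1).1 hyΩ)
  -- The projection orthogonal to `ν` is 2-Lipschitz by the triangle inequality, hence the constant
  -- `1 + 2 * K`.
  refine ⟨r, hr, ν, 1 + 2 * K, g, ?_, hmem', fun h hh s hs => ⟨hν, ?_, hh, ?_, ?_, ?_⟩⟩
  · have := K.2
    linarith
  · have := K.2
    linarith
  · intro x y
    have h1 : |inner ℝ (x - y) ν| ≤ dist x y := by
      have := abs_real_inner_le_norm (x - y) ν
      rwa [hν, mul_one, ← dist_eq_norm] at this
    have h2 : dist (x - inner ℝ x ν • ν) (y - inner ℝ y ν • ν) ≤ 2 * dist x y := by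
      have e : x - inner ℝ x ν • ν - (y - inner ℝ y ν • ν) = (x - y) - inner ℝ (x - y) ν • ν := by
        rw [inner_sub_left, sub_smul]
        abel
      rw [dist_eq_norm, e]
      refine (norm_sub_le _ _).trans ?_
      rw [norm_smul, hν, mul_one, Real.norm_eq_abs, ← dist_eq_norm]
      linarith
    have h3 := hγ.dist_le_mul (x - inner ℝ x ν • ν) (y - inner ℝ y ν • ν)
    rw [Real.dist_eq] at h3
    have h4 : (K : ℝ) * dist (x - inner ℝ x ν • ν) (y - inner ℝ y ν • ν)
        ≤ K * (2 * dist x y) := by gcongr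
    rw [inner_sub_left] at h1
    simp only [g]
    rw [abs_le] at h1 h3 ⊢
    constructor <;> linarith [h1.1, h1.2, h3.1, h3.2]
  · intro x t
    have h1 : inner ℝ (x + t • ν) ν = inner ℝ x ν + t := by
      rw [inner_add_left, real_inner_smul_left, hνν, mul_one]
    have h2 : x + t • ν - (inner ℝ x ν + t) • ν = x - inner ℝ x ν • ν := by
      rw [add_smul]
      abel
    simp only [g, h1, h2]
    ring
  · simpa [hg0] using hs

end GraphChart

/-! ### Korn regularity on Lipschitz domains. -/

section KornRegularity

variable {n : ℕ} {Ω : Set (Space n)} {u : Space n → Space n}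

/-- The regularizations of `u` are eventually bounded by `C` in `H¹(K)`, for all compact subsets
`K` of `Ω ∩ s`. -/
def RegularizationBound (Ω : Set (Space n)) (u : Space n → Space n) (s : Set (Space n))
    (C : ℝ≥0) : Prop :=
  ∀ K, IsCompact K → K ⊆ Ω → K ⊆ s → ∀ᶠ m in atTop, ∀ k,
    (∀ j, ∫⁻ x in K, ENNReal.ofReal (partialDeriv (regularize Ω u m k) j x ^ 2) ≤ C) ∧
    ∫⁻ x in K, ENNReal.ofReal (regularize Ω u m k x ^ 2) ≤ C

theorem eventually_one_div_lt {δ : ℝ} (hδ : 0 < δ) : ∀ᶠ m : ℕ in atTop, 1 / ((m : ℝ) + 1) < δ :=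
  tendsto_one_div_add_atTop_nhds_zero_nat.eventually_lt_const hδ

/-- The estimate on the ball of radius `r / 4` uses the strain on that of radius `r / 2`, and
mollification at scale below `r / 2` then stays within the ball of radius `r`. -/
theorem exists_regularizationBound_interior (hΩ : IsOpen Ω) (hu : IntegrableOn u Ω) {M : ℝ≥0}
    (hS : ∀ (m : ℕ) (A : Set (Space n)), MeasurableSet A →
      (∀ x ∈ A, Metric.closedBall x (1 / ((m : ℝ) + 1)) ⊆ Ω) →
      ∫⁻ x in A, ENNReal.ofReal (strainSq (regularize Ω u m) x) ≤ M)
    (hM : ∀ m i, ∫⁻ x, ‖regularize Ω u m i x‖ₑ ≤ M) {x₀ : Space n} (hx₀ : x₀ ∈ Ω) :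
    ∃ ρ > 0, ∃ C, RegularizationBound Ω u (Metric.ball x₀ ρ) C := by
  obtain ⟨r, hr, hrΩ⟩ := Metric.isOpen_iff.1 hΩ x₀ hx₀
  obtain ⟨C, hC⟩ := exists_lintegral_interior_le x₀ (d := r / 4) (by positivity) M
  refine ⟨r / 4, by positivity, C, fun K _ _ hK => ?_⟩
  filter_upwards [eventually_one_div_lt (half_pos hr)] with m hm k
  have h := hC _ (fun i => contDiff_regularize hΩ hu m i)
    (hS m _ measurableSet_ball fun x hx y hy => hrΩ ?_) (hM m) k
  · exact ⟨fun j => (lintegral_mono_set hK).trans (h.1 j), (lintegral_mono_set hK).trans h.2⟩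
  · rw [Metric.mem_ball] at hx ⊢
    rw [Metric.mem_closedBall] at hy
    linarith [dist_triangle y x x₀]

/-- The mollified strain is known only at some distance from the boundary, so the graph is raised by
an amount `s` depending on the compact set. The constant does not depend on `s`, because the
boundary estimates are uniform over graph heights with given `L` and `h`. -/
theorem exists_regularizationBound_boundary (hΩ : IsOpen Ω) (hL : HasLipschitzBoundary Ω)
    (hu : IntegrableOn u Ω) {M : ℝ≥0}
    (hS : ∀ (m : ℕ) (A : Set (Space n)), MeasurableSet A →
      (∀ x ∈ A, Metric.closedBall x (1 / ((m : ℝ) + 1)) ⊆ Ω) →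
      ∫⁻ x in A, ENNReal.ofReal (strainSq (regularize Ω u m) x) ≤ M)
    (hM : ∀ m i, ∫⁻ x, ‖regularize Ω u m i x‖ₑ ≤ M) {x₀ : Space n} (hx₀ : x₀ ∈ frontier Ω) :
    ∃ ρ > 0, ∃ C, RegularizationBound Ω u (Metric.ball x₀ ρ) C := by
  obtain ⟨r, hr, ν, L, g, hL1, hmem, hg⟩ := exists_isGraphHeight hΩ hL hx₀
  have hL0 : 0 < L := by linarith
  -- Makes `20 * L * h = r / 2`, which leaves half of the chart for the mollification radius.
  let h := r / (40 * L)
  have hh : 0 < h := by positivity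
  have hLh : 20 * L * h = r / 2 := by
    simp only [h]
    field_simp
    norm_num
  have hg0 := hg h hh 0 (by rw [abs_zero]; positivity)
  have hgc : Continuous g := by simpa using hg0.continuous
  have hρr : h / (2 * L) ≤ r := by
    have h1 : h / (2 * L) ≤ h := div_le_self hh.le (by linarith)
    nlinarith
  obtain ⟨C, hC⟩ := exists_lintegral_partialDeriv_sq_le ν x₀ hL1 hh M
  obtain ⟨C', hC'⟩ := exists_lintegral_boundary_sq_le ν x₀ hL1 hh M
  refine ⟨h / (2 * L), by positivity, C + C', fun K hKc hKΩ hK => ?_⟩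
  obtain ⟨a, ha, hKa⟩ := hKc.exists_forall_le' hgc.continuousOn
    (a := 0) fun x hx => (hmem x (Metric.ball_subset_ball hρr (hK hx))).1 (hKΩ hx)
  -- The first bound keeps `K` above the raised graph, the second keeps `x₀` within height `h / 2`
  -- of it.
  let s := min (a / 2) (h / 2)
  have hs : 0 < s := lt_min (by positivity) (by positivity)
  have hsh : |s| ≤ h / 2 := by rw [abs_of_pos hs]; exact min_le_right _ _
  have H := hg h hh s hsh
  have hKl : K ⊆ layer ν x₀ (fun x => g x - s) h 0 h := fun x hx => by
    refine H.ball_inter_subset ⟨hK hx, ?_⟩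
    have h1 := hKa x hx
    have h2 : s ≤ a / 2 := min_le_left _ _
    change 0 < g x - s
    linarith
  filter_upwards [eventually_one_div_lt (half_pos hr),
    eventually_one_div_lt (δ := s / L) (by positivity)] with m hm hm' k
  rw [lt_div_iff₀ hL0] at hm'
  have hv (i : Fin n) := contDiff_regularize hΩ hu m i
  have hA : ∫⁻ x in Metric.ball x₀ (20 * L * h) ∩ {x | 0 < g x - s},
      ENNReal.ofReal (strainSq (regularize Ω u m) x) ≤ M := by
    refine hS m _ (measurableSet_ball.inter (H.continuous.measurable measurableSet_Ioi)) ?_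
    rintro x ⟨hx, hxs⟩ y hy
    change 0 < g x - s at hxs
    rw [Metric.mem_ball, hLh] at hx
    rw [Metric.mem_closedBall] at hy
    refine (hmem y ?_).2 ?_
    · rw [Metric.mem_ball]
      linarith [dist_triangle y x x₀]
    · have h1 := (abs_le.1 (H.lipschitz y x)).1
      have h2 : L * dist y x ≤ L * (1 / (m + 1)) := by gcongr
      linarith
  refine ⟨fun j => ?_, ?_⟩
  · refine (lintegral_mono_set (hKl.trans (IsGraphHeight.layer_mono le_rfl le_rfl ?_))).trans
      ((hC _ H _ hv hA (hM m) j k).trans ?_)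
    · linarith
    · push_cast
      exact le_self_add
  · refine (lintegral_mono_set hKl).trans ((hC' _ H _ hv hA (hM m) k).trans ?_)
    push_cast
    exact le_add_self

theorem exists_regularizationBound (hΩ : IsOpen Ω) (hb : Bornology.IsBounded Ω)
    (hL : HasLipschitzBoundary Ω) (hu : IntegrableOn u Ω) (hS : HasL2Strain Ω u) :
    ∃ C, RegularizationBound Ω u (closure Ω) C := by
  have : IsFiniteMeasure (volume.restrict Ω) := ⟨by simpa using hb.measure_lt_top⟩
  obtain ⟨e, hei, he⟩ := hS
  let S : ℝ≥0∞ := ∑ i, ∑ j, ∫⁻ x in Ω, ENNReal.ofReal (e x i j ^ 2)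
  have hSfin : S ≠ ⊤ := by
    refine ENNReal.sum_ne_top.2 fun i _ => ENNReal.sum_ne_top.2 fun j _ => ?_
    exact (hei i j).integrable_sq.lintegral_lt_top.ne
  have hufin : ∫⁻ x in Ω, ‖u x‖ₑ ≠ ⊤ := hu.2.ne
  let M : ℝ≥0 := (S + ∫⁻ x in Ω, ‖u x‖ₑ).toNNReal
  have hMc : (M : ℝ≥0∞) = S + ∫⁻ x in Ω, ‖u x‖ₑ :=
    ENNReal.coe_toNNReal (ENNReal.add_ne_top.2 ⟨hSfin, hufin⟩)
  have hSM (m : ℕ) (A : Set (Space n)) (hA : MeasurableSet A)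
      (h : ∀ x ∈ A, Metric.closedBall x (1 / ((m : ℝ) + 1)) ⊆ Ω) :
      ∫⁻ x in A, ENNReal.ofReal (strainSq (regularize Ω u m) x) ≤ M := by
    rw [hMc]
    exact (setLIntegral_strainSq_regularize_le hΩ hu
      (fun i j => (hei i j).integrable (by norm_num)) he hA h).trans le_self_add
  have hM (m : ℕ) (i : Fin n) : ∫⁻ x, ‖regularize Ω u m i x‖ₑ ≤ M := by
    rw [hMc]
    exact (lintegral_enorm_regularize_le hΩ hu m i).trans le_add_self
  have hcompact : IsCompact (closure Ω) := hb.isCompact_closure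
  -- With closures in the inductive property, a compact set splits into compact pieces, to which the
  -- bounds for the two parts of a union apply.
  suffices ∃ C, RegularizationBound Ω u (closure (closure Ω)) C by rwa [closure_closure] at this
  refine hcompact.induction_on (p := fun s => ∃ C, RegularizationBound Ω u (closure s) C)
    ?_ ?_ ?_ ?_
  · refine ⟨0, fun K _ _ hK => Eventually.of_forall fun m k => ?_⟩
    rw [closure_empty] at hK
    simp [Set.subset_empty_iff.1 hK]
  · rintro s t hst ⟨C, hC⟩
    exact ⟨C, fun K hK hKΩ hKs => hC K hK hKΩ (hKs.trans (closure_mono hst))⟩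
  · rintro s t ⟨C, hC⟩ ⟨C', hC'⟩
    refine ⟨C + C', fun K hK hKΩ hKs => ?_⟩
    rw [closure_union] at hKs
    filter_upwards [hC (K ∩ closure s) (hK.inter_right isClosed_closure)
        (Set.inter_subset_left.trans hKΩ) Set.inter_subset_right,
      hC' (K ∩ closure t) (hK.inter_right isClosed_closure)
        (Set.inter_subset_left.trans hKΩ) Set.inter_subset_right] with m h1 h2 k
    have hsub : K ⊆ K ∩ closure s ∪ K ∩ closure t := by
      rw [← Set.inter_union_distrib_left]
      exact Set.subset_inter le_rfl hKs
    push_cast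
    exact ⟨fun j => (lintegral_mono_set hsub).trans ((lintegral_union_le _ _ _).trans
        (add_le_add ((h1 k).1 j) ((h2 k).1 j))),
      (lintegral_mono_set hsub).trans ((lintegral_union_le _ _ _).trans
        (add_le_add (h1 k).2 (h2 k).2))⟩
  · intro x hx
    have : ∃ ρ > 0, ∃ C, RegularizationBound Ω u (Metric.ball x ρ) C := by
      by_cases hxΩ : x ∈ Ω
      · exact exists_regularizationBound_interior hΩ hu hSM hM hxΩ
      · exact exists_regularizationBound_boundary hΩ hL hu hSM hM
          (by rw [hΩ.frontier_eq]; exact ⟨hx, hxΩ⟩)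
    obtain ⟨ρ, hρ, C, hC⟩ := this
    refine ⟨Metric.ball x (ρ / 2), mem_nhdsWithin_of_mem_nhds (Metric.ball_mem_nhds x (half_pos hρ)),
      C, fun K hK hKΩ hKs => hC K hK hKΩ (hKs.trans ?_)⟩
    exact Metric.closure_ball_subset_closedBall.trans
      (Metric.closedBall_subset_ball (half_lt_self hρ))

/-- Cauchy-Schwarz inequality against a test function. -/
theorem sq_integral_mul_le {w φ : Space n → ℝ} (hw : Continuous w) (hφ : IsTestFunction Ω φ)
    (hΩ : IsOpen Ω) {C : ℝ≥0} (hC : ∫⁻ x in tsupport φ, ENNReal.ofReal (w x ^ 2) ≤ C) :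
    (∫ x, w x * φ x) ^ 2 ≤ C * ∫ x in Ω, φ x ^ 2 := by
  have hK : IsCompact (tsupport φ) := hφ.compact
  have : IsFiniteMeasure (volume.restrict (tsupport φ)) := ⟨by simpa using hK.measure_lt_top⟩
  have hmem (f : Space n → ℝ) (hf : Continuous f) : MemLp f 2 (volume.restrict (tsupport φ)) := by
    refine (memLp_two_iff_integrable_sq hf.aestronglyMeasurable).2 ?_
    exact (hf.pow 2).continuousOn.integrableOn_compact hK
  have h1 : ∫ x, w x * φ x = ∫ x in tsupport φ, w x * φ x :=
    (setIntegral_eq_integral_of_forall_compl_eq_zero fun x hx => by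
      rw [image_eq_zero_of_notMem_tsupport hx, mul_zero]).symm
  have h2 : ∫ x in Ω, φ x ^ 2 = ∫ x in tsupport φ, φ x ^ 2 := by
    refine setIntegral_eq_of_subset_of_forall_sdiff_eq_zero hΩ.measurableSet hφ.support
      fun x hx => ?_
    rw [image_eq_zero_of_notMem_tsupport hx.2, zero_pow two_ne_zero]
  have h3 : ∫ x in tsupport φ, w x ^ 2 ≤ C := by
    have := ofReal_integral_eq_lintegral_ofReal (hmem w hw).integrable_sq
      (ae_of_all _ fun x => sq_nonneg (w x))
    rw [← this, ENNReal.ofReal_le_iff_le_toReal ENNReal.coe_ne_top] at hC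
    simpa using hC
  have h4 := abs_real_inner_le_norm ((hmem w hw).toLp w) ((hmem φ hφ.continuous).toLp φ)
  rw [inner_toLp, ← h1] at h4
  calc (∫ x, w x * φ x) ^ 2 = |∫ x, w x * φ x| ^ 2 := (sq_abs _).symm
    _ ≤ (‖(hmem w hw).toLp w‖ * ‖(hmem φ hφ.continuous).toLp φ‖) ^ 2 := by gcongr
    _ = (∫ x in tsupport φ, w x ^ 2) * ∫ x in tsupport φ, φ x ^ 2 := by
        rw [mul_pow, norm_toLp_sq, norm_toLp_sq]
    _ ≤ _ := by
        rw [h2]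
        exact mul_le_mul_of_nonneg_right h3 (integral_nonneg fun x => sq_nonneg _)

/-- A distributional limit of functions bounded in `L²` on compact sets is an `L²` function. -/
theorem exists_memLp_of_tendsto (hΩ : IsOpen Ω) (hb : Bornology.IsBounded Ω)
    {w : ℕ → Space n → ℝ} (hw : ∀ m, Continuous (w m)) {C : ℝ≥0}
    (hC : ∀ K, IsCompact K → K ⊆ Ω → ∀ᶠ m in atTop, ∫⁻ x in K, ENNReal.ofReal (w m x ^ 2) ≤ C)
    (T : (Space n → ℝ) → ℝ)
    (hT : ∀ φ, IsTestFunction Ω φ → Tendsto (fun m => ∫ x, w m x * φ x) atTop (𝓝 (T φ))) :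
    ∃ g, MemLp g 2 (volume.restrict Ω) ∧
      ∀ φ, IsTestFunction Ω φ → T φ = ∫ x in Ω, g x * φ x := by
  have hi (m : ℕ) (φ) (hφ : IsTestFunction Ω φ) : Integrable fun x => w m x * φ x := by
    simpa only [mul_comm] using
      integrable_mul_of_hasCompactSupport hφ.continuous (hw m) hφ.compact
  refine exists_memLp_of_bounded hΩ hb T ?_ ?_ C ?_
  · intro φ ψ hφ hψ
    refine tendsto_nhds_unique (hT _ (hφ.add hψ)) (((hT φ hφ).add (hT ψ hψ)).congr fun m => ?_)
    rw [← integral_add (hi m φ hφ) (hi m ψ hψ)]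
    simp only [Pi.add_apply, mul_add]
  · intro c φ hφ
    refine tendsto_nhds_unique (hT _ (hφ.smul c)) (((hT φ hφ).const_mul c).congr fun m => ?_)
    rw [← integral_const_mul]
    simp only [Pi.smul_apply, smul_eq_mul, mul_left_comm]
  · intro φ hφ
    refine le_of_tendsto ((hT φ hφ).pow 2) ?_
    filter_upwards [hC _ hφ.compact hφ.support] with m hm
    exact sq_integral_mul_le (hw m) hφ hΩ hm

/-- Korn's inequality: on a bounded Lipschitz domain, an integrable function with square
integrable strain belongs to `H¹`. -/
theorem memH1_of_hasL2Strain (hΩ : IsOpen Ω) (hb : Bornology.IsBounded Ω)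
    (hL : HasLipschitzBoundary Ω) (hu : IntegrableOn u Ω) (hS : HasL2Strain Ω u) :
    MemH1 Ω u := by
  have : IsFiniteMeasure (volume.restrict Ω) := ⟨by simpa using hb.measure_lt_top⟩
  obtain ⟨C, hC⟩ := exists_regularizationBound hΩ hb hL hu hS
  have hv (m : ℕ) (i : Fin n) := contDiff_regularize hΩ hu m i
  have hlim (k : Fin n) (φ : Space n → ℝ) (hφ : IsTestFunction Ω φ) :
      Tendsto (fun m => ∫ x, regularize Ω u m k x * φ x) atTop (𝓝 (∫ x in Ω, u x k * φ x)) := by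
    rw [← integral_indicator_mul hΩ]
    exact tendsto_integral_mollify_mul (integrable_indicator_apply hΩ hu k) hφ.continuous
      hφ.compact
  have h1 (k : Fin n) : ∃ g, MemLp g 2 (volume.restrict Ω) ∧
      ∀ φ, IsTestFunction Ω φ → ∫ x in Ω, u x k * φ x = ∫ x in Ω, g x * φ x := by
    refine exists_memLp_of_tendsto hΩ hb (fun m => (hv m k).continuous) (C := C)
      (fun K hK hKΩ => ?_) _ (hlim k)
    exact (hC K hK hKΩ (hKΩ.trans subset_closure)).mono fun m h => (h k).2
  have h2 (k j : Fin n) : ∃ g, MemLp g 2 (volume.restrict Ω) ∧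
      ∀ φ, IsTestFunction Ω φ →
        -∫ x in Ω, u x k * partialDeriv φ j x = ∫ x in Ω, g x * φ x := by
    refine exists_memLp_of_tendsto hΩ hb (fun m => continuous_partialDeriv (hv m k) j) (C := C)
      (fun K hK hKΩ => ?_) (fun φ => -∫ x in Ω, u x k * partialDeriv φ j x) fun φ hφ => ?_
    · exact (hC K hK hKΩ (hKΩ.trans subset_closure)).mono fun m h => (h k).1 j
    -- With the derivative on the test function, weak convergence of the fields suffices for their
    -- gradients.
    · refine ((hlim k _ (hφ.partialDeriv j)).neg).congr fun m => ?_
      have h := integral_mul_partialDeriv hφ.smooth (hv m k) hφ.compact j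
      simp only [mul_comm (φ _), mul_comm (partialDeriv φ j _)] at h
      exact h.symm
  refine ⟨MemLp.of_eval_piLp fun k => ?_, ?_⟩
  · obtain ⟨g, hg, h⟩ := h1 k
    refine hg.ae_eq (ae_eq_of_integral_testFunction hΩ (hg.integrable (by norm_num))
      (Integrable.eval_piLp hu k) fun φ hφ => (h φ hφ).symm)
  · choose G hG h using h2
    refine ⟨fun x => Matrix.of fun k j => G k j x, fun i j => hG i j, fun φ hφ i j => ?_⟩
    rw [← neg_eq_iff_eq_neg]
    exact h i j φ hφ

end KornRegularity

/-! ### Convexity of elastic quadratic forms. -/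

section ElasticityTensors

variable {n : ℕ}

theorem frob_eq_sum (ξ ζ : Mat n) : frob ξ ζ = ∑ i, ∑ j, ξ i j * ζ j i := by
  simp [frob, Matrix.trace, Matrix.mul_apply]

theorem frob_self_of_isSymm {ξ : Mat n} (h : ξ.IsSymm) : frob ξ ξ = ∑ i, ∑ j, ξ i j ^ 2 := by
  rw [frob_eq_sum]
  refine Finset.sum_congr rfl fun i _ => Finset.sum_congr rfl fun j _ => ?_
  rw [h.apply i j, sq]

theorem frob_self_nonneg {ξ : Mat n} (h : ξ.IsSymm) : 0 ≤ frob ξ ξ := by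
  rw [frob_self_of_isSymm h]
  exact Finset.sum_nonneg fun i _ => Finset.sum_nonneg fun j _ => sq_nonneg _

theorem sq_le_frob_self {ξ : Mat n} (h : ξ.IsSymm) (i j : Fin n) : ξ i j ^ 2 ≤ frob ξ ξ := by
  rw [frob_self_of_isSymm h]
  exact (Finset.single_le_sum (f := fun j => ξ i j ^ 2) (fun _ _ => sq_nonneg _)
    (Finset.mem_univ j)).trans (Finset.single_le_sum (f := fun i => ∑ j, ξ i j ^ 2)
    (fun _ _ => Finset.sum_nonneg fun _ _ => sq_nonneg _) (Finset.mem_univ i))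

theorem Tensor4.app_sub (A : Tensor4 n) (ξ ζ : Mat n) : A.app (ξ - ζ) = A.app ξ - A.app ζ := by
  ext i j
  simp [Tensor4.app, mul_sub, Finset.sum_sub_distrib]

namespace IsElasticityTensor

variable {A : Tensor4 n}

theorem frob_app (hA : IsElasticityTensor A) (ξ ζ : Mat n) :
    frob (A.app ξ) ζ = ∑ i, ∑ j, ∑ k, ∑ l, A i j k l * ξ k l * ζ i j := by
  rw [frob_eq_sum, Finset.sum_comm]
  refine Finset.sum_congr rfl fun i _ => Finset.sum_congr rfl fun j _ => ?_
  simp only [Tensor4.app, Matrix.of_apply, Finset.sum_mul]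
  refine Finset.sum_congr rfl fun k _ => Finset.sum_congr rfl fun l _ => ?_
  rw [hA.minor_left]

theorem frob_app_comm (hA : IsElasticityTensor A) (ξ ζ : Mat n) :
    frob (A.app ξ) ζ = frob (A.app ζ) ξ := by
  rw [hA.frob_app, hA.frob_app]
  have h (f : Fin n → Fin n → Fin n → Fin n → ℝ) :
      ∑ i, ∑ j, ∑ k, ∑ l, f i j k l = ∑ k, ∑ l, ∑ i, ∑ j, f i j k l := by
    have h1 : ∑ i, ∑ j, ∑ k, ∑ l, f i j k l
        = ∑ p : Fin n × Fin n, ∑ q : Fin n × Fin n, f p.1 p.2 q.1 q.2 := by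
      simp only [Fintype.sum_prod_type]
    rw [h1, Finset.sum_comm]
    simp only [Fintype.sum_prod_type]
  rw [h]
  refine Finset.sum_congr rfl fun i _ => Finset.sum_congr rfl fun j _ =>
    Finset.sum_congr rfl fun k _ => Finset.sum_congr rfl fun l _ => ?_
  rw [hA.major]
  ring

theorem frob_app_sub (hA : IsElasticityTensor A) (ξ ζ : Mat n) :
    frob (A.app (ξ - ζ)) (ξ - ζ)
      = frob (A.app ξ) ξ - 2 * frob (A.app ζ) ξ + frob (A.app ζ) ζ := by
  have h1 : frob (A.app (ξ - ζ)) (ξ - ζ) = frob (A.app ξ) ξ - frob (A.app ξ) ζ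
      - (frob (A.app ζ) ξ - frob (A.app ζ) ζ) := by
    simp only [frob, A.app_sub, sub_mul, mul_sub, Matrix.trace_sub]
    ring
  rw [h1, hA.frob_app_comm ξ ζ]
  ring

theorem frob_app_self_nonneg (hA : IsElasticityTensor A) {ξ : Mat n} (h : ξ.IsSymm) :
    0 ≤ frob (A.app ξ) ξ := by
  obtain ⟨c, _, hc, _, H⟩ := hA.growth
  exact (mul_nonneg hc.le (frob_self_nonneg h)).trans (H ξ h).1

/-- Nonnegativity of the form at `ξ - ζ`: the quadratic energy lies above its tangents, which makes
it a supremum of affine functions of the strain. -/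
theorem le_frob_app_self (hA : IsElasticityTensor A) {ξ ζ : Mat n} (h : ξ.IsSymm)
    (h' : ζ.IsSymm) :
    2 * frob (A.app ζ) ξ - frob (A.app ζ) ζ ≤ frob (A.app ξ) ξ := by
  have := hA.frob_app_self_nonneg (h.sub h')
  rw [hA.frob_app_sub] at this
  linarith

end IsElasticityTensor

end ElasticityTensors

/-! ### Integrability and consequences of an energy bound. -/

section EnergyBounds

variable {n : ℕ} {Ω : Set (Space n)}

theorem sq_integral_mul_le_mul {f g : Space n → ℝ} (hf : MemLp f 2 (volume.restrict Ω))
    (hg : MemLp g 2 (volume.restrict Ω)) :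
    (∫ x in Ω, f x * g x) ^ 2 ≤ (∫ x in Ω, f x ^ 2) * ∫ x in Ω, g x ^ 2 := by
  rw [← inner_toLp hf hg, ← norm_toLp_sq hf, ← norm_toLp_sq hg, ← mul_pow, ← sq_abs]
  gcongr
  exact abs_real_inner_le_norm _ _

theorem integral_le_of_lintegral_ofReal_le {f : Space n → ℝ}
    (hf : 0 ≤ᵐ[volume.restrict Ω] f) {b : ℝ≥0}
    (h : ∫⁻ x in Ω, ENNReal.ofReal (f x) ≤ b) : ∫ x in Ω, f x ≤ b := by
  by_cases hi : Integrable f (volume.restrict Ω)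
  · rw [integral_eq_lintegral_of_nonneg_ae hf hi.1]
    exact ENNReal.toReal_le_coe_of_le_coe h
  -- A non-integrable function has integral 0 by convention.
  · rw [integral_undef hi]
    exact b.2

theorem integrable_frob_app (A : Tensor4 n) {e e' : Space n → Mat n}
    (he : ∀ i j, MemLp (fun x => e x i j) 2 (volume.restrict Ω))
    (he' : ∀ i j, MemLp (fun x => e' x i j) 2 (volume.restrict Ω)) :
    IntegrableOn (fun x => frob (A.app (e x)) (e' x)) Ω := by
  have h (x : Space n) : frob (A.app (e x)) (e' x)
      = ∑ i, ∑ j, (∑ k, ∑ l, A i j k l * e x k l) * e' x j i := by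
    simp [frob_eq_sum, Tensor4.app]
  simp only [h]
  refine integrable_finsetSum _ fun i _ => integrable_finsetSum _ fun j _ => ?_
  refine MemLp.integrable_mul (p := 2) (q := 2) ?_ (he' j i)
  exact memLp_finsetSum _ fun k _ => memLp_finsetSum _ fun l _ => (he k l).const_mul _

theorem memLp_mul_of_zero_or_one {χ f : Space n → ℝ}
    (hχ : AEStronglyMeasurable χ (volume.restrict Ω))
    (h01 : ∀ᵐ x ∂(volume.restrict Ω), χ x = 0 ∨ χ x = 1)
    (hf : MemLp f 2 (volume.restrict Ω)) : MemLp (fun x => χ x * f x) 2 (volume.restrict Ω) := by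
  refine hf.mono (hχ.mul hf.1) ?_
  filter_upwards [h01] with x hx
  rcases hx with hx | hx <;> simp [hx]

end EnergyBounds

section Strain

variable {n : ℕ} {Ω : Set (Space n)} {u : Space n → Space n}

/-- The distributional strain `(∂ⱼuᵢ + ∂ᵢuⱼ) / 2`, tested against `φ`. -/
def strainPairing (Ω : Set (Space n)) (u : Space n → Space n) (i j : Fin n)
    (φ : Space n → ℝ) : ℝ :=
  -((1 / 2) * ∫ x in Ω, (u x i * partialDeriv φ j x + u x j * partialDeriv φ i x))

theorem isWeakGradient_weakGradient (hu : MemH1 Ω u) : IsWeakGradient Ω u (weakGradient Ω u) := by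
  rw [weakGradient, dif_pos hu.2]
  exact hu.2.choose_spec

theorem isSymm_strain (x : Space n) : (strain Ω u x).IsSymm := by
  ext i j
  simp [strain]
  ring

theorem memLp_strain (hu : MemH1 Ω u) (i j : Fin n) :
    MemLp (fun x => strain Ω u x i j) 2 (volume.restrict Ω) := by
  have h := (isWeakGradient_weakGradient hu).memLp
  simpa [strain] using ((h i j).add (h j i)).const_mul (1 / 2 : ℝ)

theorem IsTestFunction.integrableOn_mul_partialDeriv {φ : Space n → ℝ} (hφ : IsTestFunction Ω φ)
    (hu : IntegrableOn u Ω) (i j : Fin n) :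
    IntegrableOn (fun x => u x i * BrittleDamage.partialDeriv φ j x) Ω := by
  obtain ⟨B, hB⟩ := (continuous_partialDeriv hφ.smooth j).bounded_above_of_compact_support
    (hasCompactSupport_partialDeriv hφ.compact j)
  exact (Integrable.eval_piLp hu i).mul_bdd
    (continuous_partialDeriv hφ.smooth j).aestronglyMeasurable (ae_of_all _ hB)

theorem strainPairing_eq (hu : MemH1 Ω u) (hi : IntegrableOn u Ω) {φ : Space n → ℝ}
    (hφ : IsTestFunction Ω φ) (i j : Fin n) :
    strainPairing Ω u i j φ = ∫ x in Ω, strain Ω u x i j * φ x := by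
  have h := isWeakGradient_weakGradient hu
  have h1 (i j : Fin n) : IntegrableOn (fun x => weakGradient Ω u x i j * φ x) Ω :=
    MemLp.integrable_mul (p := 2) (q := 2) (h.memLp i j) (hφ.memLp 2)
  have h2 (x : Space n) : strain Ω u x i j * φ x
      = 1 / 2 * (weakGradient Ω u x i j * φ x + weakGradient Ω u x j i * φ x) := by
    simp [strain]
    ring
  simp only [h2]
  rw [strainPairing, integral_add (hφ.integrableOn_mul_partialDeriv hi i j)
    (hφ.integrableOn_mul_partialDeriv hi j i), integral_const_mul, integral_add (h1 i j) (h1 j i),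
    h.integral_eq φ hφ, h.integral_eq φ hφ]
  ring

theorem hasL2Strain_of_strainPairing {E : Fin n → Fin n → Space n → ℝ}
    (hE : ∀ i j, MemLp (E i j) 2 (volume.restrict Ω))
    (h : ∀ i j φ, IsTestFunction Ω φ → strainPairing Ω u i j φ = ∫ x in Ω, E i j x * φ x) :
    HasL2Strain Ω u :=
  ⟨fun x => Matrix.of fun i j => E i j x, hE, fun φ hφ i j => neg_eq_iff_eq_neg.1 (h i j φ hφ)⟩

end Strain

section DamageBounds

variable {n : ℕ} {Ω : Set (Space n)}

/-- The bounds on an admissible pair `(u, χ)` following from a bound `b` on its energy. -/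
structure DamageBounds (Ω : Set (Space n)) (As : Tensor4 n) (κ c η ε : ℝ) (b : ℝ≥0)
    (u : Space n → Space n) (χ : Space n → ℝ) : Prop where
  memH1 : MemH1 Ω u
  zero_or_one : ∀ᵐ x ∂(volume.restrict Ω), χ x = 0 ∨ χ x = 1
  integral_le : κ / ε * ∫ x in Ω, χ x ≤ b
  weak_le : ∀ i j, c * η * ∫ x in Ω, (χ x * strain Ω u x i j) ^ 2 ≤ b
  strong_le : ∀ i j, c * ∫ x in Ω, ((1 - χ x) * strain Ω u x i j) ^ 2 ≤ b
  elastic_le : ∫ x in Ω, 1 / 2 * ((1 - χ x) * frob (As.app (strain Ω u x)) (strain Ω u x)) ≤ b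

/-- In each phase the coercivity of the corresponding tensor is used. The constant depends only on
the two tensors, so it survives the limit in `ε`. -/
theorem exists_damageBounds (Ω : Set (Space n)) {Aw As : Tensor4 n} (hAw : IsElasticityTensor Aw)
    (hAs : IsElasticityTensor As) : ∃ c > 0, ∀ (κ η ε : ℝ), 0 < κ → 0 < η → 0 < ε →
    ∀ (b : ℝ≥0) u χ, MemH1 Ω u → (∀ᵐ x ∂(volume.restrict Ω), χ x = 0 ∨ χ x = 1) →
    damageEnergy Ω Aw As κ η ε u χ ≤ b → DamageBounds Ω As κ c η ε b u χ := by
  obtain ⟨cw, _, hcw, _, hw⟩ := hAw.growth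
  obtain ⟨cs, _, hcs, _, hs⟩ := hAs.growth
  -- The half accounts for the factor `1 / 2` in the energy.
  let c := min cw cs / 2
  have hc : 0 < c := half_pos (lt_min hcw hcs)
  have hcw' : 2 * c ≤ cw := by simp only [c]; linarith [min_le_left cw cs]
  have hcs' : 2 * c ≤ cs := by simp only [c]; linarith [min_le_right cw cs]
  refine ⟨c, hc, fun κ η ε hκ hη hε b u χ hu h01 hb => ?_⟩
  have hb1 := le_self_add.trans hb
  have hb2 := le_add_self.trans hb
  have key (f : Space n → ℝ) (hf : ∀ᵐ x ∂(volume.restrict Ω), 0 ≤ f x ∧ f x ≤ 1 / 2 *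
      (η * χ x * frob (Aw.app (strain Ω u x)) (strain Ω u x)
        + (1 - χ x) * frob (As.app (strain Ω u x)) (strain Ω u x))) : ∫ x in Ω, f x ≤ b := by
    refine integral_le_of_lintegral_ofReal_le (hf.mono fun x hx => hx.1) (le_trans ?_ hb1)
    exact lintegral_mono_ae (hf.mono fun x hx => ENNReal.ofReal_le_ofReal hx.2)
  have hgw (x : Space n) (i j : Fin n) : 2 * (c * strain Ω u x i j ^ 2)
      ≤ frob (Aw.app (strain Ω u x)) (strain Ω u x) := by
    have h1 := (hw _ (isSymm_strain (Ω := Ω) (u := u) x)).1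
    have h2 := sq_le_frob_self (isSymm_strain (Ω := Ω) (u := u) x) i j
    have h3 := frob_self_nonneg (isSymm_strain (Ω := Ω) (u := u) x)
    nlinarith
  have hgs (x : Space n) (i j : Fin n) : 2 * (c * strain Ω u x i j ^ 2)
      ≤ frob (As.app (strain Ω u x)) (strain Ω u x) := by
    have h1 := (hs _ (isSymm_strain (Ω := Ω) (u := u) x)).1
    have h2 := sq_le_frob_self (isSymm_strain (Ω := Ω) (u := u) x) i j
    have h3 := frob_self_nonneg (isSymm_strain (Ω := Ω) (u := u) x)
    nlinarith
  refine ⟨hu, h01, ?_, fun i j => ?_, fun i j => ?_, ?_⟩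
  · rw [← integral_const_mul]
    refine integral_le_of_lintegral_ofReal_le ?_ ?_
    · filter_upwards [h01] with x hx
      have : 0 ≤ χ x := by rcases hx with h | h <;> simp [h]
      change 0 ≤ κ / ε * χ x
      positivity
    · simp only [ENNReal.ofReal_mul (div_pos hκ hε).le]
      rwa [lintegral_const_mul' _ _ ENNReal.ofReal_ne_top]
  · rw [← integral_const_mul]
    refine key _ ?_
    filter_upwards [h01] with x hx
    refine ⟨by positivity, ?_⟩
    rcases hx with h | h
    · have := hAs.frob_app_self_nonneg (isSymm_strain (Ω := Ω) (u := u) x)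
      simp [h, this]
    · have := mul_le_mul_of_nonneg_left (hgw x i j) hη.le
      rw [h]
      linarith
  · rw [← integral_const_mul]
    refine key _ ?_
    filter_upwards [h01] with x hx
    refine ⟨by positivity, ?_⟩
    rcases hx with h | h
    · have := hgs x i j
      rw [h]
      linarith
    · have := hAw.frob_app_self_nonneg (isSymm_strain (Ω := Ω) (u := u) x)
      rw [h]
      simp only [sub_self, zero_mul, ne_eq, OfNat.ofNat_ne_zero, not_false_eq_true, zero_pow,
        mul_zero, add_zero]
      positivity
  · refine key _ ?_
    filter_upwards [h01] with x hx
    have h1 := hAs.frob_app_self_nonneg (isSymm_strain (Ω := Ω) (u := u) x)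
    have h2 := hAw.frob_app_self_nonneg (isSymm_strain (Ω := Ω) (u := u) x)
    rcases hx with h | h
    · simp [h, h1]
    · rw [h]
      simp only [sub_self, zero_mul, mul_zero, add_zero, le_refl, true_and]
      positivity

namespace DamageBounds

variable {As : Tensor4 n} {κ c η ε : ℝ} {b : ℝ≥0} {u : Space n → Space n} {χ : Space n → ℝ}

theorem memLp_weak (H : DamageBounds Ω As κ c η ε b u χ)
    (hχ : AEStronglyMeasurable χ (volume.restrict Ω)) (i j : Fin n) :
    MemLp (fun x => χ x * strain Ω u x i j) 2 (volume.restrict Ω) :=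
  memLp_mul_of_zero_or_one hχ H.zero_or_one (memLp_strain H.memH1 i j)

theorem memLp_strong (H : DamageBounds Ω As κ c η ε b u χ)
    (hχ : AEStronglyMeasurable χ (volume.restrict Ω)) (i j : Fin n) :
    MemLp (fun x => (1 - χ x) * strain Ω u x i j) 2 (volume.restrict Ω) :=
  memLp_mul_of_zero_or_one (aestronglyMeasurable_const.sub hχ)
    (H.zero_or_one.mono fun x hx => by rcases hx with h | h <;> simp [h])
    (memLp_strain H.memH1 i j)

/-- The strain in the damaged region is small in the sense of distributions. -/
theorem sq_integral_weak_le (H : DamageBounds Ω As κ c η ε b u χ) (hκ : 0 < κ) (hc : 0 < c)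
    (hη : 0 < η) (hε : 0 < ε) (hχ : Integrable χ (volume.restrict Ω)) {φ : Space n → ℝ}
    (hφ : IsTestFunction Ω φ) {B : ℝ} (hB : ∀ x, ‖φ x‖ ≤ B) (i j : Fin n) :
    (∫ x in Ω, χ x * strain Ω u x i j * φ x) ^ 2 ≤ B ^ 2 * b ^ 2 / (κ * c) * (η / ε)⁻¹ := by
  -- Since `χ = χ ^ 2`, one factor `χ` goes to `φ`, giving the small volume `b * ε / κ`, and the
  -- other to the strain, giving `b / (c * η)`.
  have h1 : ∫ x in Ω, χ x * strain Ω u x i j * φ x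
      = ∫ x in Ω, (χ x * φ x) * (χ x * strain Ω u x i j) := by
    refine integral_congr_ae (H.zero_or_one.mono fun x hx => ?_)
    rcases hx with h | h <;> simp [h, mul_comm]
  have h2 := sq_integral_mul_le_mul
    (memLp_mul_of_zero_or_one hχ.1 H.zero_or_one (hφ.memLp 2)) (H.memLp_weak hχ.1 i j)
  have h3 : ∫ x in Ω, (χ x * φ x) ^ 2 ≤ B ^ 2 * (b * ε / κ) := by
    calc ∫ x in Ω, (χ x * φ x) ^ 2 ≤ ∫ x in Ω, B ^ 2 * χ x := by
          refine integral_mono_of_nonneg (ae_of_all _ fun x => sq_nonneg _) (hχ.const_mul _) ?_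
          filter_upwards [H.zero_or_one] with x hx
          rcases hx with h | h
          · simp [h]
          · have := pow_le_pow_left₀ (norm_nonneg _) (hB x) 2
            rw [Real.norm_eq_abs, sq_abs] at this
            simpa [h] using this
      _ = B ^ 2 * ∫ x in Ω, χ x := integral_const_mul _ _
      _ ≤ _ := by
          have := H.integral_le
          gcongr
          rw [le_div_iff₀ hκ]
          rw [div_mul_eq_mul_div, div_le_iff₀ hε] at this
          linarith
  have h4 : ∫ x in Ω, (χ x * strain Ω u x i j) ^ 2 ≤ b / (c * η) := by
    rw [le_div_iff₀ (by positivity)]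
    linarith [H.weak_le i j]
  rw [h1]
  refine h2.trans ((mul_le_mul h3 h4 (integral_nonneg fun x => sq_nonneg _)
    (by positivity)).trans_eq ?_)
  field_simp

theorem sq_integral_strong_le (H : DamageBounds Ω As κ c η ε b u χ) (hc : 0 < c)
    (hχ : AEStronglyMeasurable χ (volume.restrict Ω)) {φ : Space n → ℝ}
    (hφ : IsTestFunction Ω φ) (i j : Fin n) :
    (∫ x in Ω, (1 - χ x) * strain Ω u x i j * φ x) ^ 2 ≤ b / c * ∫ x in Ω, φ x ^ 2 := by
  refine (sq_integral_mul_le_mul (H.memLp_strong hχ i j) (hφ.memLp 2)).trans ?_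
  refine mul_le_mul_of_nonneg_right ?_ (integral_nonneg fun x => sq_nonneg _)
  rw [le_div_iff₀ hc]
  linarith [H.strong_le i j]

/-- Convexity of the elastic energy density, integrated. -/
theorem integral_sub_le (H : DamageBounds Ω As κ c η ε b u χ) (hAs : IsElasticityTensor As)
    (hχ : AEStronglyMeasurable χ (volume.restrict Ω)) {Ψ : Space n → Mat n}
    (hΨ : ∀ i j, MemLp (fun x => Ψ x i j) 2 (volume.restrict Ω)) (hΨs : ∀ x, (Ψ x).IsSymm) :
    (∑ i, ∑ j, ∫ x in Ω, (1 - χ x) * strain Ω u x j i * As.app (Ψ x) i j)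
      - 1 / 2 * ∫ x in Ω, frob (As.app (Ψ x)) (Ψ x) ≤ b := by
  have hτ (i j : Fin n) : MemLp (fun x => As.app (Ψ x) i j) 2 (volume.restrict Ω) := by
    simp only [Tensor4.app, Matrix.of_apply]
    exact memLp_finsetSum _ fun k _ => memLp_finsetSum _ fun l _ => (hΨ k l).const_mul _
  have h1 (i j : Fin n) : Integrable (fun x => (1 - χ x) * strain Ω u x j i * As.app (Ψ x) i j)
      (volume.restrict Ω) :=
    MemLp.integrable_mul (p := 2) (q := 2) (H.memLp_strong hχ j i) (hτ i j)
  have h2 := integrable_frob_app As hΨ hΨ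
  have h3 : Integrable (fun x => ∑ i, ∑ j, (1 - χ x) * strain Ω u x j i * As.app (Ψ x) i j)
      (volume.restrict Ω) :=
    integrable_finsetSum _ fun i _ => integrable_finsetSum _ fun j _ => h1 i j
  have h4 : Integrable (fun x => 1 / 2 * ((1 - χ x) *
      frob (As.app (strain Ω u x)) (strain Ω u x))) (volume.restrict Ω) := by
    refine Integrable.const_mul ?_ _
    refine (integrable_frob_app As (memLp_strain H.memH1) (memLp_strain H.memH1)).bdd_mul
      (c := 1) (aestronglyMeasurable_const.sub hχ) (H.zero_or_one.mono fun x hx => ?_)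
    rcases hx with h | h <;> simp [h]
  refine le_trans (le_of_eq ?_) ((integral_mono_ae (h3.sub (h2.const_mul (1 / 2))) h4 ?_).trans
    H.elastic_le)
  · rw [integral_sub' h3 (h2.const_mul (1 / 2)), integral_const_mul,
      integral_finsetSum _ fun i _ => integrable_finsetSum _ fun j _ => h1 i j]
    congr 1
    exact Finset.sum_congr rfl fun i _ => (integral_finsetSum _ fun j _ => h1 i j).symm
  · filter_upwards [H.zero_or_one] with x hx
    change (∑ i, ∑ j, (1 - χ x) * strain Ω u x j i * As.app (Ψ x) i j)
      - 1 / 2 * frob (As.app (Ψ x)) (Ψ x) ≤ _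
    have e : (∑ i, ∑ j, (1 - χ x) * strain Ω u x j i * As.app (Ψ x) i j)
        = (1 - χ x) * frob (As.app (Ψ x)) (strain Ω u x) := by
      rw [frob_eq_sum]
      simp only [Finset.mul_sum]
      refine Finset.sum_congr rfl fun i _ => Finset.sum_congr rfl fun j _ => ?_
      ring
    rw [e]
    rcases hx with h | h
    · have := hAs.le_frob_app_self (isSymm_strain (Ω := Ω) (u := u) x) (hΨs x)
      rw [h]
      linarith
    -- On the damaged set the right-hand side is zero and the left-hand side is nonpositive.
    · have := hAs.frob_app_self_nonneg (hΨs x)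
      rw [h]
      linarith

end DamageBounds

end DamageBounds

/-! ### Compactness of families with bounded energy. -/

section Compactness

variable {n : ℕ} {Ω : Set (Space n)}

theorem integrableOn_fst (p : StateSpace Ω) : IntegrableOn p.1 Ω := L1.integrable_coeFn p.1

theorem integrableOn_snd (p : StateSpace Ω) : IntegrableOn p.2 Ω := L1.integrable_coeFn p.2

variable {l : Filter ℝ} {y : ℝ → StateSpace Ω} {p : StateSpace Ω}

theorem tendsto_setIntegral_fst_mul (hy : Tendsto y l (𝓝 p)) {g : Space n → ℝ}
    (hg : Continuous g) {B : ℝ} (hB : ∀ x, ‖g x‖ ≤ B) (i : Fin n) :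
    Tendsto (fun ε => ∫ x in Ω, (y ε).1 x i * g x) l (𝓝 (∫ x in Ω, p.1 x i * g x)) := by
  have hi (q : StateSpace Ω) : IntegrableOn (fun x => q.1 x i * g x) Ω :=
    (Integrable.eval_piLp (integrableOn_fst q) i).mul_bdd hg.aestronglyMeasurable
      (ae_of_all _ hB)
  refine tendsto_integral_of_L1 _ (hi p).1 (Eventually.of_forall fun ε => hi (y ε)) ?_
  have h1 : Tendsto (fun ε => edist (y ε).1 p.1) l (𝓝 0) :=
    tendsto_iff_edist_tendsto_0.1 ((continuous_fst.tendsto p).comp hy)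
  have h2 : Tendsto (fun ε => edist (y ε).1 p.1 * ENNReal.ofReal B) l (𝓝 0) := by
    simpa using ENNReal.Tendsto.mul_const h1 (Or.inr ENNReal.ofReal_ne_top)
  refine tendsto_of_tendsto_of_tendsto_of_le_of_le tendsto_const_nhds h2 (fun _ => zero_le)
    fun ε => ?_
  dsimp only
  rw [Lp.edist_def, eLpNorm_one_eq_lintegral_enorm,
    ← lintegral_mul_const' _ _ ENNReal.ofReal_ne_top]
  refine lintegral_mono fun x => ?_
  rw [← sub_mul, enorm_mul]
  refine mul_le_mul' ?_ ?_
  · exact PiLp.enorm_apply_le ((y ε).1 x - p.1 x) i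
  · rw [← ofReal_norm]
    exact ENNReal.ofReal_le_ofReal (hB x)

theorem tendsto_strainPairing (hy : Tendsto y l (𝓝 p)) {φ : Space n → ℝ}
    (hφ : IsTestFunction Ω φ) (i j : Fin n) :
    Tendsto (fun ε => strainPairing Ω (y ε).1 i j φ) l (𝓝 (strainPairing Ω p.1 i j φ)) := by
  have hB (j : Fin n) := (continuous_partialDeriv hφ.smooth j).bounded_above_of_compact_support
    (hasCompactSupport_partialDeriv hφ.compact j)
  have h (q : StateSpace Ω) : strainPairing Ω q.1 i j φ
      = -(1 / 2 * ((∫ x in Ω, q.1 x i * partialDeriv φ j x)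
        + ∫ x in Ω, q.1 x j * partialDeriv φ i x)) := by
    rw [strainPairing, integral_add (hφ.integrableOn_mul_partialDeriv (integrableOn_fst q) i j)
      (hφ.integrableOn_mul_partialDeriv (integrableOn_fst q) j i)]
  simp only [h]
  obtain ⟨B, hB1⟩ := hB j
  obtain ⟨B', hB2⟩ := hB i
  exact (((tendsto_setIntegral_fst_mul hy (continuous_partialDeriv hφ.smooth j) hB1 i).add
    (tendsto_setIntegral_fst_mul hy (continuous_partialDeriv hφ.smooth i) hB2 j)).const_mul _).neg

theorem tendsto_zero_of_sq_le {f g : ℝ → ℝ} (h : ∀ᶠ ε in l, f ε ^ 2 ≤ g ε)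
    (hg : Tendsto g l (𝓝 0)) : Tendsto f l (𝓝 0) := by
  refine squeeze_zero_norm' (a := fun ε => √(g ε)) (h.mono fun ε h => Real.abs_le_sqrt h) ?_
  have h := (Real.continuous_sqrt.tendsto 0).comp hg
  rw [Real.sqrt_zero] at h
  exact h

variable {As : Tensor4 n} {κ c : ℝ} {η : ℝ → ℝ} {b : ℝ≥0}

/-- The energy bound gives `‖χ‖₁ ≤ b ε / κ`, and the norm passes to the `L¹` limit. -/
theorem ae_eq_zero_of_damageBounds [l.NeBot] (hl : l ≤ 𝓝[>] 0) (hy : Tendsto y l (𝓝 p))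
    (hκ : 0 < κ)
    (H : ∀ᶠ ε in l, DamageBounds Ω As κ c (η ε) ε b (y ε).1 (y ε).2) :
    ∀ᵐ x ∂(volume.restrict Ω), p.2 x = 0 := by
  have hpos : ∀ᶠ ε in l, (0 : ℝ) < ε := hl self_mem_nhdsWithin
  have hzero : Tendsto (fun ε : ℝ => ε) l (𝓝 0) := tendsto_id.mono_left (hl.trans inf_le_left)
  have h1 : Tendsto (fun ε => ‖(y ε).2‖) l (𝓝 ‖p.2‖) :=
    ((continuous_snd.tendsto p).comp hy).norm
  have h2 : Tendsto (fun ε => ‖(y ε).2‖) l (𝓝 0) := by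
    have h3 : Tendsto (fun ε : ℝ => b / κ * ε) l (𝓝 0) := by simpa using hzero.const_mul (b / κ : ℝ)
    refine squeeze_zero' (Eventually.of_forall fun ε => norm_nonneg _) ?_ h3
    filter_upwards [H, hpos] with ε h hε
    have h4 := h.integral_le
    rw [L1.norm_eq_integral_norm]
    have h5 : ∫ x in Ω, ‖(y ε).2 x‖ = ∫ x in Ω, (y ε).2 x := by
      refine integral_congr_ae (h.zero_or_one.mono fun x hx => ?_)
      rcases hx with hx | hx <;> simp [hx]
    rw [h5]
    rw [div_mul_eq_mul_div, div_le_iff₀ hε] at h4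
    rw [div_mul_eq_mul_div, le_div_iff₀ hκ]
    linarith
  have h0 : p.2 = 0 := norm_eq_zero.1 (tendsto_nhds_unique h1 h2)
  rw [h0]
  exact Lp.coeFn_zero ℝ 1 (volume.restrict Ω)

/-- The full strain converges in distributions because `u` converges in `L¹`. The damaged part drops
out since its squared pairing is of order `ε / η`: here `η ε / ε → ∞` is decisive. -/
theorem tendsto_integral_strong (hl : l ≤ 𝓝[>] 0) (hy : Tendsto y l (𝓝 p)) (hκ : 0 < κ)
    (hc : 0 < c) (hη : ∀ ε, 0 < ε → 0 < η ε) (hα : Tendsto (fun ε => η ε / ε) (𝓝[>] 0) atTop)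
    (H : ∀ᶠ ε in l, DamageBounds Ω As κ c (η ε) ε b (y ε).1 (y ε).2) {φ : Space n → ℝ}
    (hφ : IsTestFunction Ω φ) (i j : Fin n) :
    Tendsto (fun ε => ∫ x in Ω, (1 - (y ε).2 x) * strain Ω (y ε).1 x i j * φ x) l
      (𝓝 (strainPairing Ω p.1 i j φ)) := by
  have hpos : ∀ᶠ ε in l, (0 : ℝ) < ε := hl self_mem_nhdsWithin
  obtain ⟨B, hB⟩ := hφ.continuous.bounded_above_of_compact_support hφ.compact
  have hweak : Tendsto (fun ε => ∫ x in Ω, (y ε).2 x * strain Ω (y ε).1 x i j * φ x) l (𝓝 0) := by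
    have h1 : Tendsto (fun ε => B ^ 2 * b ^ 2 / (κ * c) * (η ε / ε)⁻¹) l (𝓝 0) := by
      simpa using (hα.mono_left hl).inv_tendsto_atTop.const_mul (B ^ 2 * b ^ 2 / (κ * c))
    refine tendsto_zero_of_sq_le ?_ h1
    filter_upwards [H, hpos] with ε h hε
    exact h.sq_integral_weak_le hκ hc (hη ε hε) hε (integrableOn_snd (y ε)) hφ hB i j
  have h2 := (tendsto_strainPairing hy hφ i j).sub hweak
  rw [sub_zero] at h2
  refine h2.congr' ?_
  filter_upwards [H] with ε h
  have hφ2 := hφ.memLp 2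
  have i1 : IntegrableOn (fun x => strain Ω (y ε).1 x i j * φ x) Ω :=
    MemLp.integrable_mul (p := 2) (q := 2) (memLp_strain h.memH1 i j) hφ2
  have i2 : IntegrableOn (fun x => (y ε).2 x * strain Ω (y ε).1 x i j * φ x) Ω :=
    MemLp.integrable_mul (p := 2) (q := 2) (h.memLp_weak (integrableOn_snd (y ε)).1 i j) hφ2
  rw [strainPairing_eq h.memH1 (integrableOn_fst (y ε)) hφ, ← integral_sub i1 i2]
  refine integral_congr_ae (ae_of_all _ fun x => ?_)
  ring

/-- The pairings with the sound strain are linear and uniformly bounded in the `L²` norm of the test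
function; both properties pass to the limit, and Riesz representation applies. -/
theorem exists_strain_of_damageBounds [l.NeBot] (hΩ : IsOpen Ω) (hb : Bornology.IsBounded Ω)
    (hl : l ≤ 𝓝[>] 0) (hy : Tendsto y l (𝓝 p)) (hκ : 0 < κ)
    (hc : 0 < c) (hη : ∀ ε, 0 < ε → 0 < η ε) (hα : Tendsto (fun ε => η ε / ε) (𝓝[>] 0) atTop)
    (H : ∀ᶠ ε in l, DamageBounds Ω As κ c (η ε) ε b (y ε).1 (y ε).2) :
    HasL2Strain Ω p.1 := by
  have key (i j : Fin n) : ∃ g, MemLp g 2 (volume.restrict Ω) ∧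
      ∀ φ, IsTestFunction Ω φ → strainPairing Ω p.1 i j φ = ∫ x in Ω, g x * φ x := by
    have hlim (φ) (hφ : IsTestFunction Ω φ) := tendsto_integral_strong hl hy hκ hc hη hα H hφ i j
    have hint (φ) (hφ : IsTestFunction Ω φ) : ∀ᶠ ε in l, IntegrableOn
        (fun x => (1 - (y ε).2 x) * strain Ω (y ε).1 x i j * φ x) Ω := by
      filter_upwards [H] with ε h
      exact MemLp.integrable_mul (p := 2) (q := 2)
        (h.memLp_strong (integrableOn_snd (y ε)).1 i j) (hφ.memLp 2)
    refine exists_memLp_of_bounded hΩ hb _ ?_ ?_ (b / c) ?_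
    · intro φ ψ hφ hψ
      refine tendsto_nhds_unique (hlim _ (hφ.add hψ))
        (((hlim φ hφ).add (hlim ψ hψ)).congr' ?_)
      filter_upwards [hint φ hφ, hint ψ hψ] with ε h1 h2
      rw [← integral_add h1 h2]
      simp only [Pi.add_apply, mul_add]
    · intro a φ hφ
      refine tendsto_nhds_unique (hlim _ (hφ.smul a)) (((hlim φ hφ).const_mul a).congr fun ε => ?_)
      rw [← integral_const_mul]
      simp only [Pi.smul_apply, smul_eq_mul, mul_left_comm]
    · intro φ hφ
      refine le_of_tendsto ((hlim φ hφ).pow 2) (H.mono fun ε h => ?_)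
      exact h.sq_integral_strong_le hc (integrableOn_snd (y ε)).1 hφ i j
  choose E hE h using key
  exact hasL2Strain_of_strainPairing hE h

end Compactness

/-! ### Lower semicontinuity of the elastic energy. -/

section LowerSemicontinuity

variable {n : ℕ} {Ω : Set (Space n)} {A : Tensor4 n}

theorem isTestFunction_sum {ι : Type*} (s : Finset ι) {φ : ι → Space n → ℝ}
    (h : ∀ i ∈ s, IsTestFunction Ω (φ i)) : IsTestFunction Ω fun x => ∑ i ∈ s, φ i x := by
  have := Submodule.sum_mem (testFunctions Ω) h
  rwa [← Finset.sum_fn]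

theorem isTestFunction_app (A : Tensor4 n) {ψ : Fin n → Fin n → Space n → ℝ}
    (hψ : ∀ i j, IsTestFunction Ω (ψ i j)) (i j : Fin n) :
    IsTestFunction Ω fun x => A.app (Matrix.of fun i j => ψ i j x) i j := by
  simp only [Tensor4.app, Matrix.of_apply]
  exact isTestFunction_sum _ fun k _ => isTestFunction_sum _ fun l _ => (hψ k l).smul _

/-- A field of symmetric matrices in `L²` is approximated by symmetric test fields. -/
theorem exists_symm_approx (hΩ : IsOpen Ω) (hb : Bornology.IsBounded Ω) {E : Space n → Mat n}
    (hE : ∀ i j, MemLp (fun x => E x i j) 2 (volume.restrict Ω)) (hs : ∀ x, (E x).IsSymm)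
    {δ : ℝ} (hδ : 0 < δ) :
    ∃ ψ : Fin n → Fin n → Space n → ℝ, (∀ i j, IsTestFunction Ω (ψ i j)) ∧
      (∀ i j, ψ i j = ψ j i) ∧ ∀ i j, ∫ x in Ω, (E x i j - ψ i j x) ^ 2 < δ := by
  choose φ hφ h using fun i j => exists_testFunction_approx hΩ hb (hE i j) hδ
  -- Choosing one approximant for each unordered pair of indices makes the field symmetric without
  -- averaging.
  refine ⟨fun i j => φ (min i j) (max i j), fun i j => hφ _ _,
    fun i j => congrArg₂ φ (min_comm i j) (max_comm i j), fun i j => ?_⟩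
  have e (x : Space n) : E x i j = E x (min i j) (max i j) := by
    rcases le_total i j with hij | hij
    · rw [min_eq_left hij, max_eq_right hij]
    · rw [min_eq_right hij, max_eq_left hij, (hs x).apply]
  simp only [e]
  exact h _ _

/-- The elastic energy as a supremum over smooth test fields. -/
theorem integral_frob_le_of_forall (hA : IsElasticityTensor A) (hΩ : IsOpen Ω)
    (hb : Bornology.IsBounded Ω) {E : Space n → Mat n}
    (hE : ∀ i j, MemLp (fun x => E x i j) 2 (volume.restrict Ω)) (hs : ∀ x, (E x).IsSymm) {b : ℝ}
    (h : ∀ ψ : Fin n → Fin n → Space n → ℝ, (∀ i j, IsTestFunction Ω (ψ i j)) →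
      (∀ i j, ψ i j = ψ j i) →
      (∫ x in Ω, frob (A.app (Matrix.of fun i j => ψ i j x)) (E x))
        - 1 / 2 * ∫ x in Ω, frob (A.app (Matrix.of fun i j => ψ i j x))
          (Matrix.of fun i j => ψ i j x) ≤ b) :
    1 / 2 * ∫ x in Ω, frob (A.app (E x)) (E x) ≤ b := by
  obtain ⟨_, c, _, hc, H⟩ := hA.growth
  refine le_of_forall_pos_le_add fun ε hε => ?_
  -- There are `n * n` entries, each weighted by `c`; the summand 1 keeps the denominator positive
  -- and the quotient at most 1, also for `n = 0`.
  obtain ⟨ψ, hψ, hψs, hδ⟩ := exists_symm_approx hΩ hb hE hs (δ := ε / (c * (n * n) + 1))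
    (by positivity)
  have h1 := h ψ hψ hψs
  set Ψ : Space n → Mat n := fun x => Matrix.of fun i j => ψ i j x
  have hΨ (i j : Fin n) : MemLp (fun x => Ψ x i j) 2 (volume.restrict Ω) := (hψ i j).memLp 2
  have hΨs (x : Space n) : (Ψ x).IsSymm := by
    ext i j
    exact congrFun (hψs j i) x
  have i1 := integrable_frob_app A hE hE
  have i2 := integrable_frob_app A hΨ hE
  have i3 := integrable_frob_app A hΨ hΨ
  have hD (i j : Fin n) : IntegrableOn (fun x => (E x i j - ψ i j x) ^ 2) Ω :=
    ((hE i j).sub (hΨ i j)).integrable_sq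
  -- The defect in the tangent inequality is the quadratic form at `E - Ψ`, bounded by the upper
  -- growth of the tensor.
  have h2 : ∫ x in Ω, (frob (A.app (E x)) (E x) - 2 * frob (A.app (Ψ x)) (E x)
      + frob (A.app (Ψ x)) (Ψ x)) ≤ c * ∑ i, ∑ j, ∫ x in Ω, (E x i j - ψ i j x) ^ 2 := by
    calc ∫ x in Ω, (frob (A.app (E x)) (E x) - 2 * frob (A.app (Ψ x)) (E x)
          + frob (A.app (Ψ x)) (Ψ x))
        ≤ ∫ x in Ω, c * ∑ i, ∑ j, (E x i j - ψ i j x) ^ 2 := by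
          refine integral_mono ((i1.sub (i2.const_mul 2)).add i3) (Integrable.const_mul
            (integrable_finsetSum _ fun i _ => integrable_finsetSum _ fun j _ => hD i j) c)
            fun x => ?_
          have hsub := (hs x).sub (hΨs x)
          have h3 := (H _ hsub).2
          rw [frob_self_of_isSymm hsub, hA.frob_app_sub] at h3
          exact h3
      _ = _ := by
          rw [integral_const_mul,
            integral_finsetSum _ fun i _ => integrable_finsetSum _ fun j _ => hD i j]
          congr 1
          exact Finset.sum_congr rfl fun i _ => integral_finsetSum _ fun j _ => hD i j
  have h3 : c * ∑ i, ∑ j, ∫ x in Ω, (E x i j - ψ i j x) ^ 2 ≤ ε := by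
    calc c * ∑ i, ∑ j, ∫ x in Ω, (E x i j - ψ i j x) ^ 2
        ≤ c * ∑ _i : Fin n, ∑ _j : Fin n, ε / (c * (n * n) + 1) := by
          gcongr with i _ j _
          exact (hδ i j).le
      _ = ε * (c * (n * n) / (c * (n * n) + 1)) := by
          simp
          ring
      _ ≤ ε * 1 := by
          gcongr
          rw [div_le_one (by positivity)]
          linarith
      _ = ε := mul_one ε
  have i4 : IntegrableOn (fun x => frob (A.app (E x)) (E x) - 2 * frob (A.app (Ψ x)) (E x)) Ω :=
    i1.sub (i2.const_mul 2)
  rw [integral_add i4 i3, integral_sub i1 (i2.const_mul 2), integral_const_mul] at h2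
  linarith

/-- For a fixed test field, the tangent functional of the sound strain is at most `b`, and it
converges because the tensor maps test fields to test fields. The supremum over test fields is the
elastic energy. -/
theorem elasticEnergy_le_of_damageBounds {l : Filter ℝ} {y : ℝ → StateSpace Ω}
    {p : StateSpace Ω} {As : Tensor4 n} {κ c : ℝ} {η : ℝ → ℝ} {b : ℝ≥0} [l.NeBot]
    (hΩ : IsOpen Ω) (hb : Bornology.IsBounded Ω) (hAs : IsElasticityTensor As)
    (hl : l ≤ 𝓝[>] 0) (hy : Tendsto y l (𝓝 p)) (hκ : 0 < κ)
    (hc : 0 < c) (hη : ∀ ε, 0 < ε → 0 < η ε) (hα : Tendsto (fun ε => η ε / ε) (𝓝[>] 0) atTop)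
    (H : ∀ᶠ ε in l, DamageBounds Ω As κ c (η ε) ε b (y ε).1 (y ε).2) (hp : MemH1 Ω p.1) :
    elasticEnergy Ω As p ≤ b := by
  have hmem := memLp_strain hp
  have key : 1 / 2 * ∫ x in Ω, frob (As.app (strain Ω p.1 x)) (strain Ω p.1 x) ≤ b := by
    refine integral_frob_le_of_forall hAs hΩ hb hmem isSymm_strain fun ψ hψ hψs => ?_
    have hτ := isTestFunction_app As hψ
    set Ψ : Space n → Mat n := fun x => Matrix.of fun i j => ψ i j x
    have hΨs (x : Space n) : (Ψ x).IsSymm := by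
      ext i j
      exact congrFun (hψs j i) x
    have hlim := (tendsto_finsetSum Finset.univ fun i _ => tendsto_finsetSum Finset.univ
      fun j _ => tendsto_integral_strong hl hy hκ hc hη hα H (hτ i j) j i).sub_const
        (1 / 2 * ∫ x in Ω, frob (As.app (Ψ x)) (Ψ x))
    have hle := le_of_tendsto hlim (H.mono fun ε h =>
      h.integral_sub_le hAs (integrableOn_snd (y ε)).1 (fun i j => (hψ i j).memLp 2) hΨs)
    refine le_trans (le_of_eq ?_) hle
    congr 1
    have hi (i j : Fin n) : IntegrableOn
        (fun x => As.app (Ψ x) i j * strain Ω p.1 x j i) Ω :=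
      MemLp.integrable_mul (p := 2) (q := 2) ((hτ i j).memLp 2) (hmem j i)
    simp only [frob_eq_sum]
    rw [integral_finsetSum _ fun i _ => integrable_finsetSum _ fun j _ => hi i j]
    refine Finset.sum_congr rfl fun i _ => ?_
    rw [integral_finsetSum _ fun j _ => hi i j]
    refine Finset.sum_congr rfl fun j _ => ?_
    rw [strainPairing_eq hp (integrableOn_fst p) (hτ i j)]
    simp only [mul_comm, Ψ]
  rw [elasticEnergy, if_pos ⟨ae_eq_zero_of_damageBounds hl hy hκ H, hp⟩,
    ← ofReal_integral_eq_lintegral_ofReal ((integrable_frob_app As hmem hmem).const_mul _)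
      (ae_of_all _ fun x => mul_nonneg (by norm_num) (hAs.frob_app_self_nonneg (isSymm_strain x))),
    integral_const_mul]
  exact ENNReal.ofReal_le_of_le_toReal key

end LowerSemicontinuity

/-! ### Gamma-convergence. -/

section GammaConvergence

variable {n : ℕ} {Ω : Set (Space n)} {Aw As : Tensor4 n} {κ : ℝ} {η : ℝ → ℝ}

theorem gammaLiminf_le_gammaLimsup {X : Type*} [TopologicalSpace X] (F : ℝ → X → ℝ≥0∞) (x : X) :
    gammaLiminf F x ≤ gammaLimsup F x :=
  iInf₂_mono fun _ _ => liminf_le_limsup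

/-- When the right-hand side is not infinite by definition, `χ = 0` and the two energies agree, so
no recovery sequence has to be constructed. -/
theorem extendedEnergy_le_elasticEnergy (ε : ℝ) (p : StateSpace Ω) :
    extendedEnergy Ω Aw As κ η ε p ≤ elasticEnergy Ω As p := by
  by_cases h : (∀ᵐ x ∂(volume.restrict Ω), p.2 x = 0) ∧ MemH1 Ω p.1
  · rw [extendedEnergy, if_pos ⟨h.2, h.1.mono fun x hx => Or.inl hx⟩, elasticEnergy, if_pos h,
      damageEnergy]
    have h1 : ∫⁻ x in Ω, ENNReal.ofReal (p.2 x) = 0 := by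
      rw [lintegral_congr_ae (h.1.mono fun x hx => congrArg ENNReal.ofReal hx)]
      simp
    rw [h1, mul_zero, add_zero]
    refine lintegral_mono_ae (h.1.mono fun x hx => ?_)
    simp [hx]
  · rw [elasticEnergy, if_neg h]
    exact le_top

theorem gammaLimsup_le_elasticEnergy (p : StateSpace Ω) :
    gammaLimsup (extendedEnergy Ω Aw As κ η) p ≤ elasticEnergy Ω As p :=
  (iInf₂_le (fun _ => p) tendsto_const_nhds).trans <|
    (limsup_le_limsup (Eventually.of_forall fun ε => extendedEnergy_le_elasticEnergy ε p)).trans_eq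
      (limsup_const _)

theorem elasticEnergy_le_gammaLiminf (hΩ : IsOpen Ω) (hb : Bornology.IsBounded Ω)
    (hAw : IsElasticityTensor Aw) (hAs : IsElasticityTensor As) (hκ : 0 < κ)
    (hη : ∀ ε, 0 < ε → 0 < η ε) (hα : Tendsto (fun ε => η ε / ε) (𝓝[>] 0) atTop)
    {p : StateSpace Ω}
    (hp : (∀ᵐ x ∂(volume.restrict Ω), p.2 x = 0) → HasL2Strain Ω p.1 → MemH1 Ω p.1) :
    elasticEnergy Ω As p ≤ gammaLiminf (extendedEnergy Ω Aw As κ η) p := by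
  refine le_iInf₂ fun y hy => not_lt.1 fun hlt => ?_
  obtain ⟨b', hb1, hb2⟩ := exists_between hlt
  lift b' to ℝ≥0 using hb2.ne_top with b
  -- Parameters with energy below `b` accumulate at 0; restricting the filter to them replaces the
  -- extraction of a subsequence.
  let l : Filter ℝ := 𝓝[>] 0 ⊓ 𝓟 {ε | extendedEnergy Ω Aw As κ η ε (y ε) < b}
  have hl : l ≤ 𝓝[>] 0 := inf_le_left
  have : l.NeBot := frequently_mem_iff_neBot.1 (frequently_lt_of_liminf_lt (by isBoundedDefault) hb1)
  have hpos : ∀ᶠ ε in l, (0 : ℝ) < ε := hl self_mem_nhdsWithin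
  have hlt : ∀ᶠ ε in l, extendedEnergy Ω Aw As κ η ε (y ε) < b :=
    mem_inf_of_right (mem_principal_self _)
  obtain ⟨c, hc, hbounds⟩ := exists_damageBounds Ω hAw hAs
  have H : ∀ᶠ ε in l, DamageBounds Ω As κ c (η ε) ε b (y ε).1 (y ε).2 := by
    filter_upwards [hpos, hlt] with ε hε h
    rw [extendedEnergy] at h
    split_ifs at h with hadm
    · exact hbounds κ (η ε) ε hκ (hη ε hε) hε b _ _ hadm.1 hadm.2 h.le
    · exact absurd h not_top_lt
  have hyl := hy.mono_left hl
  have hpH1 := hp (ae_eq_zero_of_damageBounds hl hyl hκ H)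
    (exists_strain_of_damageBounds hΩ hb hl hyl hκ hc hη hα H)
  exact (elasticEnergy_le_of_damageBounds hΩ hb hAs hl hyl hκ hc hη hα H hpH1).not_gt hb2

theorem hasGammaLimitAt_elasticEnergy (hΩ : IsOpen Ω) (hb : Bornology.IsBounded Ω)
    (hAw : IsElasticityTensor Aw) (hAs : IsElasticityTensor As) (hκ : 0 < κ)
    (hη : ∀ ε, 0 < ε → 0 < η ε) (hα : Tendsto (fun ε => η ε / ε) (𝓝[>] 0) atTop)
    {p : StateSpace Ω}
    (hp : (∀ᵐ x ∂(volume.restrict Ω), p.2 x = 0) → HasL2Strain Ω p.1 → MemH1 Ω p.1) :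
    HasGammaLimitAt (extendedEnergy Ω Aw As κ η) p (elasticEnergy Ω As p) := by
  have h1 := elasticEnergy_le_gammaLiminf hΩ hb hAw hAs hκ hη hα hp
  have h2 := gammaLiminf_le_gammaLimsup (extendedEnergy Ω Aw As κ η) p
  have h3 := gammaLimsup_le_elasticEnergy (Aw := Aw) (As := As) (κ := κ) (η := η) p
  exact ⟨le_antisymm (h2.trans h3) h1, le_antisymm h3 (h1.trans h2)⟩

end GammaConvergence

end BrittleDamage

end

theorem theorem5p1 (n : ℕ) (Ω : Set (BrittleDamage.Space n))
    (hΩ_open : IsOpen Ω) (hΩ_bdd : Bornology.IsBounded Ω)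
    (Aw As : BrittleDamage.Tensor4 n)
    (hAw : BrittleDamage.IsElasticityTensor Aw) (hAs : BrittleDamage.IsElasticityTensor As)
    (κ : ℝ) (hκ : 0 < κ)
    (η : ℝ → ℝ) (hη_pos : ∀ ε, 0 < ε → 0 < η ε)
    (hη_zero : Tendsto η (𝓝[>] 0) (𝓝 0))
    (hα : Tendsto (fun ε => η ε / ε) (𝓝[>] 0) atTop) :
    -- for a Lipschitz boundary, the energies converge to linear elasticity
    (BrittleDamage.HasLipschitzBoundary Ω →
      BrittleDamage.GammaConverges (BrittleDamage.extendedEnergy Ω Aw As κ η)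
        (BrittleDamage.elasticEnergy Ω As)) ∧
    -- for any bounded open set, so they do at every `(u, χ)`, except possibly
    -- where `χ = 0` a.e. and `u` has square integrable strain without being in `H¹`
    (∀ p : BrittleDamage.StateSpace Ω,
      ¬ ((∀ᵐ x ∂(volume.restrict Ω), p.2 x = 0) ∧
          BrittleDamage.HasL2Strain Ω p.1 ∧ ¬ BrittleDamage.MemH1 Ω p.1) →
      BrittleDamage.HasGammaLimitAt (BrittleDamage.extendedEnergy Ω Aw As κ η) p
        (BrittleDamage.elasticEnergy Ω As p)) := by
  have h (p : BrittleDamage.StateSpace Ω) := BrittleDamage.hasGammaLimitAt_elasticEnergy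
    hΩ_open hΩ_bdd hAw hAs hκ hη_pos hα (p := p)
  -- The implication from `L²` strain to `H¹` is Korn regularity in the Lipschitz case, and the
  -- exclusion of the exceptional pairs in general.
  refine ⟨fun hL p => h p fun _ hS => ?_, fun p hp => h p fun h0 hS => ?_⟩
  · exact BrittleDamage.memH1_of_hasL2Strain hΩ_open hΩ_bdd hL (BrittleDamage.integrableOn_fst p) hS
  · exact by_contra fun hH => hp ⟨h0, hS, hH⟩
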